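/- All rings are associative and unital, and modules are right modules unless stated otherwise. Let $A=\bigoplus_{i\in\mathbb Z}A^i$ be a Koszul ring: $A^i=0$ for $i<0$, the ring $A^0$ is semisimple, and the graded right $A$-module $A^0=A/A^+$ (where $A^+=\bigoplus_{i>0}A^i$) has a Koszul resolution, that is, an exact sequence of graded right $A$-modules with degree preserving maps $$\dots\to P_{-2}\xrightarrow{d_{-2}}P_{-1}\xrightarrow{d_{-1}}P_0\to A^0\to 0$$ in which each $P_{-i}$ is projective in the category of graded right $A$-modules and generated by its component of degree $i$. Fix such a resolution $P$ and assume that it is of finite length ($P_{-j}=0$ for $j\gg0$) with finitely generated components (each $P_{-i}$ is a finitely generated $A$-module). Let $\mathcal A=(A,d=0)$ be the differential graded (dg) algebra with underlying graded ring $A$ and zero differential. Write $\{n\}$ for the shift, $(\{n\}M)^i=M^{i+n}$, $d_{\{n\}M}=(-1)^nd_M$. Let $\mathrm{dgHot}(\mathcal A)$ be the homotopy category of dg right $\mathcal A$-modules, and let $\mathrm{dgPer}(\mathcal A)$ be its smallest full triangulated subcategory that contains $\mathcal A$ and is closed under direct summands (it is equivalent to the perfect derived category of $\mathcal A$). For a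 dg module $M$ put $\overline M=M/MA^+$. Let $\heartsuit$ be the heart of the t-structure $(\mathrm{dgPer}^{\le 0},\mathrm{dgPer}^{\ge 0})$ on $\mathrm{dgPer}(\mathcal A)$, where $\mathrm{dgPer}^{\le 0}$ (respectively $\mathrm{dgPer}^{\ge 0}$) consists of the $M$ with $H^i(\overline M)=0$ for $i>0$ (respectively $i<0$). Thus $\heartsuit$ is the full subcategory of $\mathrm{dgHot}(\mathcal A)$ of those $M\in\mathrm{dgPer}(\mathcal A)$ with $H^i(\overline M)=0$ for all $i\ne0$. Let $\mathcal K(A)$ be the dg module with underlying graded module $\bigoplus_{n\ge0}\{n\}P_{-n}$ and differential $$d(p_0,p_{-1},p_{-2},\dots)=\bigl(-d_{-1}(p_{-1}),\,d_{-2}(p_{-2}),\,-d_{-3}(p_{-3}),\dots\bigr).$$ Then $\mathcal K(A)$ is an object of $\heartsuit$, and the following hold. 1. The functor $\operatorname{Hom}_\heartsuit(-,\mathcal K(A))$ takes values in finitely generated left $\operatorname{End}_\heartsuit(\mathcal K(A))$-modules and induces an equivalence $$\heartsuit\;\xrightarrow{\ \sim\ }\;\bigl(\text{finitely generated left }\operatorname{End}_\heartsuit(\mathcal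 K(A))\text{-modules}\bigr)^{\mathrm{op}}.$$ 2. The ring $\operatorname{End}_\heartsuit(\mathcal K(A))$ is isomorphic to the ring of self-extensions $E(A)=\operatorname{Ext}^\bullet_{\mathrm{Mod}(A)}(A^0,A^0)$ of the right $A$-module $A^0$ in the category of (ungraded) right $A$-modules. -/

import Mathlib

universe u v v'

open CategoryTheory

namespace DGKoszul

/-- A family of subgroups is an internal direct sum decomposition if there are projections onto
its members and the members span. -/
theorem isInternal_of_proj {M : Type u} [AddCommGroup M] {D : ℤ → AddSubgroup M}
    (p : ℤ → M →+ M) (h1 : ∀ i, ∀ x ∈ D i, p i x = x)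
    (h2 : ∀ i j, i ≠ j → ∀ x ∈ D j, p i x = 0) (h3 : iSup D = ⊤) : DirectSum.IsInternal D := by
  have key : ∀ (x : DirectSum ℤ fun i => D i) (i : ℤ),
      p i (DirectSum.coeAddMonoidHom D x) = (x i : M) := by
    intro x i
    induction x using DirectSum.induction_on with
    | zero => simp
    | of j y =>
      rw [DirectSum.coeAddMonoidHom_of]
      by_cases h : i = j
      · subst h
        rw [DirectSum.of_eq_same, h1 i y y.2]
      · rw [DirectSum.of_eq_of_ne _ _ _ h, h2 i j h y y.2]; rfl
    | add x y hx hy => simp [hx, hy]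
  constructor
  · intro x y hxy
    refine DFinsupp.ext fun i => Subtype.ext ?_
    have := congrArg (p i) hxy
    rwa [key, key] at this
  · have : (DirectSum.coeAddMonoidHom D).range = ⊤ := by
      rw [eq_top_iff, ← h3, iSup_le_iff]
      intro i x hx
      exact ⟨DirectSum.of (fun i => D i) i ⟨x, hx⟩, by simp⟩
    exact AddMonoidHom.range_eq_top.mp this

/-- The projections belonging to an internal direct sum decomposition. -/
theorem exists_proj {M : Type u} [AddCommGroup M] {D : ℤ → AddSubgroup M}
    (h : DirectSum.IsInternal D) :
    ∃ p : ℤ → M →+ M, (∀ i, ∀ x ∈ D i, p i x = x) ∧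
      (∀ i j, i ≠ j → ∀ x ∈ D j, p i x = 0) ∧ iSup D = ⊤ := by
  let e := AddEquiv.ofBijective (DirectSum.coeAddMonoidHom D) h
  have he : ∀ j (x : D j), e.symm (x : M) = DirectSum.of (fun i => D i) j x := by
    intro j x
    rw [AddEquiv.symm_apply_eq]
    exact (DirectSum.coeAddMonoidHom_of D j x).symm
  refine ⟨fun i => ((D i).subtype.comp (DFinsupp.evalAddMonoidHom i)).comp e.symm.toAddMonoidHom,
    ?_, ?_, ?_⟩
  · intro i x hx
    change ((e.symm x i : D i) : M) = x
    rw [he i ⟨x, hx⟩, DirectSum.of_eq_same]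
  · intro i j hij x hx
    change ((e.symm x i : D i) : M) = 0
    rw [he j ⟨x, hx⟩, DirectSum.of_eq_of_ne _ _ _ hij]
    rfl
  · rw [eq_top_iff]
    intro x _
    obtain ⟨y, rfl⟩ := h.2 x
    induction y using DirectSum.induction_on with
    | zero => rw [map_zero]; exact zero_mem _
    | of i y =>
      rw [DirectSum.coeAddMonoidHom_of]
      exact AddSubgroup.mem_iSup_of_mem i y.2
    | add x y hx hy => rw [map_add]; exact add_mem (hx trivial) (hy trivial)

section Modules

variable {A : Type u} [Ring A]

/-- Graded right modules over a graded ring; right modules are modules over `Aᵐᵒᵖ`. -/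
structure GrModule (𝒜 : ℤ → AddSubgroup A) where
  carrier : Type u
  [addCommGroup : AddCommGroup carrier]
  [module : Module Aᵐᵒᵖ carrier]
  deg : ℤ → AddSubgroup carrier
  isInternal : DirectSum.IsInternal deg
  smul_mem : ∀ (i j : ℤ) (x : carrier) (a : A), x ∈ deg i → a ∈ 𝒜 j →
    MulOpposite.op a • x ∈ deg (i + j)

variable {𝒜 : ℤ → AddSubgroup A}

instance : CoeSort (GrModule 𝒜) (Type u) := ⟨GrModule.carrier⟩

attribute [instance] GrModule.addCommGroup GrModule.module

/-- The `A`-linear maps `M → N` that are homogeneous of degree `n`, that is, the morphisms of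
graded modules from `M` to the shift `{n}N`. -/
def homDeg (M N : GrModule 𝒜) (n : ℤ) : AddSubgroup (M →ₗ[Aᵐᵒᵖ] N) where
  carrier := {f | ∀ i, ∀ x ∈ M.deg i, f x ∈ N.deg (i + n)}
  zero_mem' := fun i x _ => by simp
  add_mem' := fun {f g} hf hg i x hx => by
    simpa using add_mem (hf i x hx) (hg i x hx)
  neg_mem' := fun {f} hf i x hx => by
    simpa using neg_mem (hf i x hx)

theorem comp_mem_homDeg {L M N : GrModule 𝒜} {m n k : ℤ} {f : L →ₗ[Aᵐᵒᵖ] M} {g : M →ₗ[Aᵐᵒᵖ] N}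
    (hf : f ∈ homDeg L M m) (hg : g ∈ homDeg M N n) (h : m + n = k) :
    g ∘ₗ f ∈ homDeg L N k := by
  subst h
  intro i x hx
  rw [← add_assoc]
  exact hg _ _ (hf i x hx)

theorem id_mem_homDeg (M : GrModule 𝒜) : LinearMap.id ∈ homDeg M M 0 := fun i x hx => by
  simpa using hx

/-- Projective objects of the category of graded right modules (with degree preserving maps);
the epimorphisms of this category are the surjective morphisms. -/
def IsGrProjective (P : GrModule 𝒜) : Prop :=
  ∀ (M N : GrModule 𝒜) (p : M →ₗ[Aᵐᵒᵖ] N) (f : P →ₗ[Aᵐᵒᵖ] N), p ∈ homDeg M N 0 →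
    Function.Surjective p → f ∈ homDeg P N 0 → ∃ g ∈ homDeg P M 0, p ∘ₗ g = f

variable (𝒜) in
/-- Dg right modules over the dg algebra `(A, d = 0)`. As the differential of the dg algebra
vanishes, the Leibniz rule says that the differential of a dg right module is `A`-linear. -/
structure DGModule extends GrModule 𝒜 where
  d : carrier →ₗ[Aᵐᵒᵖ] carrier
  d_mem : d ∈ homDeg toGrModule toGrModule 1
  d_comp_d : d ∘ₗ d = 0

instance : CoeSort (DGModule 𝒜) (Type u) := ⟨fun M => M.carrier⟩

theorem DGModule.d_d (M : DGModule 𝒜) (x : M) : M.d (M.d x) = 0 :=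
  LinearMap.congr_fun M.d_comp_d x

/-- Morphisms of dg modules: `A`-linear maps of degree zero commuting with the differentials. -/
def dgHom (M N : DGModule 𝒜) : AddSubgroup (M →ₗ[Aᵐᵒᵖ] N) where
  carrier := {f | f ∈ homDeg M.toGrModule N.toGrModule 0 ∧ N.d ∘ₗ f = f ∘ₗ M.d}
  zero_mem' := ⟨zero_mem _, by simp⟩
  add_mem' := fun {f g} hf hg =>
    ⟨add_mem hf.1 hg.1, by rw [LinearMap.comp_add, LinearMap.add_comp, hf.2, hg.2]⟩
  neg_mem' := fun {f} hf =>
    ⟨neg_mem hf.1, by rw [LinearMap.comp_neg, LinearMap.neg_comp, hf.2]⟩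

/-- The category `dgMod` of dg modules. -/
instance : Category (DGModule 𝒜) where
  Hom M N := dgHom M N
  id M := ⟨LinearMap.id, id_mem_homDeg _, by rw [LinearMap.comp_id, LinearMap.id_comp]⟩
  comp f g := ⟨g.1 ∘ₗ f.1, comp_mem_homDeg f.2.1 g.2.1 (add_zero 0), by
    rw [← LinearMap.comp_assoc, g.2.2, LinearMap.comp_assoc, f.2.2, LinearMap.comp_assoc]⟩

instance (M N : DGModule 𝒜) : AddCommGroup (M ⟶ N) := inferInstanceAs (AddCommGroup (dgHom M N))

instance : Preadditive (DGModule 𝒜) where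
  add_comp _ _ _ _ _ _ := Subtype.ext (LinearMap.comp_add _ _ _)
  comp_add _ _ _ _ _ _ := Subtype.ext (LinearMap.add_comp _ _ _)

/-- Two morphisms of dg modules are homotopic if `f - g = d h + h d` for some `A`-linear map `h`
of degree `-1`. -/
def homotopic : HomRel (DGModule 𝒜) := fun M N f g =>
  ∃ h ∈ homDeg M.toGrModule N.toGrModule (-1), f.1 - g.1 = N.d ∘ₗ h + h ∘ₗ M.d

instance : Congruence (homotopic (𝒜 := 𝒜)) where
  equivalence :=
    { refl := fun f => ⟨0, zero_mem _, by simp⟩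
      symm := fun {f g} ⟨h, hh, e⟩ => ⟨-h, neg_mem hh, by
        rw [LinearMap.comp_neg, LinearMap.neg_comp, ← neg_add, ← e, neg_sub]⟩
      trans := fun {f g k} ⟨h, hh, e⟩ ⟨h', hh', e'⟩ => ⟨h + h', add_mem hh hh', by
        rw [LinearMap.comp_add, LinearMap.add_comp, add_add_add_comm, ← e, ← e',
          sub_add_sub_cancel]⟩ }
  comp_left := by
    rintro L M N f g g' ⟨h, hh, e⟩
    refine ⟨h ∘ₗ f.1, comp_mem_homDeg f.2.1 hh (zero_add _), ?_⟩
    change g.1 ∘ₗ f.1 - g'.1 ∘ₗ f.1 = _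
    rw [← LinearMap.sub_comp, e, LinearMap.add_comp, LinearMap.comp_assoc, LinearMap.comp_assoc,
      LinearMap.comp_assoc, f.2.2]
  comp_right := by
    rintro L M N f f' g ⟨h, hh, e⟩
    refine ⟨g.1 ∘ₗ h, comp_mem_homDeg hh g.2.1 (add_zero _), ?_⟩
    change g.1 ∘ₗ f.1 - g.1 ∘ₗ f'.1 = _
    rw [← LinearMap.comp_sub, e, LinearMap.comp_add, ← LinearMap.comp_assoc, ← g.2.2,
      LinearMap.comp_assoc, LinearMap.comp_assoc]

variable (𝒜) in
/-- The homotopy category `dgHot` of dg modules: morphisms are homotopy classes. -/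
abbrev DGHot := Quotient (homotopic (𝒜 := 𝒜))

/-- A dg module as an object of the homotopy category. -/
abbrev toHot (M : DGModule 𝒜) : DGHot 𝒜 := (Quotient.functor homotopic).obj M

instance : Preadditive (DGHot 𝒜) := Quotient.preadditive _ (by
  rintro M N f f' g g' ⟨h, hh, e⟩ ⟨h', hh', e'⟩
  refine ⟨h + h', add_mem hh hh', ?_⟩
  change (f.1 + g.1) - (f'.1 + g'.1) = _
  rw [add_sub_add_comm, e, e', LinearMap.comp_add, LinearMap.add_comp, add_add_add_comm])

/-- The shift `{n}M`, with `({n}M)^i = M^{i+n}` and differential `(-1)^n d`. -/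
def shift (n : ℤ) (M : DGModule 𝒜) : DGModule 𝒜 where
  carrier := M
  deg i := M.deg (i + n)
  isInternal := by
    obtain ⟨p, h1, h2, h3⟩ := exists_proj M.isInternal
    refine isInternal_of_proj (fun i => p (i + n)) (fun i x hx => h1 _ x hx)
      (fun i j hij x hx => h2 _ _ (by omega) x hx) ?_
    rw [← h3]
    exact (Equiv.addRight n).iSup_comp (g := M.deg)
  smul_mem i j x a hx ha := by
    have := M.smul_mem _ j x a hx ha
    rwa [add_right_comm] at this
  d := (n.negOnePow : ℤ) • M.d
  d_mem i x hx := by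
    have := M.d_mem _ x hx
    rw [add_right_comm] at this
    exact zsmul_mem this _
  d_comp_d := by
    rw [LinearMap.smul_comp, LinearMap.comp_smul, M.d_comp_d, smul_zero, smul_zero]

/-- The mapping cone of `f : M → N`: the graded module `N ⊕ {1}M` with differential
`(y, x) ↦ (d y + f x, - d x)`. -/
def cone {M N : DGModule 𝒜} (f : M ⟶ N) : DGModule 𝒜 where
  carrier := N × M
  deg i := (N.deg i).prod (M.deg (i + 1))
  isInternal := by
    obtain ⟨p, h1, h2, h3⟩ := exists_proj M.isInternal
    obtain ⟨q, k1, k2, k3⟩ := exists_proj N.isInternal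
    refine isInternal_of_proj (fun i => (q i).prodMap (p (i + 1)))
      (fun i x hx => Prod.ext (k1 _ _ hx.1) (h1 _ _ hx.2))
      (fun i j hij x hx => Prod.ext (k2 _ _ hij _ hx.1) (h2 _ _ (by omega) _ hx.2)) ?_
    have hN : ∀ y : N, ((y, 0) : N × M) ∈ ⨆ i, (N.deg i).prod (M.deg (i + 1)) := by
      intro y
      have hy : y ∈ iSup N.deg := k3 ▸ AddSubgroup.mem_top y
      have hle : iSup N.deg ≤ (⨆ i, (N.deg i).prod (M.deg (i + 1))).comap
          (AddMonoidHom.inl N M) :=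
        iSup_le fun i z hz => (le_iSup (fun i => (N.deg i).prod (M.deg (i + 1))) i)
          ⟨hz, zero_mem _⟩
      exact hle hy
    have hM : ∀ y : M, ((0, y) : N × M) ∈ ⨆ i, (N.deg i).prod (M.deg (i + 1)) := by
      intro y
      have hy : y ∈ iSup M.deg := h3 ▸ AddSubgroup.mem_top y
      have hle : iSup M.deg ≤ (⨆ i, (N.deg i).prod (M.deg (i + 1))).comap
          (AddMonoidHom.inr N M) :=
        iSup_le fun i z hz => (le_iSup (fun i => (N.deg i).prod (M.deg (i + 1))) (i - 1))
          ⟨zero_mem _, by simpa using hz⟩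
      exact hle hy
    rw [eq_top_iff]
    rintro ⟨y, x⟩ -
    simpa using add_mem (hN y) (hM x)
  smul_mem i j x a hx ha := by
    refine ⟨N.smul_mem _ j _ a hx.1 ha, ?_⟩
    have := M.smul_mem _ j _ a hx.2 ha
    rwa [add_right_comm] at this
  d := (N.d.coprod f.1).prod (-(M.d ∘ₗ LinearMap.snd Aᵐᵒᵖ N M))
  d_mem i x hx := by
    refine ⟨?_, ?_⟩
    · have := f.2.1 _ _ hx.2
      rw [add_zero] at this
      exact add_mem (N.d_mem _ _ hx.1) this
    · exact (M.deg _).neg_mem (M.d_mem _ _ hx.2)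
  d_comp_d := by
    refine LinearMap.ext fun x => ?_
    have h : N.d (f.1 x.2) = f.1 (M.d x.2) := LinearMap.congr_fun f.2.2 x.2
    refine Prod.ext ?_ ?_
    · change N.d (N.d x.1 + f.1 x.2) + f.1 (-(M.d x.2)) = 0
      rw [map_add, N.d_d, h, map_neg, zero_add, add_neg_cancel]
    · change -(M.d (-(M.d x.2))) = 0
      rw [map_neg, M.d_d, neg_zero, neg_zero]

variable (𝒜) in
/-- `A` as a dg right module over `(A, d = 0)`. -/
def regular [GradedRing 𝒜] : DGModule 𝒜 where
  carrier := A
  deg := 𝒜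
  isInternal := DirectSum.Decomposition.isInternal 𝒜
  smul_mem i j x a hx ha := SetLike.mul_mem_graded hx ha
  d := 0
  d_mem := zero_mem _
  d_comp_d := by simp

variable (𝒜) in
/-- The objects of the category of perfect dg modules: the smallest full triangulated subcategory
of the homotopy category that contains `A` and is closed under direct summands. Every
distinguished triangle of the homotopy category is isomorphic to the triangle of a mapping cone,
so closure under shifts, mapping cones and isomorphism describes the triangulated subcategories.
A retract `X` of `Y` is a direct summand of `Y`, with complement the cone of `X → Y`; closure
under isomorphism is a special case. -/
inductive IsPerfect [GradedRing 𝒜] : DGHot 𝒜 → Prop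
  | regular : IsPerfect (toHot (regular 𝒜))
  | shift (n : ℤ) (M : DGModule 𝒜) : IsPerfect (toHot M) → IsPerfect (toHot (shift n M))
  | cone {M N : DGModule 𝒜} (f : M ⟶ N) : IsPerfect (toHot M) → IsPerfect (toHot N) →
      IsPerfect (toHot (cone f))
  | summand {X Y : DGHot 𝒜} : Retract X Y → IsPerfect Y → IsPerfect X

variable (𝒜) in
/-- The right ideal `A⁺` generated by the homogeneous elements of positive degree; for a
positively graded ring it is the sum of the components of positive degree. -/
def posIdeal : Submodule Aᵐᵒᵖ A := Submodule.span Aᵐᵒᵖ {a | ∃ i, 0 < i ∧ a ∈ 𝒜 i}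

/-- The submodule `M A⁺` of `M`. -/
def mulPos (M : GrModule 𝒜) : Submodule Aᵐᵒᵖ M :=
  Submodule.span Aᵐᵒᵖ {x | ∃ (m : M) (a : A), a ∈ posIdeal 𝒜 ∧ x = MulOpposite.op a • m}

/-- The quotient `M / M A⁺ = M ⊗_A A⁰`. -/
abbrev Bar (M : DGModule 𝒜) : Type u := M ⧸ mulPos M.toGrModule

/-- The differential induced on `M / M A⁺`. -/
def barD (M : DGModule 𝒜) : Bar M →ₗ[Aᵐᵒᵖ] Bar M :=
  Submodule.mapQ _ _ M.d (by
    refine Submodule.span_le.mpr ?_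
    rintro _ ⟨m, a, ha, rfl⟩
    change M.d _ ∈ mulPos M.toGrModule
    rw [map_smul]
    exact Submodule.subset_span ⟨_, a, ha, rfl⟩)

/-- The component of degree `i` of `M / M A⁺`. -/
def barDeg (M : DGModule 𝒜) (i : ℤ) : AddSubgroup (Bar M) :=
  (M.deg i).map (mulPos M.toGrModule).mkQ.toAddMonoidHom

/-- The cocycles of degree `i` of `M / M A⁺`. -/
def barCocycles (M : DGModule 𝒜) (i : ℤ) : AddSubgroup (Bar M) :=
  barDeg M i ⊓ (barD M).toAddMonoidHom.ker

/-- The coboundaries of degree `i` of `M / M A⁺`. -/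
def barCoboundaries (M : DGModule 𝒜) (i : ℤ) : AddSubgroup (Bar M) :=
  (barDeg M (i - 1)).map (barD M).toAddMonoidHom

/-- The support of the cohomology of `M / M A⁺`: the degrees in which not every cocycle is a
coboundary. -/
def suppBar (M : DGModule 𝒜) : Set ℤ := {i | ¬ barCocycles M i ≤ barCoboundaries M i}

variable (𝒜) in
/-- The full subcategory `dgPer^I` of perfect dg modules `M` such that the cohomology of
`M / M A⁺` is supported in `I`. -/
def perIn [GradedRing 𝒜] (I : Set ℤ) : ObjectProperty (DGHot 𝒜) :=
  fun X => IsPerfect 𝒜 X ∧ suppBar X.as ⊆ I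

variable (𝒜) in
/-- The heart of the t-structure `(dgPer^{≤ 0}, dgPer^{≥ 0})`, as a property of objects. -/
def heart [GradedRing 𝒜] : ObjectProperty (DGHot 𝒜) :=
  perIn 𝒜 (Set.Iic 0) ⊓ perIn 𝒜 (Set.Ici 0)

variable (𝒜) in
/-- The heart as a category, a full subcategory of the homotopy category. -/
abbrev Heart [GradedRing 𝒜] := (heart 𝒜).FullSubcategory

variable (𝒜) in
/-- The right `A`-module `A⁰ = A / A⁺`. -/
abbrev degZero : Type u := A ⧸ posIdeal 𝒜

variable (𝒜) in
/-- Koszul resolutions `⋯ → P₋₂ → P₋₁ → P₀ → A⁰`, in the category of graded right modules, of the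
graded right module `A⁰ = A / A⁺`, with `X i` in the role of `P₋ᵢ`: each `P₋ᵢ` is projective in
the category of graded modules and generated by its component of degree `i`. -/
structure KoszulResolution where
  X : ℕ → GrModule 𝒜
  d : ∀ n, X (n + 1) →ₗ[Aᵐᵒᵖ] X n
  d_mem : ∀ n, d n ∈ homDeg (X (n + 1)) (X n) 0
  ε : X 0 →ₗ[Aᵐᵒᵖ] degZero 𝒜
  ε_mem : ∀ i, ∀ x ∈ (X 0).deg i, ε x ∈ (𝒜 i).map (posIdeal 𝒜).mkQ.toAddMonoidHom
  exact_succ : ∀ n, Function.Exact (d (n + 1)) (d n)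
  exact_zero : Function.Exact (d 0) ε
  surjective : Function.Surjective ε
  projective : ∀ n, IsGrProjective (X n)
  generated : ∀ n : ℕ, Submodule.span Aᵐᵒᵖ ((X n).deg n : Set (X n)) = ⊤

variable (𝒜) in
/-- Koszul rings: positively graded rings with semisimple degree zero part such that the graded
right module `A⁰ = A / A⁺` has a Koszul resolution. -/
structure IsKoszulRing [GradedRing 𝒜] : Prop where
  positive : ∀ i < 0, 𝒜 i = ⊥
  semisimple : IsSemisimpleRing (𝒜 0)
  resolution : Nonempty (KoszulResolution 𝒜)

/-- `P₋ⱼ = 0` for all large `j`. -/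
def KoszulResolution.FiniteLength (P : KoszulResolution 𝒜) : Prop :=
  ∃ N, ∀ n ≥ N, Subsingleton (P.X n)

/-- Each `P₋ᵢ` is a finitely generated `A`-module. -/
def KoszulResolution.FinitelyGenerated (P : KoszulResolution 𝒜) : Prop :=
  ∀ n, Module.Finite Aᵐᵒᵖ (P.X n)

/-- The differential of `K(A)`: its `n`-th component is `(-1)^{n+1} d₋₍ₙ₊₁₎ (p₋₍ₙ₊₁₎)`. -/
noncomputable def KoszulResolution.kd (P : KoszulResolution 𝒜) :
    (DirectSum ℕ fun n => P.X n) →ₗ[Aᵐᵒᵖ] (DirectSum ℕ fun n => P.X n) :=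
  DirectSum.toModule Aᵐᵒᵖ ℕ _ fun n => match n with
    | 0 => 0
    | n + 1 => ((-1 : ℤ) ^ (n + 1)) • (DirectSum.lof Aᵐᵒᵖ ℕ (fun n => P.X n) n ∘ₗ P.d n)

theorem KoszulResolution.kd_apply (P : KoszulResolution 𝒜) (x : DirectSum ℕ fun n => P.X n)
    (n : ℕ) : P.kd x n = ((-1 : ℤ) ^ (n + 1)) • P.d n (x (n + 1)) := by
  induction x using DirectSum.induction_on with
  | zero => simp
  | of m y =>
    change P.kd (DirectSum.lof Aᵐᵒᵖ ℕ (fun n => P.X n) m y) n =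
      ((-1 : ℤ) ^ (n + 1)) • P.d n (DirectSum.lof Aᵐᵒᵖ ℕ (fun n => P.X n) m y (n + 1))
    rw [KoszulResolution.kd, DirectSum.toModule_lof]
    cases m with
    | zero =>
      rw [DirectSum.lof_eq_of, DirectSum.of_eq_of_ne _ _ _ (Nat.succ_ne_zero n)]
      simp
    | succ m =>
      simp only [LinearMap.smul_apply, LinearMap.comp_apply, DirectSum.smul_apply,
        DirectSum.lof_eq_of]
      by_cases h : n = m
      · subst h
        rw [DirectSum.of_eq_same, DirectSum.of_eq_same]
      · rw [DirectSum.of_eq_of_ne _ _ _ h, DirectSum.of_eq_of_ne _ _ _ (by omega)]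
        simp
  | add x y hx hy => simp [hx, hy]

/-- The dg module `K(A)`: the graded module `⨁ₙ {n}P₋ₙ` with the differential `kd`. -/
noncomputable def KoszulResolution.K (P : KoszulResolution 𝒜) : DGModule 𝒜 where
  carrier := DirectSum ℕ fun n => P.X n
  deg i :=
    { carrier := {x | ∀ n : ℕ, x n ∈ (P.X n).deg (i + n)}
      zero_mem' := fun n => zero_mem _
      add_mem' := fun {x y} hx hy n => add_mem (hx n) (hy n)
      neg_mem' := fun {x} hx n => neg_mem (hx n) }
  isInternal := by
    choose p h1 h2 h3 using fun n => exists_proj (P.X n).isInternal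
    refine isInternal_of_proj (fun i => DirectSum.map fun n => p n (i + n)) ?_ ?_ ?_
    · intro i x hx
      refine DFinsupp.ext fun n => ?_
      exact (DirectSum.map_apply _ _ _).trans (h1 n _ _ (hx n))
    · intro i j hij x hx
      refine DFinsupp.ext fun n => ?_
      exact (DirectSum.map_apply _ _ _).trans (h2 n _ _ (by omega) _ (hx n))
    · rw [eq_top_iff]
      intro x _
      induction x using DirectSum.induction_on with
      | zero => exact zero_mem _
      | of n y =>
        have hy : y ∈ iSup (P.X n).deg := h3 n ▸ AddSubgroup.mem_top y
        refine AddSubgroup.mem_comap.mp ((?_ : iSup (P.X n).deg ≤ AddSubgroup.comap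
          (DirectSum.of (fun n => (P.X n : Type u)) n) _) hy)
        refine iSup_le fun i z hz => ?_
        refine AddSubgroup.mem_comap.mpr (AddSubgroup.mem_iSup_of_mem (i - n) ?_)
        intro m
        by_cases h : m = n
        · subst h
          rw [DirectSum.of_eq_same]
          simpa using hz
        · rw [DirectSum.of_eq_of_ne _ _ _ h]
          exact zero_mem _
      | add x y hx hy => exact add_mem (hx trivial) (hy trivial)
  smul_mem i j x a hx ha n := by
    have := (P.X n).smul_mem _ j _ a (hx n) ha
    rw [add_right_comm] at this
    exact this
  d := P.kd
  d_mem i x hx n := by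
    rw [P.kd_apply]
    have := P.d_mem n _ _ (hx (n + 1))
    have e : i + ((n + 1 : ℕ) : ℤ) + 0 = i + 1 + n := by push_cast; ring
    rw [e] at this
    exact zsmul_mem this _
  d_comp_d := by
    refine LinearMap.ext fun x => DFinsupp.ext fun n => ?_
    refine (P.kd_apply _ n).trans ?_
    rw [P.kd_apply, map_zsmul, (P.exact_succ n).apply_apply_eq_zero]
    simp

end Modules

section ExtRing

open Abelian

section

variable {C : Type v'} [Category.{v} C] [Abelian C] [HasExt.{u} C] (M : C)

/-- The product on `⨁ₙ Extⁿ(M, M)` is the composition product: `x * y` is `x` after `y`. -/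
noncomputable instance extGMul : GradedMonoid.GMul fun n : ℕ => Ext.{u} M M n where
  mul {i j} x y := y.comp x (add_comm j i)

noncomputable instance extGOne : GradedMonoid.GOne fun n : ℕ => Ext.{u} M M n where
  one := Ext.mk₀ (𝟙 M)

noncomputable instance extGMonoid : GradedMonoid.GMonoid fun n : ℕ => Ext.{u} M M n where
  one_mul := by
    rintro ⟨n, x⟩
    have : ∀ m (h : n + 0 = m), HEq (x.comp (Ext.mk₀ (𝟙 M)) h) x := by
      rintro m rfl
      exact heq_of_eq (Ext.comp_mk₀_id x)
    exact Sigma.ext (zero_add n) (this _ (add_comm n 0))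
  mul_one := by
    rintro ⟨n, x⟩
    have : ∀ m (h : 0 + n = m), HEq ((Ext.mk₀ (𝟙 M)).comp x h) x := by
      rintro m h
      obtain rfl : n = m := by omega
      exact heq_of_eq (Ext.mk₀_id_comp x)
    exact Sigma.ext (add_zero n) (this _ (add_comm 0 n))
  mul_assoc := by
    rintro ⟨a, x⟩ ⟨b, y⟩ ⟨c, z⟩
    have : ∀ m m' (h : c + (a + b) = m) (h' : (b + c) + a = m'),
        HEq (z.comp (y.comp x (add_comm b a)) h) ((z.comp y (add_comm c b)).comp x h') := by
      rintro m m' h h'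
      obtain rfl : m = m' := by omega
      exact heq_of_eq (Ext.comp_assoc z y x (add_comm c b) (add_comm b a) (by omega)).symm
    exact Sigma.ext (add_assoc a b c) (this _ _ (add_comm c (a + b)) (add_comm (b + c) a))

/-- The graded ring structure on `⨁ₙ Extⁿ(M, M)`. -/
noncomputable instance extGRing : DirectSum.GRing fun n : ℕ => Ext.{u} M M n where
  mul_zero _ := Ext.zero_comp _ _ _ _ _
  zero_mul _ := Ext.comp_zero _ _ _ _ _
  mul_add _ _ _ := Ext.add_comp _ _ _ _
  add_mul _ _ _ := Ext.comp_add _ _ _ _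
  natCast n := n • Ext.mk₀ (𝟙 M)
  natCast_zero := zero_smul _ _
  natCast_succ n := succ_nsmul _ n
  intCast n := n • Ext.mk₀ (𝟙 M)
  intCast_ofNat n := natCast_zsmul _ n
  intCast_negSucc_ofNat n := negSucc_zsmul _ n

end

/-- The ring `E(A) = Ext^•(A⁰, A⁰)` of self-extensions of the right module `A⁰ = A / A⁺` in the
category of (ungraded) right `A`-modules. -/
abbrev KoszulDual {A : Type u} [Ring A] (𝒜 : ℤ → AddSubgroup A) : Type u :=
  DirectSum ℕ fun n =>
    Ext.{u} (ModuleCat.of Aᵐᵒᵖ (degZero 𝒜)) (ModuleCat.of Aᵐᵒᵖ (degZero 𝒜)) n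

end ExtRing

end DGKoszul

namespace DGKoszul

set_option linter.unusedSectionVars false

/-! ### Complexes of homogeneous maps, and dévissage over perfect dg modules. -/

section Perfect

variable {A : Type u} [Ring A] {𝒜 : ℤ → AddSubgroup A}

/-- The projection of a graded module onto its component of degree `i`. -/
noncomputable def GrModule.proj (M : GrModule 𝒜) : ℤ → M →+ M :=
  (exists_proj M.isInternal).choose

theorem GrModule.proj_of_mem (M : GrModule 𝒜) {i : ℤ} {x : M} (hx : x ∈ M.deg i) :
    M.proj i x = x :=
  (exists_proj M.isInternal).choose_spec.1 i x hx

theorem GrModule.proj_of_mem_ne (M : GrModule 𝒜) {i j : ℤ} (hij : i ≠ j) {x : M}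
    (hx : x ∈ M.deg j) : M.proj i x = 0 :=
  (exists_proj M.isInternal).choose_spec.2.1 i j hij x hx

theorem GrModule.iSup_deg (M : GrModule 𝒜) : iSup M.deg = ⊤ :=
  (exists_proj M.isInternal).choose_spec.2.2

@[elab_as_elim]
theorem GrModule.homogeneous_induction (M : GrModule 𝒜) {p : M → Prop} (x : M)
    (mem : ∀ i, ∀ x ∈ M.deg i, p x) (zero : p 0) (add : ∀ x y, p x → p y → p (x + y)) : p x :=
  AddSubgroup.iSup_induction M.deg (C := p) (M.iSup_deg ▸ AddSubgroup.mem_top x) mem zero add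

theorem GrModule.proj_mem (M : GrModule 𝒜) (i : ℤ) (x : M) : M.proj i x ∈ M.deg i := by
  induction x using M.homogeneous_induction with
  | mem j x hx =>
    by_cases h : i = j
    · subst h; rwa [M.proj_of_mem hx]
    · rw [M.proj_of_mem_ne h hx]; exact zero_mem _
  | zero => rw [map_zero]; exact zero_mem _
  | add x y hx hy => rw [map_add]; exact add_mem hx hy

theorem proj_apply_of_mem_homDeg {M N : GrModule 𝒜} {n : ℤ} {f : M →ₗ[Aᵐᵒᵖ] N}
    (hf : f ∈ homDeg M N n) (i j : ℤ) (h : i + n = j) (x : M) :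
    N.proj j (f x) = f (M.proj i x) := by
  induction x using M.homogeneous_induction with
  | mem k x hx =>
    by_cases hik : i = k
    · subst hik; rw [M.proj_of_mem hx, N.proj_of_mem (h ▸ hf _ _ hx)]
    · rw [M.proj_of_mem_ne hik hx, N.proj_of_mem_ne (by omega) (hf _ _ hx), map_zero]
  | zero => simp
  | add x y hx hy => simp [hx, hy]

/-- Cycles of degree `s` in the complex of homogeneous maps, with an arbitrary sign `ε`. -/
def IsCycle (M N : DGModule 𝒜) (s : ℤ) (ε : ℤˣ) (f : M →ₗ[Aᵐᵒᵖ] N) : Prop :=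
  f ∈ homDeg M.toGrModule N.toGrModule s ∧ ∀ x, N.d (f x) = (ε : ℤ) • f (M.d x)

/-- Boundaries of degree `s` in the complex of homogeneous maps. -/
def IsBoundary (M N : DGModule 𝒜) (s : ℤ) (ε : ℤˣ) (f : M →ₗ[Aᵐᵒᵖ] N) : Prop :=
  ∃ h ∈ homDeg M.toGrModule N.toGrModule (s - 1), ∀ x, f x = N.d (h x) + (ε : ℤ) • h (M.d x)

/-- The complex of homogeneous maps from `M` to `N` is exact in degree `s`. -/
def Null (M N : DGModule 𝒜) (s : ℤ) : Prop :=
  ∀ ε f, IsCycle M N s ε f → IsBoundary M N s ε f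

/-- The identity as a map into the shift. -/
def toShift (n : ℤ) (M : DGModule 𝒜) : M →ₗ[Aᵐᵒᵖ] shift n M :=
  (LinearMap.id : M →ₗ[Aᵐᵒᵖ] M)

/-- The identity as a map out of the shift. -/
def ofShift (n : ℤ) (M : DGModule 𝒜) : shift n M →ₗ[Aᵐᵒᵖ] M :=
  (LinearMap.id : M →ₗ[Aᵐᵒᵖ] M)

theorem ofShift_toShift (n : ℤ) (M : DGModule 𝒜) (x : M) :
    ofShift n M (toShift n M x) = x := rfl

theorem toShift_mem (n : ℤ) (M : DGModule 𝒜) :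
    toShift n M ∈ homDeg M.toGrModule (shift n M).toGrModule (-n) := fun i x hx => by
  change x ∈ M.deg (i + -n + n)
  simpa using hx

theorem ofShift_mem (n : ℤ) (M : DGModule 𝒜) :
    ofShift n M ∈ homDeg (shift n M).toGrModule M.toGrModule n := fun _ _ hx => hx

theorem shift_d_toShift (n : ℤ) (M : DGModule 𝒜) (x : M) :
    (shift n M).d (toShift n M x) = (n.negOnePow : ℤ) • toShift n M (M.d x) := rfl

theorem ofShift_d (n : ℤ) (M : DGModule 𝒜) (x : shift n M) :
    ofShift n M ((shift n M).d x) = (n.negOnePow : ℤ) • M.d (ofShift n M x) := rfl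

/-- The sign in the differential of the shift is absorbed into ε. Quantifying `Null` over all signs,
instead of tying ε to the parity of s, makes this possible. -/
theorem Null.shift {M N : DGModule 𝒜} {s n : ℤ} (h : Null M N (s - n)) :
    Null (shift n M) N s := by
  rintro ε f ⟨hf, hfd⟩
  obtain ⟨k, hk, e⟩ := h (ε * n.negOnePow) (f ∘ₗ toShift n M)
    ⟨comp_mem_homDeg (toShift_mem n M) hf (by ring), fun x => by
      rw [LinearMap.comp_apply, hfd, shift_d_toShift, map_zsmul, smul_smul]; rfl⟩
  refine ⟨k ∘ₗ ofShift n M, comp_mem_homDeg (ofShift_mem n M) hk (by ring), fun x => ?_⟩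
  rw [LinearMap.comp_apply, LinearMap.comp_apply, ofShift_d, map_zsmul, smul_smul]
  exact e (ofShift n M x)

section Cone

variable {M N : DGModule 𝒜} (f : M ⟶ N)

/-- The inclusion of the target into the mapping cone. -/
def coneInl : N →ₗ[Aᵐᵒᵖ] cone f := LinearMap.inl Aᵐᵒᵖ N M

/-- The inclusion of the shifted source into the mapping cone. -/
def coneInr : M →ₗ[Aᵐᵒᵖ] cone f := LinearMap.inr Aᵐᵒᵖ N M

/-- The projection of the mapping cone to the target. -/
def coneFst : cone f →ₗ[Aᵐᵒᵖ] N := LinearMap.fst Aᵐᵒᵖ N M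

/-- The projection of the mapping cone to the source. -/
def coneSnd : cone f →ₗ[Aᵐᵒᵖ] M := LinearMap.snd Aᵐᵒᵖ N M

@[simp] theorem coneFst_inl (y : N) : coneFst f (coneInl f y) = y := rfl
@[simp] theorem coneSnd_inl (y : N) : coneSnd f (coneInl f y) = 0 := rfl
@[simp] theorem coneFst_inr (x : M) : coneFst f (coneInr f x) = 0 := rfl
@[simp] theorem coneSnd_inr (x : M) : coneSnd f (coneInr f x) = x := rfl

theorem coneInl_fst_add (z : cone f) : coneInl f (coneFst f z) + coneInr f (coneSnd f z) = z := by
  obtain ⟨y, x⟩ := z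
  exact Prod.ext (add_zero y) (zero_add x)

theorem cone_d_inl (y : N) : (cone f).d (coneInl f y) = coneInl f (N.d y) := by
  refine Prod.ext ?_ ?_
  · change N.d y + f.1 0 = N.d y
    rw [map_zero, add_zero]
  · change -(M.d 0) = 0
    rw [map_zero, neg_zero]

theorem cone_d_inr (x : M) :
    (cone f).d (coneInr f x) = coneInl f (f.1 x) - coneInr f (M.d x) := by
  refine Prod.ext ?_ ?_
  · change N.d 0 + f.1 x = f.1 x - 0
    rw [map_zero, zero_add, sub_zero]
  · exact (zero_sub (M.d x)).symm

theorem coneFst_d (z : cone f) :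
    coneFst f ((cone f).d z) = N.d (coneFst f z) + f.1 (coneSnd f z) := rfl

theorem coneSnd_d (z : cone f) : coneSnd f ((cone f).d z) = -(M.d (coneSnd f z)) := rfl

theorem coneInl_mem : coneInl f ∈ homDeg N.toGrModule (cone f).toGrModule 0 := fun i x hx => by
  rw [add_zero]; exact ⟨hx, zero_mem _⟩

theorem coneInr_mem : coneInr f ∈ homDeg M.toGrModule (cone f).toGrModule (-1) := fun i x hx =>
  ⟨zero_mem _, by change x ∈ M.deg (i + -1 + 1); simpa using hx⟩

theorem coneFst_mem : coneFst f ∈ homDeg (cone f).toGrModule N.toGrModule 0 := fun i x hx => by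
  rw [add_zero]; exact hx.1

theorem coneSnd_mem : coneSnd f ∈ homDeg (cone f).toGrModule M.toGrModule 1 := fun _ _ hx => hx.2

/-- A map out of the mapping cone is null if its restriction to the target is a boundary, and the
correction of its restriction to the source is. -/
theorem isBoundary_cone {f : M ⟶ N} {Y : DGModule 𝒜} {s : ℤ} {ε : ℤˣ} {g : cone f →ₗ[Aᵐᵒᵖ] Y}
    {h₁ : N →ₗ[Aᵐᵒᵖ] Y} (hh₁ : h₁ ∈ homDeg N.toGrModule Y.toGrModule (s - 1))
    (e₁ : ∀ y, g (coneInl f y) = Y.d (h₁ y) + (ε : ℤ) • h₁ (N.d y))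
    (h₂ : IsBoundary M Y (s - 1) (-ε) (g ∘ₗ coneInr f - (ε : ℤ) • (h₁ ∘ₗ f.1))) :
    IsBoundary (cone f) Y s ε g := by
  obtain ⟨h₂, hh₂, e₂⟩ := h₂
  refine ⟨h₁ ∘ₗ coneFst f + h₂ ∘ₗ coneSnd f, add_mem (comp_mem_homDeg (coneFst_mem f) hh₁ (by ring))
    (comp_mem_homDeg (coneSnd_mem f) hh₂ (by ring)), fun z => ?_⟩
  have := e₂ (coneSnd f z)
  simp only [LinearMap.sub_apply, LinearMap.comp_apply, LinearMap.smul_apply, sub_eq_iff_eq_add]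
    at this
  conv_lhs => rw [← coneInl_fst_add f z, map_add, e₁, this]
  simp only [LinearMap.add_apply, LinearMap.comp_apply, coneFst_d, coneSnd_d, map_add, map_neg,
    smul_add, smul_neg, Units.val_neg, neg_smul]
  abel

/-- Subtracting from g the boundary of h₁ extended by zero kills its restriction to N. What remains
on M is closed, in degree one lower and with the opposite sign because of the shift in the cone. -/
theorem isCycle_cone_correction {f : M ⟶ N} {Y : DGModule 𝒜} {s : ℤ} {ε : ℤˣ}
    {g : cone f →ₗ[Aᵐᵒᵖ] Y} (hg : IsCycle (cone f) Y s ε g)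
    {h₁ : N →ₗ[Aᵐᵒᵖ] Y} (hh₁ : h₁ ∈ homDeg N.toGrModule Y.toGrModule (s - 1))
    (e₁ : ∀ y, g (coneInl f y) = Y.d (h₁ y) + (ε : ℤ) • h₁ (N.d y)) :
    IsCycle M Y (s - 1) (-ε) (g ∘ₗ coneInr f - (ε : ℤ) • (h₁ ∘ₗ f.1)) := by
  refine ⟨sub_mem (comp_mem_homDeg (coneInr_mem f) hg.1 (by ring))
    (zsmul_mem (comp_mem_homDeg f.2.1 hh₁ (by ring)) _), fun x => ?_⟩
  have h1 := hg.2 (coneInr f x)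
  have hf : N.d (f.1 x) = f.1 (M.d x) := LinearMap.congr_fun f.2.2 x
  rw [cone_d_inr, map_sub, e₁, hf] at h1
  simp only [LinearMap.sub_apply, LinearMap.comp_apply, LinearMap.smul_apply, map_sub, map_zsmul,
    h1]
  have hε : ∀ y : Y, (ε : ℤ) • (ε : ℤ) • y = y := by
    intro y
    rcases Int.units_eq_one_or ε with rfl | rfl <;> simp
  simp only [smul_sub, smul_add, hε, Units.val_neg, neg_smul]
  abel

theorem IsCycle.comp_inl {f : M ⟶ N} {Y : DGModule 𝒜} {s : ℤ} {ε : ℤˣ}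
    {g : cone f →ₗ[Aᵐᵒᵖ] Y} (hg : IsCycle (cone f) Y s ε g) :
    IsCycle N Y s ε (g ∘ₗ coneInl f) :=
  ⟨comp_mem_homDeg (coneInl_mem f) hg.1 (by ring), fun x => by
    rw [LinearMap.comp_apply, hg.2, cone_d_inl]; rfl⟩

/-- The piece Hˢ⁻¹(M, Y) → Hˢ(cone f, Y) → Hˢ(N, Y) of the long exact sequence. -/
theorem Null.cone {f : M ⟶ N} {Y : DGModule 𝒜} {s : ℤ} (hN : Null N Y s)
    (hM : Null M Y (s - 1)) : Null (cone f) Y s := by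
  intro ε g hg
  obtain ⟨h₁, hh₁, e₁⟩ := hN ε _ hg.comp_inl
  exact isBoundary_cone hh₁ e₁ (hM _ _ (isCycle_cone_correction hg hh₁ e₁))

end Cone

theorem IsCycle.sub {M N : DGModule 𝒜} {s : ℤ} {ε : ℤˣ} {f g : M →ₗ[Aᵐᵒᵖ] N}
    (hf : IsCycle M N s ε f) (hg : IsCycle M N s ε g) : IsCycle M N s ε (f - g) :=
  ⟨sub_mem hf.1 hg.1, fun x => by simp [hf.2, hg.2, smul_sub]⟩

theorem IsCycle.add {M N : DGModule 𝒜} {s : ℤ} {ε : ℤˣ} {f g : M →ₗ[Aᵐᵒᵖ] N}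
    (hf : IsCycle M N s ε f) (hg : IsCycle M N s ε g) : IsCycle M N s ε (f + g) :=
  ⟨add_mem hf.1 hg.1, fun x => by simp [hf.2, hg.2, smul_add]⟩

theorem IsBoundary.sub {M N : DGModule 𝒜} {s : ℤ} {ε : ℤˣ} {f g : M →ₗ[Aᵐᵒᵖ] N}
    (hf : IsBoundary M N s ε f) (hg : IsBoundary M N s ε g) : IsBoundary M N s ε (f - g) := by
  obtain ⟨h, hh, e⟩ := hf
  obtain ⟨k, hk, e'⟩ := hg
  exact ⟨h - k, sub_mem hh hk, fun x => by simp [e, e', smul_sub]; abel⟩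

theorem DGModule.hom_d {M N : DGModule 𝒜} (f : M ⟶ N) (x : M) : N.d (f.1 x) = f.1 (M.d x) :=
  LinearMap.congr_fun f.2.2 x

theorem IsCycle.comp {L M N : DGModule 𝒜} {s : ℤ} {ε : ℤˣ} {g : M →ₗ[Aᵐᵒᵖ] N}
    (hg : IsCycle M N s ε g) (f : L ⟶ M) : IsCycle L N s ε (g ∘ₗ f.1) :=
  ⟨comp_mem_homDeg f.2.1 hg.1 (by ring), fun x => by
    simp [hg.2, DGModule.hom_d]⟩

theorem IsCycle.postcomp {L M N : DGModule 𝒜} {s : ℤ} {ε : ℤˣ} {f : L →ₗ[Aᵐᵒᵖ] M}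
    (hf : IsCycle L M s ε f) (g : M ⟶ N) : IsCycle L N s ε (g.1 ∘ₗ f) :=
  ⟨comp_mem_homDeg hf.1 g.2.1 (by ring), fun x => by
    simp [hf.2, DGModule.hom_d]⟩

theorem IsBoundary.comp {L M N : DGModule 𝒜} {s : ℤ} {ε : ℤˣ} {g : M →ₗ[Aᵐᵒᵖ] N}
    (hg : IsBoundary M N s ε g) (f : L ⟶ M) : IsBoundary L N s ε (g ∘ₗ f.1) := by
  obtain ⟨h, hh, e⟩ := hg
  exact ⟨h ∘ₗ f.1, comp_mem_homDeg f.2.1 hh (by ring), fun x => by simp [e, DGModule.hom_d]⟩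

theorem IsBoundary.postcomp {L M N : DGModule 𝒜} {s : ℤ} {ε : ℤˣ} {f : L →ₗ[Aᵐᵒᵖ] M}
    (hf : IsBoundary L M s ε f) (g : M ⟶ N) : IsBoundary L N s ε (g.1 ∘ₗ f) := by
  obtain ⟨h, hh, e⟩ := hf
  exact ⟨g.1 ∘ₗ h, comp_mem_homDeg hh g.2.1 (by ring), fun x => by simp [e, DGModule.hom_d]⟩

theorem isBoundary_sub_of_homotopic {L M N : DGModule 𝒜} {s : ℤ} {ε : ℤˣ} {g : M →ₗ[Aᵐᵒᵖ] N}
    (hg : IsCycle M N s ε g) {f f' : L ⟶ M} (h : homotopic f f') :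
    IsBoundary L N s ε (g ∘ₗ f.1 - g ∘ₗ f'.1) := by
  obtain ⟨h, hh, e⟩ := h
  refine ⟨(ε : ℤ) • (g ∘ₗ h), zsmul_mem (comp_mem_homDeg hh hg.1 (by ring)) _, fun x => ?_⟩
  have e' : f.1 x - f'.1 x = M.d (h x) + h (L.d x) := LinearMap.congr_fun e x
  simp only [LinearMap.sub_apply, LinearMap.comp_apply, ← map_sub, e', map_add,
    LinearMap.smul_apply, map_zsmul, hg.2, smul_smul]
  rcases Int.units_eq_one_or ε with rfl | rfl <;> simp

/-- A cycle f differs from f r i by a boundary, and f r is already a boundary on Y. -/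
theorem Null.retract {X Y N : DGModule 𝒜} {i : X ⟶ Y} {r : Y ⟶ X}
    (h : homotopic (i ≫ r) (𝟙 X)) {s : ℤ} (hY : Null Y N s) : Null X N s := by
  intro ε f hf
  have h1 := (hY ε _ (hf.comp r)).comp i
  have h2 := isBoundary_sub_of_homotopic hf h
  have h3 := h1.sub h2
  convert h3 using 1
  change f = f ∘ₗ r.1 ∘ₗ i.1 - (f ∘ₗ (r.1 ∘ₗ i.1) - f)
  simp

theorem homotopic_iff_isBoundary {M N : DGModule 𝒜} {f g : M ⟶ N} :
    homotopic f g ↔ IsBoundary M N 0 1 (f.1 - g.1) := by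
  constructor
  · rintro ⟨h, hh, e⟩
    exact ⟨h, hh, fun x => by simpa using LinearMap.congr_fun e x⟩
  · rintro ⟨h, hh, e⟩
    exact ⟨h, hh, LinearMap.ext fun x => by simpa using e x⟩

theorem isCycle_hom {M N : DGModule 𝒜} (f : M ⟶ N) : IsCycle M N 0 1 f.1 :=
  ⟨f.2.1, fun x => by simp [DGModule.hom_d]⟩

/-- Cycles of degree zero as morphisms. -/
def IsCycle.hom {M N : DGModule 𝒜} {f : M →ₗ[Aᵐᵒᵖ] N} (hf : IsCycle M N 0 1 f) : M ⟶ N :=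
  ⟨f, hf.1, LinearMap.ext fun x => by simpa using hf.2 x⟩

theorem exists_hom_of_retract {X Y : DGHot 𝒜} (h : Retract X Y) :
    ∃ (i : X.as ⟶ Y.as) (r : Y.as ⟶ X.as), homotopic (i ≫ r) (𝟙 _) := by
  obtain ⟨i, hi⟩ := (Quotient.functor (homotopic (𝒜 := 𝒜))).map_surjective
    (X := X.as) (Y := Y.as) h.i
  obtain ⟨r, hr⟩ := (Quotient.functor (homotopic (𝒜 := 𝒜))).map_surjective
    (X := Y.as) (Y := X.as) h.r
  refine ⟨i, r, (Quotient.functor_map_eq_iff homotopic _ _).1 ?_⟩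
  rw [Functor.map_comp, hi, hr, CategoryTheory.Functor.map_id]
  exact h.retract

/-- A strict retract up to homotopy, as a retract in the homotopy category. -/
def retractOfHomotopic {X Y : DGModule 𝒜} (i : X ⟶ Y) (r : Y ⟶ X)
    (h : homotopic (i ≫ r) (𝟙 X)) : Retract (toHot X) (toHot Y) where
  i := (Quotient.functor homotopic).map i
  r := (Quotient.functor homotopic).map r
  retract := by
    rw [← Functor.map_comp, ← CategoryTheory.Functor.map_id]
    exact (Quotient.functor_map_eq_iff homotopic _ _).2 h

variable [GradedRing 𝒜]

/-- Dévissage for properties of honest dg modules: a retract in the homotopy category is represented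
by morphisms whose composite is only homotopic to the identity. -/
theorem isPerfect_induction {p : DGModule 𝒜 → Prop} (regular : p (regular 𝒜))
    (shift : ∀ n M, p M → p (shift n M))
    (cone : ∀ (M N : DGModule 𝒜) (f : M ⟶ N), p M → p N → p (cone f))
    (retract : ∀ (X Y : DGModule 𝒜) (i : X ⟶ Y) (r : Y ⟶ X), homotopic (i ≫ r) (𝟙 X) →
      p Y → p X) {M : DGModule 𝒜} (hM : IsPerfect 𝒜 (toHot M)) : p M := by
  have : ∀ X : DGHot 𝒜, IsPerfect 𝒜 X → p X.as := by
    intro X hX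
    induction hX with
    | regular => exact regular
    | shift n M _ h => exact shift n M h
    | cone f _ _ h h' => exact cone _ _ f h h'
    | summand h _ h' =>
      obtain ⟨i, r, e⟩ := exists_hom_of_retract h
      exact retract _ _ i r e h'
  exact this _ hM

/-- Acyclic dg modules. -/
def Acyclic (N : DGModule 𝒜) : Prop :=
  ∀ i, ∀ x ∈ N.deg i, N.d x = 0 → ∃ y, N.d y = x

/-- The map `A → N` with a given value at `1`. -/
def fromRegular (N : DGModule 𝒜) (y : N) : regular 𝒜 →ₗ[Aᵐᵒᵖ] N where
  toFun a := MulOpposite.op (show A from a) • y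
  map_add' a b := by rw [← add_smul]; rfl
  map_smul' c a := by rw [RingHom.id_apply, smul_smul]; rfl

theorem fromRegular_mem {N : DGModule 𝒜} {y : N} {s : ℤ} (hy : y ∈ N.deg s) :
    fromRegular N y ∈ homDeg (regular 𝒜).toGrModule N.toGrModule s := fun i a ha => by
  rw [add_comm]
  exact N.smul_mem s i y a hy ha

/-- The unit of `A` as an element of the regular dg module. -/
def regularOne : regular 𝒜 := (1 : A)

theorem regularOne_mem : regularOne ∈ (regular 𝒜).deg 0 := SetLike.one_mem_graded 𝒜

theorem regular_hom_ext {X : Type*} [AddCommGroup X] [Module Aᵐᵒᵖ X]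
    {f g : regular 𝒜 →ₗ[Aᵐᵒᵖ] X} (h : f regularOne = g regularOne) : f = g := by
  refine LinearMap.ext fun a => ?_
  have : a = MulOpposite.op (show A from a) • (regularOne : regular 𝒜) := (one_mul (M := A) a).symm
  rw [this, map_smul, map_smul, h]

theorem fromRegular_one {N : DGModule 𝒜} (y : N) : fromRegular N y regularOne = y := one_smul _ y

/-- Evaluation at 1 identifies maps of degree s out of A with elements of N of degree s. -/
theorem null_regular {N : DGModule 𝒜} {s : ℤ}
    (h : ∀ x ∈ N.deg s, N.d x = 0 → ∃ y, N.d y = x) : Null (regular 𝒜) N s := by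
  rintro ε f ⟨hf, hfd⟩
  have h1 : f regularOne ∈ N.deg s := by simpa using hf 0 regularOne regularOne_mem
  obtain ⟨y, hy⟩ := h _ h1 (by rw [hfd]; exact (congrArg _ (map_zero f)).trans (smul_zero _))
  -- The preimage y need not be homogeneous; its component of degree s - 1 has the same
  -- differential.
  refine ⟨fromRegular N (N.proj (s - 1) y), by simpa using fromRegular_mem (N.proj_mem _ _),
    fun x => ?_⟩
  have h2 : f = N.d ∘ₗ fromRegular N (N.proj (s - 1) y) := by
    refine regular_hom_ext ?_
    rw [LinearMap.comp_apply, fromRegular_one,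
      ← proj_apply_of_mem_homDeg N.d_mem (s - 1) s (by ring), hy, N.proj_of_mem h1]
  have h3 : (regular 𝒜).d x = 0 := rfl
  rw [h3, map_zero, smul_zero, add_zero]
  exact LinearMap.congr_fun h2 x

/-- Perfect dg modules are homotopically projective: clear for A, and inherited by shifts, cones and
retracts. -/
theorem IsPerfect.null_of_acyclic {M N : DGModule 𝒜} (hM : IsPerfect 𝒜 (toHot M))
    (hN : Acyclic N) (s : ℤ) : Null M N s :=
  isPerfect_induction (p := fun M => ∀ s, Null M N s) (fun s => null_regular (hN s))
    (fun _ _ h _ => (h _).shift) (fun _ _ _ h h' s => (h' s).cone (h _))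
    (fun _ _ _ _ e h s => (h s).retract e) hM s

/-- A perfect M is built from finitely many shifts of A. The bound j is uniform in N, which lets it
start the induction in `null_of_null_residue`, where the target changes at every step. -/
theorem IsPerfect.exists_null_of_lt {M : DGModule 𝒜} (hM : IsPerfect 𝒜 (toHot M)) :
    ∃ j : ℤ, ∀ s < j, ∀ N : DGModule 𝒜, (∀ i < 0, N.deg i = ⊥) → Null M N s := by
  refine isPerfect_induction (p := fun M => ∃ j : ℤ, ∀ s < j, ∀ N : DGModule 𝒜,
    (∀ i < 0, N.deg i = ⊥) → Null M N s) ?_ ?_ ?_ ?_ hM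
  · refine ⟨0, fun s hs N hN => null_regular fun x hx _ => ⟨0, ?_⟩⟩
    rw [hN s hs, AddSubgroup.mem_bot] at hx
    rw [hx, map_zero]
  · rintro n M ⟨j, h⟩
    exact ⟨j + n, fun s hs N hN => (h _ (by omega) N hN).shift⟩
  · rintro M N f ⟨j, h⟩ ⟨j', h'⟩
    exact ⟨min j j', fun s hs N hN => (h' s (by omega) N hN).cone (h _ (by omega) N hN)⟩
  · rintro X Y i r e ⟨j, h⟩
    exact ⟨j, fun s hs N hN => (h s hs N hN).retract e⟩

end Perfect

/-! ### Modules killed by A⁺ over a positively graded ring with semisimple A⁰. -/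

section Semisimple

variable {A : Type u} [Ring A] {𝒜 : ℤ → AddSubgroup A} [GradedRing 𝒜]

variable (𝒜) in
/-- Positively graded rings with semisimple component of degree zero. -/
class PosSemisimple : Prop where
  positive : ∀ i < 0, 𝒜 i = ⊥
  semisimple : IsSemisimpleRing (𝒜 0)

theorem mem_posIdeal_of_mem {i : ℤ} (hi : 0 < i) {a : A} (ha : a ∈ 𝒜 i) : a ∈ posIdeal 𝒜 :=
  Submodule.subset_span ⟨i, hi, ha⟩

variable (𝒜) in
@[elab_as_elim]
theorem ring_induction {p : A → Prop} (a : A) (mem : ∀ i, ∀ a ∈ 𝒜 i, p a) (zero : p 0)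
    (add : ∀ a b, p a → p b → p (a + b)) : p a :=
  (regular 𝒜).homogeneous_induction (p := p) a mem zero add

/-- Positive elements act as zero. -/
def IsTrivialMod (𝒜 : ℤ → AddSubgroup A) (X : Type*) [AddCommGroup X] [Module Aᵐᵒᵖ X] : Prop :=
  ∀ a ∈ posIdeal 𝒜, ∀ x : X, MulOpposite.op a • x = 0

section

variable [PosSemisimple 𝒜]

variable (𝒜) in
@[elab_as_elim]
theorem ring_induction_nonneg {p : A → Prop} (a : A) (zero_mem : ∀ a ∈ 𝒜 0, p a)
    (pos_mem : ∀ i > 0, ∀ a ∈ 𝒜 i, p a)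
    (add : ∀ a b, p a → p b → p (a + b)) : p a := by
  refine ring_induction 𝒜 a (fun i a ha => ?_) (zero_mem 0 (AddSubgroup.zero_mem _)) add
  rcases lt_trichotomy i 0 with h | rfl | h
  · rw [PosSemisimple.positive (𝒜 := 𝒜) i h, AddSubgroup.mem_bot] at ha
    exact ha ▸ zero_mem 0 (AddSubgroup.zero_mem _)
  · exact zero_mem a ha
  · exact pos_mem i h a ha

theorem exists_add_mem_posIdeal (a : A) : ∃ b ∈ 𝒜 0, ∃ c ∈ posIdeal 𝒜, a = b + c := by
  refine ring_induction_nonneg 𝒜 a (fun a ha => ⟨a, ha, 0, zero_mem _, (add_zero a).symm⟩)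
    (fun i hi a ha => ⟨0, zero_mem _, a, mem_posIdeal_of_mem hi ha, (zero_add a).symm⟩) ?_
  rintro _ _ ⟨b, hb, c, hc, rfl⟩ ⟨b', hb', c', hc', rfl⟩
  exact ⟨b + b', add_mem hb hb', c + c', add_mem hc hc', add_add_add_comm _ _ _ _⟩

-- Although A⁺ is defined as a right ideal, sums of positive homogeneous elements exhaust it:
-- without negative components, right multiplication keeps a positive degree positive.
@[elab_as_elim]
theorem posIdeal_induction {p : A → Prop} {a : A} (ha : a ∈ posIdeal 𝒜) (zero : p 0)
    (mem : ∀ i > 0, ∀ a ∈ 𝒜 i, p a) (add : ∀ a b, p a → p b → p (a + b)) : p a := by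
  refine Submodule.closure_induction (p := fun a _ => p a) zero (fun x y _ _ => add x y) ?_ ha
  rintro b a ⟨i, hi, ha⟩
  change p (a * b.unop)
  refine ring_induction 𝒜 b.unop (fun j b hb => ?_) (by rwa [mul_zero])
    (fun b b' h h' => by rw [mul_add]; exact add _ _ h h')
  have := SetLike.mul_mem_graded ha hb
  rcases lt_or_ge j 0 with h | h
  · rw [PosSemisimple.positive (𝒜 := 𝒜) j h, AddSubgroup.mem_bot] at hb
    rwa [hb, mul_zero]
  · exact mem (i + j) (by omega) _ this

/-- A⁺ is two-sided; this is what makes the right action of A⁺ on A / A⁺ zero. -/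
theorem mul_mem_posIdeal (b : A) {a : A} (ha : a ∈ posIdeal 𝒜) : b * a ∈ posIdeal 𝒜 := by
  refine posIdeal_induction ha (by rw [mul_zero]; exact zero_mem _) (fun i hi a ha => ?_)
    (fun x y hx hy => by rw [mul_add]; exact add_mem hx hy)
  refine ring_induction_nonneg 𝒜 b (fun b hb => ?_) (fun j hj b hb => ?_)
    (fun x y hx hy => by rw [add_mul]; exact add_mem hx hy)
  · exact mem_posIdeal_of_mem (by omega) (SetLike.mul_mem_graded hb ha)
  · exact mem_posIdeal_of_mem (by omega) (SetLike.mul_mem_graded hb ha)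

theorem isTrivialMod_degZero : IsTrivialMod 𝒜 (degZero 𝒜) := by
  intro a ha x
  obtain ⟨b, rfl⟩ := (posIdeal 𝒜).mkQ_surjective x
  rw [← map_smul, Submodule.mkQ_apply, Submodule.Quotient.mk_eq_zero]
  exact mul_mem_posIdeal b ha

/-- Complements exist over the semisimple component of degree zero, and they are A-stable because
every element of A is a sum of one of degree zero and one of A⁺, which acts as zero. -/
theorem IsTrivialMod.isSemisimpleModule {X : Type*} [AddCommGroup X] [Module Aᵐᵒᵖ X]
    (hX : IsTrivialMod 𝒜 X) : IsSemisimpleModule Aᵐᵒᵖ X := by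
  have := PosSemisimple.semisimple (𝒜 := 𝒜)
  let φ : (𝒜 0)ᵐᵒᵖ →+* Aᵐᵒᵖ :=
    { toFun := fun a => MulOpposite.op (a.unop : A)
      map_one' := rfl
      map_mul' := fun a b => rfl
      map_zero' := rfl
      map_add' := fun a b => rfl }
  let : Module (𝒜 0)ᵐᵒᵖ X := Module.compHom X φ
  have smul_def : ∀ (a : (𝒜 0)ᵐᵒᵖ) (x : X), a • x = MulOpposite.op (a.unop : A) • x :=
    fun _ _ => rfl
  rw [isSemisimpleModule_iff]
  refine ⟨fun W => ?_⟩
  let W₀ : Submodule (𝒜 0)ᵐᵒᵖ X :=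
    { W.toAddSubmonoid with smul_mem' := fun a x hx => W.smul_mem _ hx }
  obtain ⟨V, hV⟩ := exists_isCompl W₀
  refine ⟨{ V.toAddSubmonoid with
    smul_mem' := fun a x hx => ?_ }, ?_⟩
  · obtain ⟨b, hb, c, hc, e⟩ := exists_add_mem_posIdeal (𝒜 := 𝒜) a.unop
    have : a • x = MulOpposite.op (⟨b, hb⟩ : 𝒜 0) • x := by
      rw [smul_def, ← MulOpposite.op_unop a, e, MulOpposite.op_add, add_smul, hX c hc, add_zero]
      rfl
    change a • x ∈ V
    rw [this]
    exact V.smul_mem _ hx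
  · rw [isCompl_iff, Submodule.disjoint_def, codisjoint_iff, Submodule.eq_top_iff'] at hV ⊢
    refine ⟨hV.1, fun x => ?_⟩
    obtain ⟨y, hy, z, hz, e⟩ := Submodule.mem_sup.1 (hV.2 x)
    exact Submodule.mem_sup.2 ⟨y, hy, z, hz, e⟩

/-- The map `A⁰ → X` with a given value at `1`. -/
def IsTrivialMod.fromDegZero {X : Type*} [AddCommGroup X] [Module Aᵐᵒᵖ X]
    (hX : IsTrivialMod 𝒜 X) (x : X) : degZero 𝒜 →ₗ[Aᵐᵒᵖ] X :=
  (posIdeal 𝒜).liftQ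
    { toFun := fun a => MulOpposite.op a • x
      map_add' := fun a b => by rw [MulOpposite.op_add, add_smul]
      map_smul' := fun c a => by
        rw [RingHom.id_apply, smul_smul]; rfl }
    fun a ha => hX a ha x

theorem IsTrivialMod.fromDegZero_one {X : Type*} [AddCommGroup X] [Module Aᵐᵒᵖ X]
    (hX : IsTrivialMod 𝒜 X) (x : X) : hX.fromDegZero x ((posIdeal 𝒜).mkQ 1) = x := by
  change MulOpposite.op (1 : A) • x = x
  rw [MulOpposite.op_one, one_smul]

/-- A⁰ cogenerates the modules killed by A⁺: the surjection of A⁰ onto the submodule generated by x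
splits, and the splitting extends to X by semisimplicity. -/
theorem IsTrivialMod.exists_ne_zero {X : Type*} [AddCommGroup X] [Module Aᵐᵒᵖ X]
    (hX : IsTrivialMod 𝒜 X) {x : X} (hx : x ≠ 0) : ∃ k : X →ₗ[Aᵐᵒᵖ] degZero 𝒜, k x ≠ 0 := by
  have := hX.isSemisimpleModule
  have := (isTrivialMod_degZero (𝒜 := 𝒜)).isSemisimpleModule
  set c := hX.fromDegZero x
  obtain ⟨s, hs⟩ := IsSemisimpleModule.lifting_property c.rangeRestrict c.surjective_rangeRestrict
    LinearMap.id
  obtain ⟨k, hk⟩ := IsSemisimpleModule.extension_property (LinearMap.range c).subtype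
    (Submodule.subtype_injective _) s
  have hxc : x ∈ LinearMap.range c := ⟨_, hX.fromDegZero_one x⟩
  refine ⟨k, fun h => hx ?_⟩
  have h1 : s ⟨x, hxc⟩ = 0 := (LinearMap.congr_fun hk ⟨x, hxc⟩).symm.trans h
  have h2 := LinearMap.congr_fun hs ⟨x, hxc⟩
  rw [LinearMap.comp_apply, h1, map_zero] at h2
  exact (congrArg Subtype.val h2).symm

end

/-- The surjection of V onto the image of g splits, and the splitting extends from the image to W.
-/
theorem exists_regular_of_isSemisimpleModule {R V W : Type*} [Ring R] [AddCommGroup V] [Module R V]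
    [AddCommGroup W] [Module R W] [IsSemisimpleModule R V] [IsSemisimpleModule R W]
    (g : V →ₗ[R] W) : ∃ r : W →ₗ[R] V, g ∘ₗ r ∘ₗ g = g := by
  obtain ⟨s, hs⟩ := IsSemisimpleModule.lifting_property g.rangeRestrict g.surjective_rangeRestrict
    LinearMap.id
  obtain ⟨r, hr⟩ := IsSemisimpleModule.extension_property (LinearMap.range g).subtype
    (Submodule.subtype_injective _) s
  refine ⟨r, LinearMap.ext fun x => ?_⟩
  have h1 := LinearMap.congr_fun hr (g.rangeRestrict x)
  have h2 := congrArg Subtype.val (LinearMap.congr_fun hs (g.rangeRestrict x))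
  exact (congrArg g h1).trans h2

section Concentrated

variable [PosSemisimple 𝒜]

/-- A module on which the positive elements act as zero, as a graded module in degree zero. -/
def concentrated (X : Type u) [AddCommGroup X] [Module Aᵐᵒᵖ X] (hX : IsTrivialMod 𝒜 X) :
    GrModule 𝒜 where
  carrier := X
  deg i := if i = 0 then ⊤ else ⊥
  isInternal := by
    refine isInternal_of_proj (fun i => if i = 0 then AddMonoidHom.id X else 0) ?_ ?_ ?_
    · intro i x hx
      by_cases h : i = 0
      · simp [h]
      · simp only [h, if_false, AddSubgroup.mem_bot] at hx ⊢
        rw [hx]; rfl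
    · intro i j hij x hx
      by_cases h : i = 0
      · have hj : j ≠ 0 := by omega
        simp only [hj, if_false, AddSubgroup.mem_bot] at hx
        rw [hx, map_zero]
      · simp [h]
    · rw [eq_top_iff]
      exact le_iSup_of_le 0 (by simp)
  smul_mem i j x a hx ha := by
    by_cases hi : i = 0
    · rcases lt_trichotomy j 0 with hj | rfl | hj
      · rw [PosSemisimple.positive (𝒜 := 𝒜) j hj, AddSubgroup.mem_bot] at ha
        rw [ha, MulOpposite.op_zero, zero_smul]
        exact zero_mem _
      · simp [hi]
      · rw [hX a (mem_posIdeal_of_mem hj ha)]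
        exact zero_mem _
    · simp only [hi, if_false, AddSubgroup.mem_bot] at hx
      rw [hx, smul_zero]
      exact zero_mem _

variable (𝒜) in
/-- `A⁰` as a dg module in degree zero. -/
def residue : DGModule 𝒜 where
  toGrModule := concentrated (degZero 𝒜) isTrivialMod_degZero
  d := 0
  d_mem := zero_mem _
  d_comp_d := by simp

theorem mem_homDeg_concentrated {M : GrModule 𝒜} {X : Type u} [AddCommGroup X] [Module Aᵐᵒᵖ X]
    {hX : IsTrivialMod 𝒜 X} {s : ℤ} {f : M →ₗ[Aᵐᵒᵖ] X} :
    f ∈ homDeg M (concentrated X hX) s ↔ ∀ i, i + s ≠ 0 → ∀ x ∈ M.deg i, f x = 0 := by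
  refine ⟨fun h i hi x hx => ?_, fun h i x hx => ?_⟩
  · have : f x ∈ (if i + s = 0 then (⊤ : AddSubgroup X) else ⊥) := h i x hx
    simpa [hi] using this
  · change f x ∈ (if i + s = 0 then (⊤ : AddSubgroup X) else ⊥)
    by_cases hi : i + s = 0
    · simp [hi]
    · simp [h i hi x hx]

theorem mem_homDeg_residue {M : GrModule 𝒜} {s : ℤ} {f : M →ₗ[Aᵐᵒᵖ] degZero 𝒜} :
    f ∈ homDeg M (residue 𝒜).toGrModule s ↔ ∀ i, i + s ≠ 0 → ∀ x ∈ M.deg i, f x = 0 :=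
  mem_homDeg_concentrated (hX := isTrivialMod_degZero)

theorem IsTrivialMod.map_mulPos {M : GrModule 𝒜} {X : Type*} [AddCommGroup X] [Module Aᵐᵒᵖ X]
    (hX : IsTrivialMod 𝒜 X) (f : M →ₗ[Aᵐᵒᵖ] X) : mulPos M ≤ LinearMap.ker f := by
  refine Submodule.span_le.2 ?_
  rintro _ ⟨m, a, ha, rfl⟩
  change f _ = 0
  rw [map_smul, hX a ha]

theorem isTrivialMod_bar (M : GrModule 𝒜) : IsTrivialMod 𝒜 (M ⧸ mulPos M) := by
  intro a ha x
  obtain ⟨m, rfl⟩ := (mulPos M).mkQ_surjective x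
  rw [← map_smul, Submodule.mkQ_apply, Submodule.Quotient.mk_eq_zero]
  exact Submodule.subset_span ⟨m, a, ha, rfl⟩

/-- The homogeneous component of a linear map to a module with trivial action. -/
noncomputable def IsTrivialMod.component {M : GrModule 𝒜} {X : Type*} [AddCommGroup X]
    [Module Aᵐᵒᵖ X] (hX : IsTrivialMod 𝒜 X) (f : M →ₗ[Aᵐᵒᵖ] X) (i : ℤ) : M →ₗ[Aᵐᵒᵖ] X where
  toFun x := f (M.proj i x)
  map_add' x y := by simp
  map_smul' b x := by
    rw [RingHom.id_apply]
    -- Elements of degree zero commute with the projection. Elements of positive degree do not, but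
    -- f kills everything they produce.
    refine ring_induction_nonneg 𝒜 b.unop (p := fun a => f (M.proj i (MulOpposite.op a • x)) =
      MulOpposite.op a • f (M.proj i x)) (fun a ha => ?_) (fun j hj a ha => ?_) ?_
    · refine M.homogeneous_induction x (fun k x hx => ?_) (by simp) ?_
      · have h1 := M.smul_mem k 0 x a hx ha
        rw [add_zero] at h1
        by_cases h : i = k
        · subst h
          rw [M.proj_of_mem h1, M.proj_of_mem hx, map_smul]
        · rw [M.proj_of_mem_ne h h1, M.proj_of_mem_ne h hx, map_zero, smul_zero]
      · intro x y hx hy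
        rw [smul_add, map_add, map_add, hx, hy, map_add, map_add, smul_add]
    · have ha' := mem_posIdeal_of_mem hj ha
      rw [hX a ha']
      refine M.homogeneous_induction x (fun k x hx => ?_) (by simp) ?_
      · have h1 := M.smul_mem k j x a hx ha
        by_cases h : i = k + j
        · subst h
          rw [M.proj_of_mem h1, map_smul, hX a ha']
        · rw [M.proj_of_mem_ne h h1, map_zero]
      · intro x y hx hy
        rw [smul_add, map_add, map_add, hx, hy, add_zero]
    · intro a b h h'
      rw [MulOpposite.op_add, add_smul, map_add, map_add, h, h', add_smul]

end Concentrated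

end Semisimple

/-! ### Linear graded modules: projective, finitely generated, generated in degree zero. -/

section Linear

variable {A : Type u} [Ring A] {𝒜 : ℤ → AddSubgroup A}

/-- Finitely generated projective graded modules generated in degree zero. -/
structure GrModule.IsLinear (Y : GrModule 𝒜) : Prop where
  projective : IsGrProjective Y
  generated : Submodule.span Aᵐᵒᵖ (Y.deg 0 : Set Y) = ⊤
  finite : Module.Finite Aᵐᵒᵖ Y

@[elab_as_elim]
theorem generated_induction {Y : GrModule 𝒜} (h : Submodule.span Aᵐᵒᵖ (Y.deg 0 : Set Y) = ⊤)
    {p : Y → Prop} (y : Y) (smul : ∀ a : A, ∀ v ∈ Y.deg 0, p (MulOpposite.op a • v))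
    (zero : p 0) (add : ∀ x y, p x → p y → p (x + y)) : p y := by
  have hy : y ∈ Submodule.span Aᵐᵒᵖ (Y.deg 0 : Set Y) := h ▸ Submodule.mem_top
  exact Submodule.closure_induction (p := fun y _ => p y) zero (fun x y _ _ => add x y)
    (fun a v hv => smul a.unop v hv) hy

theorem generated_hom_ext {Y : GrModule 𝒜} (h : Submodule.span Aᵐᵒᵖ (Y.deg 0 : Set Y) = ⊤)
    {X : Type*} [AddCommGroup X] [Module Aᵐᵒᵖ X] {f g : Y →ₗ[Aᵐᵒᵖ] X}
    (e : ∀ v ∈ Y.deg 0, f v = g v) : f = g :=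
  LinearMap.ext_on h e

/-- A retract of a linear module is linear. -/
theorem GrModule.IsLinear.of_retract {Y Z : GrModule 𝒜} (hZ : Z.IsLinear)
    {i : Y →ₗ[Aᵐᵒᵖ] Z} {r : Z →ₗ[Aᵐᵒᵖ] Y} (hi : i ∈ homDeg Y Z 0) (hr : r ∈ homDeg Z Y 0)
    (h : ∀ y, r (i y) = y) : Y.IsLinear where
  projective M N p f hp hps hf := by
    obtain ⟨g, hg, e⟩ := hZ.projective M N p (f ∘ₗ r) hp hps (comp_mem_homDeg hr hf (add_zero 0))
    refine ⟨g ∘ₗ i, comp_mem_homDeg hi hg (add_zero 0), LinearMap.ext fun x => ?_⟩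
    have := LinearMap.congr_fun e (i x)
    rw [LinearMap.comp_apply, LinearMap.comp_apply, h] at this
    exact this
  generated := by
    have hs : Function.Surjective r := fun y => ⟨i y, h y⟩
    rw [eq_top_iff, ← LinearMap.range_eq_top.2 hs, LinearMap.range_eq_map, ← hZ.generated,
      Submodule.map_span, Submodule.span_le]
    rintro _ ⟨v, hv, rfl⟩
    have := hr 0 v hv
    rw [add_zero] at this
    exact Submodule.subset_span this
  finite := by
    have := hZ.finite
    exact Module.Finite.of_surjective r fun y => ⟨i y, h y⟩

section Bar

variable [GradedRing 𝒜] [PosSemisimple 𝒜]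

theorem proj_eq_zero_of_generated {Y : GrModule 𝒜}
    (h : Submodule.span Aᵐᵒᵖ (Y.deg 0 : Set Y) = ⊤) {i : ℤ} (hi : i < 0) (y : Y) :
    Y.proj i y = 0 := by
  refine generated_induction h y (fun a v hv => ?_) (map_zero _)
    (fun x y hx hy => by rw [map_add, hx, hy, add_zero])
  refine ring_induction_nonneg 𝒜 a (fun a ha => ?_) (fun j hj a ha => ?_)
    (fun a b ha hb => by rw [MulOpposite.op_add, add_smul, map_add, ha, hb, add_zero])
  · exact Y.proj_of_mem_ne (by omega) (Y.smul_mem _ _ _ _ hv ha)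
  · exact Y.proj_of_mem_ne (by omega) (Y.smul_mem _ _ _ _ hv ha)

theorem deg_eq_bot_of_generated {Y : GrModule 𝒜}
    (h : Submodule.span Aᵐᵒᵖ (Y.deg 0 : Set Y) = ⊤) {i : ℤ} (hi : i < 0) : Y.deg i = ⊥ := by
  rw [eq_bot_iff]
  intro y hy
  rw [AddSubgroup.mem_bot, ← Y.proj_of_mem hy, proj_eq_zero_of_generated h hi]

theorem mem_mulPos_of_generated {Y : GrModule 𝒜}
    (h : Submodule.span Aᵐᵒᵖ (Y.deg 0 : Set Y) = ⊤) {i : ℤ} (hi : i ≠ 0) {y : Y}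
    (hy : y ∈ Y.deg i) : y ∈ mulPos Y := by
  rw [← Y.proj_of_mem hy]
  refine generated_induction h y (fun a v hv => ?_) (by rw [map_zero]; exact zero_mem _)
    (fun x y hx hy => by rw [map_add]; exact add_mem hx hy)
  refine ring_induction_nonneg 𝒜 a (fun a ha => ?_) (fun j hj a ha => ?_)
    (fun a b ha hb => by rw [MulOpposite.op_add, add_smul, map_add]; exact add_mem ha hb)
  · rw [Y.proj_of_mem_ne (by omega) (Y.smul_mem _ _ _ _ hv ha)]
    exact zero_mem _
  · by_cases hij : i = 0 + j
    · rw [hij, Y.proj_of_mem (Y.smul_mem _ _ _ _ hv ha)]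
      exact Submodule.subset_span ⟨v, a, mem_posIdeal_of_mem hj ha, rfl⟩
    · rw [Y.proj_of_mem_ne hij (Y.smul_mem _ _ _ _ hv ha)]
      exact zero_mem _

theorem proj_zero_smul_of_pos {Y : GrModule 𝒜}
    (h : Submodule.span Aᵐᵒᵖ (Y.deg 0 : Set Y) = ⊤) {i : ℤ} (hi : i > 0)
    {a : A} (ha : a ∈ 𝒜 i) (m : Y) : Y.proj 0 (MulOpposite.op a • m) = 0 := by
  induction m using Y.homogeneous_induction with
  | mem j m hm =>
    rcases lt_or_ge j 0 with hj | hj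
    · rw [deg_eq_bot_of_generated h hj, AddSubgroup.mem_bot] at hm
      rw [hm, smul_zero, map_zero]
    · exact Y.proj_of_mem_ne (by omega) (Y.smul_mem _ _ _ _ hm ha)
  | zero => rw [smul_zero, map_zero]
  | add x y hx hy => rw [smul_add, map_add, hx, hy, add_zero]

theorem proj_zero_of_mem_mulPos {Y : GrModule 𝒜}
    (h : Submodule.span Aᵐᵒᵖ (Y.deg 0 : Set Y) = ⊤) {y : Y} (hy : y ∈ mulPos Y) :
    Y.proj 0 y = 0 := by
  refine Submodule.closure_induction (p := fun y _ => Y.proj 0 y = 0) (map_zero _)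
    (fun x y _ _ hx hy => by rw [map_add, hx, hy, add_zero]) ?_ hy
  rintro b _ ⟨m, a, ha, rfl⟩
  rw [smul_smul]
  have hab : a * b.unop ∈ posIdeal 𝒜 := (posIdeal 𝒜).smul_mem b ha
  change Y.proj 0 (MulOpposite.op (a * b.unop) • m) = 0
  refine posIdeal_induction hab (by rw [MulOpposite.op_zero, zero_smul, map_zero])
    (fun i hi a ha => ?_)
    (fun a b ha hb => by rw [MulOpposite.op_add, add_smul, map_add, ha, hb, add_zero])
  exact proj_zero_smul_of_pos h hi ha m

/-- Y A⁺ has no component of degree zero. Together with `mem_mulPos_of_generated` this identifies Y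
/ Y A⁺ with the component of degree zero, so maps of linear modules are controlled by their
reductions. -/
theorem eq_zero_of_mem_mulPos {Y : GrModule 𝒜}
    (h : Submodule.span Aᵐᵒᵖ (Y.deg 0 : Set Y) = ⊤) {y : Y} (hy : y ∈ mulPos Y)
    (h0 : y ∈ Y.deg 0) : y = 0 := by
  rw [← Y.proj_of_mem h0, proj_zero_of_mem_mulPos h hy]

/-- The quotient `Y / Y A⁺`, as a graded module in degree zero. -/
def barZero (Y : GrModule 𝒜) : GrModule 𝒜 := concentrated (Y ⧸ mulPos Y) (isTrivialMod_bar Y)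

/-- The projection to `Y / Y A⁺`. -/
def toBarZero (Y : GrModule 𝒜) : Y →ₗ[Aᵐᵒᵖ] barZero Y := (mulPos Y).mkQ

theorem toBarZero_mem {Y : GrModule 𝒜} (h : Submodule.span Aᵐᵒᵖ (Y.deg 0 : Set Y) = ⊤) :
    toBarZero Y ∈ homDeg Y (barZero Y) 0 :=
  mem_homDeg_concentrated.2 fun i hi x hx =>
    (Submodule.Quotient.mk_eq_zero _).2 (mem_mulPos_of_generated h (by omega) hx)

/-- The category of linear modules is von Neumann regular. -/
theorem GrModule.IsLinear.exists_regular {Y Z : GrModule 𝒜} (hY : Y.IsLinear) (hZ : Z.IsLinear)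
    {g : Y →ₗ[Aᵐᵒᵖ] Z} (hg : g ∈ homDeg Y Z 0) :
    ∃ r ∈ homDeg Z Y 0, ∀ y, g (r (g y)) = g y := by
  have := (isTrivialMod_bar Y).isSemisimpleModule
  have := (isTrivialMod_bar Z).isSemisimpleModule
  have hle : mulPos Y ≤ (mulPos Z).comap g := by
    have := (isTrivialMod_bar Z).map_mulPos ((mulPos Z).mkQ ∘ₗ g)
    rwa [LinearMap.ker_comp, Submodule.ker_mkQ] at this
  obtain ⟨s, hs⟩ := exists_regular_of_isSemisimpleModule ((mulPos Y).mapQ (mulPos Z) g hle)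
  -- Graded projectivity of Z lifts the quasi-inverse s of the reduction of g to a map Z → Y of
  -- degree zero.
  obtain ⟨r, hr, e⟩ := hZ.projective Y (barZero Y) (toBarZero Y)
    (show Z →ₗ[Aᵐᵒᵖ] barZero Y from s ∘ₗ (mulPos Z).mkQ) (toBarZero_mem hY.generated)
    (mulPos Y).mkQ_surjective
    (mem_homDeg_concentrated.2 fun i hi x hx => by
      have hx' : (mulPos Z).mkQ x = 0 :=
        (Submodule.Quotient.mk_eq_zero _).2 (mem_mulPos_of_generated hZ.generated (by omega) hx)
      exact (congrArg s hx').trans (map_zero s))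
  refine ⟨r, hr, fun y => ?_⟩
  have hgr : g ∘ₗ r ∘ₗ g ∈ homDeg Y Z 0 :=
    comp_mem_homDeg (comp_mem_homDeg hg hr (add_zero 0)) hg (add_zero 0)
  suffices g ∘ₗ r ∘ₗ g = g from LinearMap.congr_fun this y
  -- On generators both sides lie in the component of degree zero of Z, where equality can be tested
  -- modulo Z A⁺.
  refine generated_hom_ext hY.generated fun v hv => ?_
  rw [← sub_eq_zero]
  have h0 := sub_mem (hgr 0 v hv) (hg 0 v hv)
  rw [add_zero] at h0
  refine eq_zero_of_mem_mulPos hZ.generated ?_ h0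
  rw [← Submodule.Quotient.mk_eq_zero, Submodule.Quotient.mk_sub, sub_eq_zero]
  have e1 : ∀ z : Z, (mulPos Y).mkQ (r z) = s ((mulPos Z).mkQ z) := LinearMap.congr_fun e
  have e2 := LinearMap.congr_fun hs ((mulPos Y).mkQ v)
  have e3 : ∀ y : Y, (mulPos Z).mkQ (g y) = (mulPos Y).mapQ (mulPos Z) g hle ((mulPos Y).mkQ y) :=
    fun _ => rfl
  change (mulPos Z).mkQ (g (r (g v))) = (mulPos Z).mkQ (g v)
  rw [e3, e1, e3]
  exact e2

end Bar

section Corner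

/-- The image of a graded idempotent. -/
def GrModule.corner (Y : GrModule 𝒜) (e : Y →ₗ[Aᵐᵒᵖ] Y) (he : e ∈ homDeg Y Y 0) :
    GrModule 𝒜 where
  carrier := LinearMap.range e
  deg i := (Y.deg i).comap (LinearMap.range e).subtype.toAddMonoidHom
  isInternal := by
    have hp : ∀ i, ∀ x : LinearMap.range e, Y.proj i x ∈ LinearMap.range e := by
      rintro i ⟨_, x, rfl⟩
      exact ⟨Y.proj i x, (proj_apply_of_mem_homDeg he i i (add_zero i) x).symm⟩
    refine isInternal_of_proj (fun i => ((Y.proj i).comp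
      (LinearMap.range e).subtype.toAddMonoidHom).codRestrict
      (LinearMap.range e).toAddSubgroup (hp i)) ?_ ?_ ?_
    · intro i x hx
      exact Subtype.ext (Y.proj_of_mem hx)
    · intro i j hij x hx
      exact Subtype.ext (Y.proj_of_mem_ne hij hx)
    · rw [eq_top_iff]
      rintro ⟨_, x, rfl⟩ -
      induction x using Y.homogeneous_induction with
      | mem i x hx =>
        refine AddSubgroup.mem_iSup_of_mem i ?_
        have := he i x hx
        rwa [add_zero] at this
      | zero =>
        rw [show (⟨e 0, ⟨0, rfl⟩⟩ : LinearMap.range e) = 0 from Subtype.ext (map_zero e)]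
        exact zero_mem _
      | add x y hx hy =>
        rw [show (⟨e (x + y), ⟨x + y, rfl⟩⟩ : LinearMap.range e) = ⟨e x, ⟨x, rfl⟩⟩ + ⟨e y, ⟨y, rfl⟩⟩
          from Subtype.ext (map_add e x y)]
        exact add_mem hx hy
  smul_mem i j x a hx ha := Y.smul_mem i j x a hx ha

end Corner

/-- Finite powers of a graded module. -/
def GrModule.pow (Y : GrModule 𝒜) (n : ℕ) : GrModule 𝒜 where
  carrier := Fin n → Y
  deg i := AddSubgroup.pi Set.univ fun _ => Y.deg i
  isInternal := by
    refine isInternal_of_proj (fun i => AddMonoidHom.mk' (fun x k => Y.proj i (x k))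
      fun x y => funext fun k => map_add _ _ _) ?_ ?_ ?_
    · intro i x hx
      exact funext fun k => Y.proj_of_mem (hx k trivial)
    · intro i j hij x hx
      exact funext fun k => Y.proj_of_mem_ne hij (hx k trivial)
    · rw [eq_top_iff]
      intro x _
      rw [← Finset.univ_sum_single x]
      refine sum_mem fun k _ => ?_
      induction x k using Y.homogeneous_induction with
      | mem i y hy =>
        refine AddSubgroup.mem_iSup_of_mem i fun l _ => ?_
        by_cases h : l = k
        · subst h; simpa using hy
        · simp only [Pi.single_eq_of_ne h]; exact AddSubgroup.zero_mem _
      | zero => rw [Pi.single_zero]; exact zero_mem _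
      | add x y hx hy => rw [Pi.single_add]; exact add_mem hx hy
  smul_mem i j x a hx ha k _ := Y.smul_mem i j _ a (hx k trivial) ha

/-- The projections of a finite power. -/
def GrModule.powProj (Y : GrModule 𝒜) {n : ℕ} (k : Fin n) : Y.pow n →ₗ[Aᵐᵒᵖ] Y :=
  (LinearMap.proj k : (Fin n → Y) →ₗ[Aᵐᵒᵖ] Y)

/-- The inclusions of a finite power. -/
def GrModule.powSingle (Y : GrModule 𝒜) {n : ℕ} (k : Fin n) : Y →ₗ[Aᵐᵒᵖ] Y.pow n :=
  (LinearMap.single Aᵐᵒᵖ (fun _ : Fin n => (Y : Type u)) k)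

/-- Tuples of maps as maps to a finite power. -/
def GrModule.powLift (Y : GrModule 𝒜) {n : ℕ} {X : Type*} [AddCommGroup X] [Module Aᵐᵒᵖ X]
    (f : Fin n → X →ₗ[Aᵐᵒᵖ] Y) : X →ₗ[Aᵐᵒᵖ] Y.pow n :=
  (LinearMap.pi f : X →ₗ[Aᵐᵒᵖ] Fin n → Y)

theorem GrModule.pow_ext (Y : GrModule 𝒜) {n : ℕ} {x y : Y.pow n}
    (h : ∀ k, Y.powProj k x = Y.powProj k y) : x = y := funext h

theorem GrModule.mem_pow_deg (Y : GrModule 𝒜) {n : ℕ} {i : ℤ} {x : Y.pow n} :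
    x ∈ (Y.pow n).deg i ↔ ∀ k, Y.powProj k x ∈ Y.deg i :=
  ⟨fun h k => h k trivial, fun h k _ => h k⟩

theorem GrModule.powProj_single (Y : GrModule 𝒜) {n : ℕ} (k l : Fin n) (y : Y) :
    Y.powProj l (Y.powSingle k y) = if l = k then y else 0 := by
  change (Pi.single k y : Fin n → Y) l = _
  by_cases h : l = k
  · subst h; simp
  · simp [h]

theorem GrModule.powProj_mem (Y : GrModule 𝒜) {n : ℕ} (k : Fin n) :
    Y.powProj k ∈ homDeg (Y.pow n) Y 0 := fun i x hx => by
  rw [add_zero]; exact Y.mem_pow_deg.1 hx k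

theorem GrModule.powSingle_mem (Y : GrModule 𝒜) {n : ℕ} (k : Fin n) :
    Y.powSingle k ∈ homDeg Y (Y.pow n) 0 := fun i x hx => by
  rw [add_zero, Y.mem_pow_deg]
  intro l
  rw [Y.powProj_single]
  split_ifs
  · exact hx
  · exact zero_mem _

theorem GrModule.powLift_mem (Y : GrModule 𝒜) {n : ℕ} {X : GrModule 𝒜} {s : ℤ}
    {f : Fin n → X →ₗ[Aᵐᵒᵖ] Y} (hf : ∀ k, f k ∈ homDeg X Y s) :
    Y.powLift f ∈ homDeg X (Y.pow n) s := fun i x hx =>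
  Y.mem_pow_deg.2 fun k => hf k i x hx

theorem GrModule.sum_powSingle (Y : GrModule 𝒜) {n : ℕ} (x : Y.pow n) :
    ∑ k, Y.powSingle k (Y.powProj k x) = x :=
  Finset.univ_sum_single (M := fun _ : Fin n => (Y : Type u)) x

theorem GrModule.IsLinear.pow {Y : GrModule 𝒜} (hY : Y.IsLinear) (n : ℕ) :
    (Y.pow n).IsLinear where
  projective M N p f hp hps hf := by
    choose g hg e using fun k => hY.projective M N p (f ∘ₗ Y.powSingle k) hp hps
      (comp_mem_homDeg (Y.powSingle_mem k) hf (add_zero 0))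
    refine ⟨∑ k, g k ∘ₗ Y.powProj k, sum_mem fun k _ =>
      comp_mem_homDeg (Y.powProj_mem k) (hg k) (add_zero 0), LinearMap.ext fun x => ?_⟩
    have e' : ∀ k y, p (g k y) = f (Y.powSingle k y) := fun k => LinearMap.congr_fun (e k)
    rw [LinearMap.comp_apply, LinearMap.sum_apply, map_sum]
    simp only [LinearMap.comp_apply, e']
    rw [← map_sum, Y.sum_powSingle]
  generated := by
    rw [eq_top_iff]
    intro x _
    rw [← Y.sum_powSingle x]
    refine sum_mem fun k _ => ?_
    refine generated_induction hY.generated (Y.powProj k x) (fun a v hv => ?_)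
      (by rw [map_zero]; exact zero_mem _) (fun x y hx hy => by rw [map_add]; exact add_mem hx hy)
    rw [map_smul]
    refine Submodule.smul_mem _ _ (Submodule.subset_span ?_)
    have := Y.powSingle_mem k 0 v hv
    rwa [add_zero] at this
  finite := by
    have := hY.finite
    exact inferInstanceAs (Module.Finite Aᵐᵒᵖ (Fin n → Y))

/-- The shift of a graded module. -/
def GrModule.shift (n : ℤ) (M : GrModule 𝒜) : GrModule 𝒜 where
  carrier := M
  deg i := M.deg (i + n)
  isInternal := by
    refine isInternal_of_proj (fun i => M.proj (i + n)) (fun i x hx => M.proj_of_mem hx)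
      (fun i j hij x hx => M.proj_of_mem_ne (by omega) hx) ?_
    rw [← M.iSup_deg]
    exact (Equiv.addRight n).iSup_comp (g := M.deg)
  smul_mem i j x a hx ha := by
    have := M.smul_mem _ j x a hx ha
    rwa [add_right_comm] at this

/-- Shifting a homogeneous map. -/
theorem mem_homDeg_shift_iff {M N : GrModule 𝒜} {n s : ℤ} {f : M →ₗ[Aᵐᵒᵖ] N} :
    (show M.shift n →ₗ[Aᵐᵒᵖ] N.shift n from f) ∈ homDeg (M.shift n) (N.shift n) s ↔
      f ∈ homDeg M N s := by
  constructor
  · intro h i x hx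
    have : f x ∈ N.deg (i - n + s + n) :=
      h (i - n) x (show x ∈ M.deg (i - n + n) by simpa using hx)
    rwa [show i - n + s + n = i + s by ring] at this
  · intro h i x hx
    change f x ∈ N.deg (i + s + n)
    have := h (i + n) x hx
    rwa [show i + n + s = i + s + n by ring] at this

theorem IsGrProjective.shift {P : GrModule 𝒜} (hP : IsGrProjective P) (n : ℤ) :
    IsGrProjective (P.shift n) := by
  intro M N p f hp hps hf
  -- Shifting by n is inverse to shifting by -n, so the lifting problem is transposed to one for P
  -- itself.
  have tr : ∀ {X Y : GrModule 𝒜} {g : X →ₗ[Aᵐᵒᵖ] Y}, g ∈ homDeg (X.shift n) Y 0 →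
      g ∈ homDeg X (Y.shift (-n)) 0 := by
    intro X Y g hg i x hx
    have : g x ∈ Y.deg (i - n + 0) := hg (i - n) x (show x ∈ X.deg (i - n + n) by simpa using hx)
    change g x ∈ Y.deg (i + 0 + -n)
    rwa [show i + 0 + -n = i - n + 0 by ring]
  obtain ⟨g, hg, e⟩ := hP (M.shift (-n)) (N.shift (-n)) p f (mem_homDeg_shift_iff.2 hp) hps (tr hf)
  refine ⟨g, fun i x hx => ?_, e⟩
  have : g x ∈ M.deg (i + n + 0 + -n) := hg (i + n) x hx
  rwa [show i + n + 0 + -n = i + 0 by ring] at this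

end Linear

/-! ### Graded-split short exact sequences of dg modules, and criteria for perfection. -/

section Sequences

variable {A : Type u} [Ring A] {𝒜 : ℤ → AddSubgroup A}

/-- The inclusion of the image of an idempotent. -/
def GrModule.cornerIncl {Y : GrModule 𝒜} (e : Y →ₗ[Aᵐᵒᵖ] Y) (he : e ∈ homDeg Y Y 0) :
    Y.corner e he →ₗ[Aᵐᵒᵖ] Y := (LinearMap.range e).subtype

/-- The projection to the image of an idempotent. -/
def GrModule.cornerProj {Y : GrModule 𝒜} (e : Y →ₗ[Aᵐᵒᵖ] Y) (he : e ∈ homDeg Y Y 0) :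
    Y →ₗ[Aᵐᵒᵖ] Y.corner e he := e.rangeRestrict

section

variable {Y : GrModule 𝒜} {e : Y →ₗ[Aᵐᵒᵖ] Y} {he : e ∈ homDeg Y Y 0}

theorem GrModule.cornerIncl_injective : Function.Injective (cornerIncl e he) :=
  Subtype.val_injective

theorem GrModule.cornerProj_surjective : Function.Surjective (cornerProj e he) :=
  e.surjective_rangeRestrict

theorem GrModule.cornerIncl_mem : cornerIncl e he ∈ homDeg (Y.corner e he) Y 0 := fun i x hx => by
  rw [add_zero]; exact hx

theorem GrModule.cornerProj_mem : cornerProj e he ∈ homDeg Y (Y.corner e he) 0 := fun i x hx =>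
  he i x hx

theorem GrModule.cornerProj_incl (h : ∀ y, e (e y) = e y) (x : Y.corner e he) :
    cornerProj e he (cornerIncl e he x) = x := by
  obtain ⟨y, rfl⟩ := cornerProj_surjective x
  exact cornerIncl_injective (h y)

theorem GrModule.IsLinear.corner (hY : Y.IsLinear) (h : ∀ y, e (e y) = e y) :
    (Y.corner e he).IsLinear :=
  hY.of_retract cornerIncl_mem cornerProj_mem (cornerProj_incl h)

end

/-- The image of an idempotent, with the compressed differential. -/
def DGModule.corner (Y : DGModule 𝒜) (e : Y →ₗ[Aᵐᵒᵖ] Y)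
    (he : e ∈ homDeg Y.toGrModule Y.toGrModule 0) (hd : ∀ y, e (Y.d (e (Y.d (e y)))) = 0) :
    DGModule 𝒜 where
  toGrModule := Y.toGrModule.corner e he
  d := GrModule.cornerProj e he ∘ₗ Y.d ∘ₗ GrModule.cornerIncl e he
  d_mem := comp_mem_homDeg (comp_mem_homDeg GrModule.cornerIncl_mem Y.d_mem (zero_add 1))
    GrModule.cornerProj_mem (add_zero 1)
  d_comp_d := by
    refine LinearMap.ext fun x => ?_
    obtain ⟨y, rfl⟩ := GrModule.cornerProj_surjective x
    exact GrModule.cornerIncl_injective (hd y)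

/-- Short exact sequences of dg modules that split as sequences of graded modules. -/
structure SplitSES (Y Z C : DGModule 𝒜) where
  φ : Y ⟶ Z
  q : Z ⟶ C
  r : Z →ₗ[Aᵐᵒᵖ] Y
  j : C →ₗ[Aᵐᵒᵖ] Z
  r_mem : r ∈ homDeg Z.toGrModule Y.toGrModule 0
  j_mem : j ∈ homDeg C.toGrModule Z.toGrModule 0
  r_φ : ∀ y, r (φ.1 y) = y
  q_j : ∀ c, q.1 (j c) = c
  add : ∀ z, φ.1 (r z) + j (q.1 z) = z

namespace SplitSES

variable {Y Z C : DGModule 𝒜} (S : SplitSES Y Z C)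

theorem q_φ (y : Y) : S.q.1 (S.φ.1 y) = 0 := by
  have h := S.add (S.φ.1 y)
  rw [S.r_φ, add_eq_left] at h
  rw [← S.q_j (S.q.1 (S.φ.1 y)), h, map_zero]

theorem φ_r_of_q_eq_zero {z : Z} (h : S.q.1 z = 0) : S.φ.1 (S.r z) = z := by
  have := S.add z
  rwa [h, map_zero, add_zero] at this

/-- Exactness of Hˢ⁻¹(M, C) → Hˢ(M, Y) → Hˢ(M, Z): the image in C of a homotopy for φ f is a cycle,
and correcting the homotopy by a boundary moves it into Y. -/
theorem isBoundary_of_φ {M : DGModule 𝒜} {s : ℤ} {ε : ℤˣ} {f : M →ₗ[Aᵐᵒᵖ] Y}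
    (hC : Null M C (s - 1)) (hf : IsBoundary M Z s ε (S.φ.1 ∘ₗ f)) :
    IsBoundary M Y s ε f := by
  obtain ⟨h, hh, e⟩ := hf
  have hε : ∀ {N : DGModule 𝒜} (y : N), (ε : ℤ) • (ε : ℤ) • y = y := by
    intro N y
    rcases Int.units_eq_one_or ε with rfl | rfl <;> simp
  have hc : IsCycle M C (s - 1) (-ε) (S.q.1 ∘ₗ h) := by
    refine ⟨comp_mem_homDeg hh S.q.2.1 (add_zero _), fun x => ?_⟩
    have h1 := congrArg S.q.1 (e x)
    rw [LinearMap.comp_apply, S.q_φ, map_add, map_zsmul, ← DGModule.hom_d] at h1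
    rw [LinearMap.comp_apply, LinearMap.comp_apply, Units.val_neg, neg_smul]
    exact eq_neg_of_add_eq_zero_left h1.symm
  obtain ⟨w, hw, e'⟩ := hC _ _ hc
  -- The subtracted term is the boundary of j w, with the sign -ε belonging to degree s - 1. It has
  -- the same image in C as h, so the difference lies in Y.
  have hu : h - (Z.d ∘ₗ S.j ∘ₗ w - (ε : ℤ) • (S.j ∘ₗ w ∘ₗ M.d)) ∈
      homDeg M.toGrModule Z.toGrModule (s - 1) := by
    refine sub_mem hh (sub_mem ?_ (zsmul_mem ?_ _))
    · exact comp_mem_homDeg (comp_mem_homDeg hw S.j_mem (add_zero _)) Z.d_mem (by ring)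
    · exact comp_mem_homDeg (comp_mem_homDeg M.d_mem hw rfl) S.j_mem (by ring)
  set u := h - (Z.d ∘ₗ S.j ∘ₗ w - (ε : ℤ) • (S.j ∘ₗ w ∘ₗ M.d)) with hu_def
  have hu' : ∀ x, u x = h x - (Z.d (S.j (w x)) - (ε : ℤ) • S.j (w (M.d x))) := fun _ => rfl
  have hqu : ∀ x, S.φ.1 (S.r (u x)) = u x := by
    intro x
    refine S.φ_r_of_q_eq_zero ?_
    have h1 : S.q.1 (h x) = C.d (w x) + (-(ε : ℤ)) • w (M.d x) := e' x
    rw [hu', map_sub, map_sub, map_zsmul, ← DGModule.hom_d, S.q_j, S.q_j, h1]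
    simp
  refine ⟨S.r ∘ₗ u, comp_mem_homDeg hu S.r_mem (add_zero _), fun x => ?_⟩
  have hinj : Function.Injective S.φ.1 := Function.LeftInverse.injective S.r_φ
  apply hinj
  have e1 : S.φ.1 (f x) = _ := e x
  rw [map_add, map_zsmul, ← DGModule.hom_d, LinearMap.comp_apply, LinearMap.comp_apply, hqu, hqu,
    hu', hu', M.d_d, e1]
  simp only [map_sub, map_zsmul, Z.d_d, smul_sub, map_zero, hε]
  abel

/-- Exactness at Hˢ(M, Z): a null-homotopy of q f lifts along the graded section j, and subtracting
its boundary from f gives a cycle with values in Y. -/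
theorem exists_lift {M : DGModule 𝒜} {s : ℤ} {ε : ℤˣ} {f : M →ₗ[Aᵐᵒᵖ] Z}
    (hf : IsCycle M Z s ε f) (hqf : IsBoundary M C s ε (S.q.1 ∘ₗ f)) :
    ∃ f', IsCycle M Y s ε f' ∧ IsBoundary M Z s ε (f - S.φ.1 ∘ₗ f') := by
  obtain ⟨w, hw, e⟩ := hqf
  have hjw := comp_mem_homDeg hw S.j_mem (add_zero _)
  set b := Z.d ∘ₗ S.j ∘ₗ w + (ε : ℤ) • (S.j ∘ₗ w ∘ₗ M.d) with hb_def
  have hb' : ∀ x, b x = Z.d (S.j (w x)) + (ε : ℤ) • S.j (w (M.d x)) := fun _ => rfl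
  have hbb : IsBoundary M Z s ε b := ⟨S.j ∘ₗ w, hjw, hb'⟩
  have hbc : IsCycle M Z s ε b := by
    refine ⟨add_mem (comp_mem_homDeg hjw Z.d_mem (by ring))
      (zsmul_mem (comp_mem_homDeg (comp_mem_homDeg M.d_mem hw rfl) S.j_mem (by ring)) _),
      fun x => ?_⟩
    rw [hb', hb', map_add, Z.d_d, M.d_d, map_zsmul, map_zero, map_zero, smul_zero, add_zero,
      zero_add]
  have hφ : ∀ x, S.φ.1 (S.r ((f - b) x)) = (f - b) x := fun x => by
    refine S.φ_r_of_q_eq_zero ?_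
    have h1 : S.q.1 (f x) = _ := e x
    rw [LinearMap.sub_apply, map_sub, h1, hb', map_add, map_zsmul, ← DGModule.hom_d, S.q_j, S.q_j,
      sub_self]
  have hinj : Function.Injective S.φ.1 := Function.LeftInverse.injective S.r_φ
  refine ⟨S.r ∘ₗ (f - b), ⟨comp_mem_homDeg (sub_mem hf.1 hbc.1) S.r_mem (add_zero _),
    fun x => hinj ?_⟩, ?_⟩
  · rw [map_zsmul, ← DGModule.hom_d, LinearMap.comp_apply, LinearMap.comp_apply, hφ, hφ]
    exact (hf.sub hbc).2 x
  · convert hbb using 1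
    refine LinearMap.ext fun x => ?_
    have := hφ x
    rw [LinearMap.sub_apply, LinearMap.comp_apply, LinearMap.comp_apply, this, LinearMap.sub_apply,
      sub_sub_cancel]

theorem _root_.DGKoszul.id_sub_mem_homDeg {Y : GrModule 𝒜} {e : Y →ₗ[Aᵐᵒᵖ] Y}
    (he : e ∈ homDeg Y Y 0) : LinearMap.id - e ∈ homDeg Y Y 0 :=
  sub_mem (id_mem_homDeg Y) he

/-- The sequence given by an idempotent whose kernel is stable under the differential. -/
def ofIdempotent (Y : DGModule 𝒜) (e : Y →ₗ[Aᵐᵒᵖ] Y)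
    (he : e ∈ homDeg Y.toGrModule Y.toGrModule 0) (h : ∀ y, e (e y) = e y)
    (hd : ∀ y, e (Y.d (e y)) = e (Y.d y)) :
    SplitSES (Y.corner (LinearMap.id - e) (id_sub_mem_homDeg he) (fun y => by
        simp [hd, Y.d_d]))
      Y (Y.corner e he (fun y => by rw [hd, Y.d_d, map_zero])) where
  φ := ⟨GrModule.cornerIncl _ (id_sub_mem_homDeg he), GrModule.cornerIncl_mem,
    LinearMap.ext fun x => by
      obtain ⟨y, rfl⟩ := GrModule.cornerProj_surjective (he := id_sub_mem_homDeg he) x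
      change Y.d (y - e y) = Y.d (y - e y) - e (Y.d (y - e y))
      rw [map_sub Y.d, map_sub e, hd, sub_self, sub_zero]⟩
  q := ⟨GrModule.cornerProj _ he, GrModule.cornerProj_mem, LinearMap.ext fun y =>
    GrModule.cornerIncl_injective (he := he) (hd y)⟩
  r := GrModule.cornerProj _ (id_sub_mem_homDeg he)
  j := GrModule.cornerIncl _ he
  r_mem := GrModule.cornerProj_mem
  j_mem := GrModule.cornerIncl_mem
  r_φ := GrModule.cornerProj_incl fun y => by simp [h]
  q_j := GrModule.cornerProj_incl h
  add z := by
    change z - e z + e z = z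
    rw [sub_add_cancel]

theorem _root_.DGKoszul.id_sub_comp_mem_homDeg (φ : Y ⟶ Z) {r : Z →ₗ[Aᵐᵒᵖ] Y}
    (hr : r ∈ homDeg Z.toGrModule Y.toGrModule 0) :
    LinearMap.id - φ.1 ∘ₗ r ∈ homDeg Z.toGrModule Z.toGrModule 0 :=
  id_sub_mem_homDeg (comp_mem_homDeg hr φ.2.1 (add_zero 0))

/-- The cokernel sequence of a morphism that is split injective as a map of graded modules. -/
def ofSplitMono (φ : Y ⟶ Z) (r : Z →ₗ[Aᵐᵒᵖ] Y) (hr : r ∈ homDeg Z.toGrModule Y.toGrModule 0)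
    (h : ∀ y, r (φ.1 y) = y) :
    SplitSES Y Z (Z.corner (LinearMap.id - φ.1 ∘ₗ r) (id_sub_comp_mem_homDeg φ hr) (fun y => by
        simp [h, DGModule.hom_d, Z.d_d])) where
  φ := φ
  q := ⟨GrModule.cornerProj _ (id_sub_comp_mem_homDeg φ hr), GrModule.cornerProj_mem,
    LinearMap.ext fun y => GrModule.cornerIncl_injective (he := id_sub_comp_mem_homDeg φ hr) (by
      change Z.d (y - φ.1 (r y)) - φ.1 (r (Z.d (y - φ.1 (r y)))) = Z.d y - φ.1 (r (Z.d y))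
      simp [h, DGModule.hom_d])⟩
  r := r
  j := GrModule.cornerIncl _ (id_sub_comp_mem_homDeg φ hr)
  r_mem := hr
  j_mem := GrModule.cornerIncl_mem
  r_φ := h
  q_j := GrModule.cornerProj_incl fun y => by simp [h]
  add z := by
    change φ.1 (r z) + (z - φ.1 (r z)) = z
    rw [add_sub_cancel]

end SplitSES

/-- Finite powers of a dg module. -/
def DGModule.pow (Y : DGModule 𝒜) (n : ℕ) : DGModule 𝒜 where
  toGrModule := Y.toGrModule.pow n
  d := Y.toGrModule.powLift fun k => Y.d ∘ₗ Y.toGrModule.powProj k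
  d_mem := Y.toGrModule.powLift_mem fun k =>
    comp_mem_homDeg (Y.toGrModule.powProj_mem k) Y.d_mem (zero_add 1)
  d_comp_d := LinearMap.ext fun _ => Y.toGrModule.pow_ext fun _ => Y.d_d _

theorem DGModule.powProj_d (Y : DGModule 𝒜) {n : ℕ} (k : Fin n) (x : Y.pow n) :
    Y.toGrModule.powProj k ((Y.pow n).d x) = Y.d (Y.toGrModule.powProj k x) := rfl

/-- The projections of a finite power. -/
def DGModule.powProj (Y : DGModule 𝒜) {n : ℕ} (k : Fin n) : Y.pow n ⟶ Y :=
  ⟨Y.toGrModule.powProj k, Y.toGrModule.powProj_mem k, LinearMap.ext fun x =>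
    (Y.powProj_d k x).symm⟩

/-- Tuples of morphisms as morphisms to a finite power. -/
def DGModule.powLift {X Y : DGModule 𝒜} {n : ℕ} (f : Fin n → (X ⟶ Y)) : X ⟶ Y.pow n :=
  ⟨Y.toGrModule.powLift fun k => (f k).1, Y.toGrModule.powLift_mem fun k => (f k).2.1,
    LinearMap.ext fun x => Y.toGrModule.pow_ext fun k => DGModule.hom_d (f k) x⟩

theorem Null.pow {M Y : DGModule 𝒜} {s : ℤ} (h : Null M Y s) (n : ℕ) : Null M (Y.pow n) s := by
  intro ε f hf
  choose g hg e using fun k => h ε _ (hf.postcomp (Y.powProj (n := n) k))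
  exact ⟨Y.toGrModule.powLift g, Y.toGrModule.powLift_mem hg, fun x =>
    Y.toGrModule.pow_ext fun k => e k x⟩

/-- The sequence that splits off the first factor of a finite power. -/
def SplitSES.powSucc (Y : DGModule 𝒜) (n : ℕ) : SplitSES (Y.pow n) (Y.pow (n + 1)) Y where
  φ := DGModule.powLift fun k => Fin.cases 0 (fun l => Y.powProj l) k
  q := Y.powProj 0
  r := Y.toGrModule.powLift fun k => Y.toGrModule.powProj k.succ
  j := Y.toGrModule.powSingle 0
  r_mem := Y.toGrModule.powLift_mem fun k => Y.toGrModule.powProj_mem _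
  j_mem := Y.toGrModule.powSingle_mem 0
  r_φ y := Y.toGrModule.pow_ext fun k => rfl
  q_j c := (Y.toGrModule.powProj_single 0 0 c).trans (if_pos rfl)
  add z := by
    refine Y.toGrModule.pow_ext fun k => (map_add (Y.toGrModule.powProj k) _ _).trans ?_
    have h := Y.toGrModule.powProj_single 0 k (Y.toGrModule.powProj 0 z)
    refine (congrArg₂ (· + ·) rfl h).trans ?_
    cases k using Fin.cases with
    | zero => exact (congrArg₂ (· + ·) rfl (if_pos rfl)).trans (zero_add _)
    | succ l => exact (congrArg₂ (· + ·) rfl (if_neg (Fin.succ_ne_zero l))).trans (add_zero _)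

section Perfect

variable [GradedRing 𝒜]

theorem IsPerfect.of_retract {X Y : DGModule 𝒜} (hY : IsPerfect 𝒜 (toHot Y)) (i : X ⟶ Y)
    (r : Y ⟶ X) (h : ∀ x, r.1 (i.1 x) = x) : IsPerfect 𝒜 (toHot X) := by
  refine IsPerfect.summand (retractOfHomotopic i r ?_) hY
  rw [show i ≫ r = 𝟙 X from Subtype.ext (LinearMap.ext h)]
  exact Congruence.equivalence.refl _

theorem isPerfect_of_subsingleton (Y : DGModule 𝒜) [Subsingleton Y] : IsPerfect 𝒜 (toHot Y) :=
  IsPerfect.regular.of_retract 0 0 fun _ => Subsingleton.elim _ _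

/-- C is a strict retract of the cone of φ. The section sends c to (j c, -r d j c); its second entry
compensates for the failure of j to commute with the differentials. -/
theorem SplitSES.isPerfect_quotient {Y Z C : DGModule 𝒜} (S : SplitSES Y Z C)
    (hY : IsPerfect 𝒜 (toHot Y)) (hZ : IsPerfect 𝒜 (toHot Z)) : IsPerfect 𝒜 (toHot C) := by
  refine (IsPerfect.cone S.φ hY hZ).of_retract
    ⟨coneInl S.φ ∘ₗ S.j - coneInr S.φ ∘ₗ S.r ∘ₗ Z.d ∘ₗ S.j, ?_, ?_⟩
    ⟨S.q.1 ∘ₗ coneFst S.φ, comp_mem_homDeg (coneFst_mem _) S.q.2.1 (add_zero _), ?_⟩ ?_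
  · exact sub_mem (comp_mem_homDeg S.j_mem (coneInl_mem _) (add_zero 0))
      (comp_mem_homDeg (comp_mem_homDeg (comp_mem_homDeg S.j_mem Z.d_mem rfl) S.r_mem rfl)
        (coneInr_mem _) (by ring))
  · refine LinearMap.ext fun c => ?_
    have h1 : Z.d (S.j c) - S.φ.1 (S.r (Z.d (S.j c))) = S.j (C.d c) := by
      have := S.add (Z.d (S.j c))
      rw [← DGModule.hom_d S.q, S.q_j] at this
      exact sub_eq_of_eq_add' this.symm
    have h2 : Y.d (S.r (Z.d (S.j c))) = -(S.r (Z.d (S.j (C.d c)))) := by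
      rw [← h1, map_sub, Z.d_d, zero_sub, DGModule.hom_d, map_neg, S.r_φ, neg_neg]
    simp only [LinearMap.comp_apply, LinearMap.sub_apply, map_sub, cone_d_inl, cone_d_inr]
    have h3 : coneInl S.φ (Z.d (S.j c)) =
        coneInl S.φ (S.φ.1 (S.r (Z.d (S.j c)))) + coneInl S.φ (S.j (C.d c)) := by
      rw [← map_add, ← h1, add_sub_cancel]
    rw [h2, map_neg, h3]
    abel
  · refine LinearMap.ext fun z => ?_
    simp only [LinearMap.comp_apply, coneFst_d, map_add, S.q_φ, add_zero, DGModule.hom_d]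
  · intro c
    change S.q.1 (coneFst S.φ (coneInl S.φ (S.j c) - coneInr S.φ (S.r (Z.d (S.j c))))) = c
    rw [map_sub, coneFst_inl, coneFst_inr, sub_zero, S.q_j]

/-- The connecting morphism. -/
def SplitSES.connecting {Y Z C : DGModule 𝒜} (S : SplitSES Y Z C) : shift (-1) C ⟶ Y :=
  ⟨S.r ∘ₗ Z.d ∘ₗ S.j ∘ₗ ofShift (-1) C, comp_mem_homDeg (comp_mem_homDeg (comp_mem_homDeg
    (ofShift_mem _ _) S.j_mem rfl) Z.d_mem rfl) S.r_mem (by ring), by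
    refine LinearMap.ext fun x => ?_
    have hinj : Function.Injective S.φ.1 := Function.LeftInverse.injective S.r_φ
    set c := ofShift (-1) C x
    have hd : ofShift (-1) C ((shift (-1) C).d x) = -(C.d c) := by
      rw [ofShift_d]; simp [c]
    have h1 : Z.d (S.j c) - S.φ.1 (S.r (Z.d (S.j c))) = S.j (C.d c) := by
      have := S.add (Z.d (S.j c))
      rw [← DGModule.hom_d S.q, S.q_j] at this
      exact sub_eq_of_eq_add' this.symm
    change Y.d (S.r (Z.d (S.j c))) = S.r (Z.d (S.j (ofShift (-1) C ((shift (-1) C).d x))))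
    rw [hd, map_neg, ← h1, neg_sub, map_sub, Z.d_d, sub_zero, DGModule.hom_d S.φ, S.r_φ]⟩

/-- In the coordinates given by r and q the differential of Z is triangular, with the connecting
morphism off the diagonal. This presents Z as a retract of the cone of that morphism. -/
theorem SplitSES.isPerfect_middle {Y Z C : DGModule 𝒜} (S : SplitSES Y Z C)
    (hY : IsPerfect 𝒜 (toHot Y)) (hC : IsPerfect 𝒜 (toHot C)) : IsPerfect 𝒜 (toHot Z) := by
  have hδ : ∀ c, S.connecting.1 (toShift (-1) C c) = S.r (Z.d (S.j c)) := fun _ => rfl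
  have hq : ∀ z, S.r (Z.d z) = Y.d (S.r z) + S.r (Z.d (S.j (S.q.1 z))) := by
    intro z
    conv_lhs => rw [← S.add z]
    rw [map_add, map_add, DGModule.hom_d, S.r_φ]
  refine (IsPerfect.cone S.connecting (IsPerfect.shift (-1) C hC) hY).of_retract
    ⟨coneInl S.connecting ∘ₗ S.r + coneInr S.connecting ∘ₗ toShift (-1) C ∘ₗ S.q.1, ?_, ?_⟩
    ⟨S.φ.1 ∘ₗ coneFst S.connecting + S.j ∘ₗ ofShift (-1) C ∘ₗ coneSnd S.connecting, ?_, ?_⟩ ?_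
  · exact add_mem (comp_mem_homDeg S.r_mem (coneInl_mem _) (add_zero 0))
      (comp_mem_homDeg (comp_mem_homDeg S.q.2.1 (toShift_mem _ _) rfl) (coneInr_mem _) (by ring))
  · refine LinearMap.ext fun z => ?_
    simp only [LinearMap.comp_apply, LinearMap.add_apply, map_add, cone_d_inl, cone_d_inr,
      shift_d_toShift, hδ, hq z, map_zsmul, DGModule.hom_d]
    simp [add_assoc]
  · exact add_mem (comp_mem_homDeg (coneFst_mem _) S.φ.2.1 (add_zero 0))
      (comp_mem_homDeg (comp_mem_homDeg (coneSnd_mem _) (ofShift_mem _ _) rfl) S.j_mem (by ring))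
  · refine LinearMap.ext fun w => ?_
    obtain ⟨c, hc⟩ : ∃ c, coneSnd S.connecting w = toShift (-1) C c := ⟨_, rfl⟩
    simp only [LinearMap.comp_apply, LinearMap.add_apply, map_add, coneFst_d, coneSnd_d, hc,
      hδ, shift_d_toShift, map_neg, map_zsmul, ofShift_toShift, ← DGModule.hom_d]
    have h1 := S.add (Z.d (S.j c))
    rw [← DGModule.hom_d S.q, S.q_j] at h1
    conv_lhs => rw [← h1]
    simp
    abel
  · intro z
    change S.φ.1 (coneFst S.connecting (coneInl S.connecting (S.r z) + coneInr S.connecting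
      (toShift (-1) C (S.q.1 z)))) + S.j (ofShift (-1) C (coneSnd S.connecting
      (coneInl S.connecting (S.r z) + coneInr S.connecting (toShift (-1) C (S.q.1 z))))) = z
    simp [ofShift_toShift, S.add]

theorem IsPerfect.pow {Y : DGModule 𝒜} (hY : IsPerfect 𝒜 (toHot Y)) (n : ℕ) :
    IsPerfect 𝒜 (toHot (Y.pow n)) := by
  induction n with
  | zero =>
    have : Subsingleton (Y.pow 0) := inferInstanceAs (Subsingleton (Fin 0 → Y))
    exact isPerfect_of_subsingleton _
  | succ n ih => exact (SplitSES.powSucc Y n).isPerfect_middle ih hY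

/-- Linear modules are retracts of finite free modules. -/
theorem GrModule.IsLinear.exists_retract {T : GrModule 𝒜} (hT : T.IsLinear) :
    ∃ (n : ℕ) (i : T →ₗ[Aᵐᵒᵖ] (regular 𝒜).toGrModule.pow n)
      (p : (regular 𝒜).toGrModule.pow n →ₗ[Aᵐᵒᵖ] T), i ∈ homDeg T _ 0 ∧ p ∈ homDeg _ T 0 ∧
        ∀ x, p (i x) = x := by
  have h1 : (Submodule.span Aᵐᵒᵖ (T.deg 0 : Set T)).FG := hT.generated ▸ hT.finite.1
  -- The finite generating set is taken inside the component of degree zero, so that the surjection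
  -- from the free module preserves degrees and splits by graded projectivity.
  obtain ⟨t, ht, e⟩ := Submodule.fg_span_iff_fg_span_finset_subset _ |>.1 h1
  let D : DGModule 𝒜 := { T with d := 0, d_mem := zero_mem _, d_comp_d := by simp }
  let x : Fin t.card → D := fun k => (t.equivFin.symm k : T)
  let p : (regular 𝒜).toGrModule.pow t.card →ₗ[Aᵐᵒᵖ] T :=
    ∑ k, fromRegular D (x k) ∘ₗ (regular 𝒜).toGrModule.powProj k
  have hp : p ∈ homDeg _ T 0 := sum_mem fun k _ =>
    comp_mem_homDeg ((regular 𝒜).toGrModule.powProj_mem k)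
      (fromRegular_mem (N := D) (ht (t.equivFin.symm k).2)) (add_zero 0)
  have hps : Function.Surjective p := by
    rw [← LinearMap.range_eq_top, eq_top_iff, ← hT.generated, e, Submodule.span_le]
    intro v hv
    refine ⟨(regular 𝒜).toGrModule.powSingle (t.equivFin ⟨v, hv⟩) regularOne, ?_⟩
    rw [LinearMap.sum_apply, Finset.sum_eq_single (t.equivFin ⟨v, hv⟩)]
    · rw [LinearMap.comp_apply, GrModule.powProj_single, if_pos rfl, fromRegular_one]
      simp [x]
    · intro k _ hk
      rw [LinearMap.comp_apply, GrModule.powProj_single, if_neg hk, map_zero]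
    · intro h
      exact absurd (Finset.mem_univ _) h
  obtain ⟨i, hi, e'⟩ := hT.projective _ _ p LinearMap.id hp hps (id_mem_homDeg T)
  exact ⟨t.card, i, p, hi, hp, LinearMap.congr_fun e'⟩

theorem isPerfect_of_d_eq_zero {T : DGModule 𝒜} (hT : T.toGrModule.IsLinear) (hd : T.d = 0) :
    IsPerfect 𝒜 (toHot T) := by
  obtain ⟨n, i, p, hi, hp, h⟩ := hT.exists_retract
  have hd' : ((regular 𝒜).pow n).d = 0 := rfl
  exact (IsPerfect.regular.pow n).of_retract 
    ⟨i, hi, LinearMap.ext fun x => by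
      rw [hd]; exact (LinearMap.congr_fun hd' (i x)).trans (map_zero i).symm⟩
    ⟨p, hp, LinearMap.ext fun x => by
      rw [hd]; exact ((congrArg p (LinearMap.congr_fun hd' x)).trans (map_zero p)).symm⟩ h

/-- Linear dg submodules of powers of a filtered dg module are perfect. -/
theorem isPerfect_of_injective [PosSemisimple 𝒜] {K : DGModule 𝒜} {T : ℕ → GrModule 𝒜}
    (hT : ∀ k, (T k).IsLinear) {c : ∀ k, K →ₗ[Aᵐᵒᵖ] T k}
    (hc : ∀ k, c k ∈ homDeg K.toGrModule (T k) 0)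
    (hinj : ∀ x, (∀ k, c k x = 0) → x = 0) (hd : ∀ k x, c (k + 1) x = 0 → c k (K.d x) = 0)
    {m : ℕ} (hm : ∀ k ≥ m, c k = 0) {Y : DGModule 𝒜} (hY : Y.toGrModule.IsLinear) {n : ℕ}
    (j : Y ⟶ K.pow n) (hj : Function.Injective j.1) : IsPerfect 𝒜 (toHot Y) := by
  -- Induction on the number m of filtration steps that the image of Y can meet.
  suffices ∀ (m : ℕ) (Y : DGModule 𝒜), Y.toGrModule.IsLinear → ∀ j : Y ⟶ K.pow n,
      Function.Injective j.1 → (∀ k ≥ m, ∀ i y, c k (K.toGrModule.powProj i (j.1 y)) = 0) →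
      IsPerfect 𝒜 (toHot Y) from
    this m Y hY j hj fun k hk i y => by rw [hm k hk]; rfl
  clear hm hj j hY Y m
  intro m
  induction m with
  | zero =>
    intro Y _ j hj h
    have : Subsingleton Y := ⟨fun x y => hj <| K.toGrModule.pow_ext fun i => by
      rw [hinj _ fun k => h k (Nat.zero_le k) i x, hinj _ fun k => h k (Nat.zero_le k) i y]⟩
    exact isPerfect_of_subsingleton Y
  | succ m ih =>
    intro Y hY j hj h
    -- The top component. It kills all differentials, since the differential lowers the filtration
    -- index and nothing lies above m.
    let q : Y →ₗ[Aᵐᵒᵖ] (T m).pow n :=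
      (T m).powLift fun i => c m ∘ₗ K.toGrModule.powProj i ∘ₗ j.1
    have hq : q ∈ homDeg Y.toGrModule ((T m).pow n) 0 := (T m).powLift_mem fun i =>
      comp_mem_homDeg (comp_mem_homDeg j.2.1 (K.toGrModule.powProj_mem i) (add_zero 0)) (hc m)
        (add_zero 0)
    have hqd : ∀ y, q (Y.d y) = 0 := fun y => (T m).pow_ext fun i => by
      change c m (K.toGrModule.powProj i (j.1 (Y.d y))) = 0
      rw [← DGModule.hom_d]
      exact hd m _ (h (m + 1) le_rfl i y)
    obtain ⟨r, hr, e⟩ := hY.exists_regular ((hT m).pow n) hq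
    have hid : ∀ y, (r ∘ₗ q) ((r ∘ₗ q) y) = (r ∘ₗ q) y := fun y => by
      simp only [LinearMap.comp_apply, e]
    have hed : ∀ y, (r ∘ₗ q) (Y.d y) = 0 := fun y => by rw [LinearMap.comp_apply, hqd, map_zero]
    have he := comp_mem_homDeg hq hr (add_zero 0)
    -- The kernel of this idempotent is the kernel of q, which has one filtration step less; its
    -- image carries the zero differential, so it is perfect as a retract of a finite free module.
    let S := SplitSES.ofIdempotent Y (r ∘ₗ q) he hid
      fun y => by rw [hed, hed]
    refine S.isPerfect_middle (ih _ (hY.corner (he := id_sub_mem_homDeg he) fun y => ?_) (S.φ ≫ j)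
      ?_ ?_)
      (isPerfect_of_d_eq_zero (hY.corner (he := he) hid) ?_)
    · simp only [LinearMap.sub_apply, LinearMap.id_apply, map_sub, hid]
      simp
    · exact hj.comp (Function.LeftInverse.injective S.r_φ)
    · intro k hk i y
      rcases Nat.lt_or_ge m k with hk' | hk'
      · exact h k hk' i _
      · obtain rfl : k = m := le_antisymm hk' hk
        obtain ⟨z, rfl⟩ := GrModule.cornerProj_surjective (he := id_sub_mem_homDeg he) y
        have : q (z - r (q z)) = 0 := by rw [map_sub, e, sub_self]
        exact congrArg ((T k).powProj i) this
    · refine LinearMap.ext fun x => GrModule.cornerIncl_injective (he := he) ?_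
      exact hed _

end Perfect

end Sequences

/-- Modulo B, Z lies in a finitely generated module over a Noetherian ring, so finitely many
elements of Z itself generate it there. -/
theorem exists_fg_le_of_le_sup {L V : Type*} [Ring L] [IsNoetherianRing L] [AddCommGroup V]
    [Module L V] {Z B G : Submodule L V} (hG : G.FG) (h : Z ≤ G ⊔ B) :
    ∃ G' : Submodule L V, G'.FG ∧ G' ≤ Z ∧ Z ≤ G' ⊔ B := by
  have h1 : Z.map B.mkQ ≤ G.map B.mkQ := by
    refine (Submodule.map_mono h).trans ?_
    rw [Submodule.map_sup, Submodule.mkQ_map_self, sup_bot_eq]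
  have h2 : (Submodule.span L (B.mkQ '' (Z : Set V))).FG := by
    rw [← Submodule.map_coe, Submodule.span_eq]
    exact (hG.map B.mkQ).of_le h1
  obtain ⟨t, ht, e⟩ := (Submodule.fg_span_iff_fg_span_finset_subset _).1 h2
  classical
  obtain ⟨t', ht', rfl⟩ := Finset.subset_set_image_iff.1 ht
  refine ⟨Submodule.span L t', ⟨t', rfl⟩, Submodule.span_le.2 ht', fun z hz => ?_⟩
  have h3 : B.mkQ z ∈ (Submodule.span L (t' : Set V)).map B.mkQ := by
    rw [Submodule.map_span, ← Finset.coe_image, ← e]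
    exact Submodule.subset_span ⟨z, hz, rfl⟩
  obtain ⟨g, hg, e'⟩ := h3
  refine Submodule.mem_sup.2 ⟨g, hg, z - g, ?_, add_sub_cancel _ _⟩
  rw [← Submodule.Quotient.mk_eq_zero, Submodule.Quotient.mk_sub, sub_eq_zero]
  exact e'.symm

/-! ### Cohomology with values in A⁰, and its finiteness over End(A⁰). -/

section Residue

variable {A : Type u} [Ring A] {𝒜 : ℤ → AddSubgroup A} [GradedRing 𝒜] [PosSemisimple 𝒜]

theorem homDeg_residue_smul {M : GrModule 𝒜} {s : ℤ} {f : M →ₗ[Aᵐᵒᵖ] degZero 𝒜}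
    (hf : f ∈ homDeg M (residue 𝒜).toGrModule s) (c : degZero 𝒜 →ₗ[Aᵐᵒᵖ] degZero 𝒜) :
    c ∘ₗ f ∈ homDeg M (residue 𝒜).toGrModule s :=
  mem_homDeg_residue.2 fun i hi x hx => by
    rw [LinearMap.comp_apply, mem_homDeg_residue.1 hf i hi x hx, map_zero]

/-- The cycles of degree `s` in the complex of maps to `A⁰`. -/
def resCycles (M : DGModule 𝒜) (s : ℤ) :
    Submodule (Module.End Aᵐᵒᵖ (degZero 𝒜)) (M →ₗ[Aᵐᵒᵖ] degZero 𝒜) where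
  carrier := {f | f ∈ homDeg M.toGrModule (residue 𝒜).toGrModule s ∧ ∀ x, f (M.d x) = 0}
  zero_mem' := ⟨zero_mem _, fun x => rfl⟩
  add_mem' := fun {f g} hf hg => ⟨add_mem hf.1 hg.1, fun x => by simp [hf.2, hg.2]⟩
  smul_mem' := fun c f hf => ⟨homDeg_residue_smul hf.1 c, fun x => by simp [hf.2]⟩

/-- The boundaries of degree `s` in the complex of maps to `A⁰`. -/
def resBoundaries (M : DGModule 𝒜) (s : ℤ) :
    Submodule (Module.End Aᵐᵒᵖ (degZero 𝒜)) (M →ₗ[Aᵐᵒᵖ] degZero 𝒜) where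
  carrier := {f | ∃ h : M →ₗ[Aᵐᵒᵖ] degZero 𝒜,
    h ∈ homDeg M.toGrModule (residue 𝒜).toGrModule (s - 1) ∧ ∀ x, f x = h (M.d x)}
  zero_mem' := ⟨0, zero_mem _, fun x => rfl⟩
  add_mem' := by
    rintro f g ⟨h, hh, e⟩ ⟨h', hh', e'⟩
    exact ⟨h + h', add_mem hh hh', fun x => by simp [e, e']⟩
  smul_mem' := by
    rintro c f ⟨h, hh, e⟩
    exact ⟨c ∘ₗ h, homDeg_residue_smul hh c, fun x => by simp [e]⟩

theorem isCycle_residue_iff {M : DGModule 𝒜} {s : ℤ} {ε : ℤˣ} {f : M →ₗ[Aᵐᵒᵖ] degZero 𝒜} :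
    IsCycle M (residue 𝒜) s ε f ↔ f ∈ resCycles M s := by
  refine and_congr Iff.rfl (forall_congr' fun x => ?_)
  change 0 = (ε : ℤ) • f (M.d x) ↔ f (M.d x) = 0
  rcases Int.units_eq_one_or ε with rfl | rfl <;> simp [eq_comm]

theorem isBoundary_residue_iff {M : DGModule 𝒜} {s : ℤ} {ε : ℤˣ} {f : M →ₗ[Aᵐᵒᵖ] degZero 𝒜} :
    IsBoundary M (residue 𝒜) s ε f ↔ f ∈ resBoundaries M s := by
  have hε : ∀ y : degZero 𝒜, (ε : ℤ) • (ε : ℤ) • y = y := by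
    intro y
    rcases Int.units_eq_one_or ε with rfl | rfl <;> simp
  constructor
  · rintro ⟨h, hh, e⟩
    exact ⟨(ε : ℤ) • (show M →ₗ[Aᵐᵒᵖ] degZero 𝒜 from h), zsmul_mem hh _, fun x =>
      (e x).trans (zero_add _)⟩
  · rintro ⟨h, hh, e⟩
    exact ⟨(ε : ℤ) • h, zsmul_mem hh _, fun x =>
      (e x).trans ((hε _).symm.trans (zero_add (M := degZero 𝒜) _).symm)⟩

theorem null_residue_iff {M : DGModule 𝒜} {s : ℤ} :
    Null M (residue 𝒜) s ↔ resCycles M s ≤ resBoundaries M s :=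
  ⟨fun h _ hf => isBoundary_residue_iff.1 (h 1 _ (isCycle_residue_iff.2 hf)),
    fun h _ _ hf => isBoundary_residue_iff.2 (h (isCycle_residue_iff.1 hf))⟩

theorem isSemisimpleModule_degZero : IsSemisimpleModule Aᵐᵒᵖ (degZero 𝒜) :=
  (isTrivialMod_degZero (𝒜 := 𝒜)).isSemisimpleModule

/-- The endomorphism ring of a finitely generated semisimple module is semisimple. -/
theorem isNoetherianRing_end_degZero : IsNoetherianRing (Module.End Aᵐᵒᵖ (degZero 𝒜)) := by
  have := isSemisimpleModule_degZero (𝒜 := 𝒜)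
  have : Module.Finite Aᵐᵒᵖ A := Module.Finite.of_surjective
    (LinearMap.toSpanSingleton Aᵐᵒᵖ A 1) fun a => ⟨MulOpposite.op a, one_mul a⟩
  have : IsSemisimpleRing (Module.End Aᵐᵒᵖ (degZero 𝒜)) := IsSemisimpleRing.moduleEnd _ _
  infer_instance

/-- The cohomology of the complex of maps to `A⁰` is finitely generated. -/
def ResFinite (M : DGModule 𝒜) (s : ℤ) : Prop :=
  ∃ G : Submodule (Module.End Aᵐᵒᵖ (degZero 𝒜)) (M →ₗ[Aᵐᵒᵖ] degZero 𝒜), G.FG ∧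
    G ≤ resCycles M s ∧ resCycles M s ≤ G ⊔ resBoundaries M s

/-- Precomposition with a linear map. -/
def precompRes {M N : DGModule 𝒜} (g : M →ₗ[Aᵐᵒᵖ] N) :
    (N →ₗ[Aᵐᵒᵖ] degZero 𝒜) →ₗ[Module.End Aᵐᵒᵖ (degZero 𝒜)] (M →ₗ[Aᵐᵒᵖ] degZero 𝒜) where
  toFun f := f ∘ₗ g
  map_add' _ _ := rfl
  map_smul' _ _ := rfl

/-- Over End(A⁰) the quotient map A → A⁰ generates all maps A → A⁰, because some endomorphism of A⁰
sends the class of 1 to any given element. -/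
theorem resFinite_regular (s : ℤ) : ResFinite (regular 𝒜) s := by
  have := isNoetherianRing_end_degZero (𝒜 := 𝒜)
  let f₀ : regular 𝒜 →ₗ[Aᵐᵒᵖ] degZero 𝒜 := (posIdeal 𝒜).mkQ
  have h : resCycles (regular 𝒜) s ≤
      Submodule.span (Module.End Aᵐᵒᵖ (degZero 𝒜)) {f₀} ⊔ ⊥ := by
    intro f _
    rw [sup_bot_eq]
    refine Submodule.mem_span_singleton.2
      ⟨isTrivialMod_degZero.fromDegZero (f regularOne), regular_hom_ext ?_⟩
    exact isTrivialMod_degZero.fromDegZero_one (f regularOne)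
  obtain ⟨G, h1, h2, h3⟩ := exists_fg_le_of_le_sup (Submodule.fg_span_singleton f₀) h
  exact ⟨G, h1, h2, h3.trans (sup_le_sup_left bot_le _)⟩

theorem ResFinite.shift {M : DGModule 𝒜} {s n : ℤ} (h : ResFinite M (s - n)) :
    ResFinite (shift n M) s := by
  obtain ⟨G, h1, h2, h3⟩ := h
  refine ⟨G.map (precompRes (ofShift n M)), h1.map _, ?_, ?_⟩
  · rintro _ ⟨f, hf, rfl⟩
    refine ⟨comp_mem_homDeg (ofShift_mem n M) (h2 hf).1 (by ring), fun x => ?_⟩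
    refine (congrArg f (ofShift_d n M x)).trans ?_
    rw [map_zsmul, (h2 hf).2, smul_zero]
  · intro f hf
    have hf' : f ∘ₗ toShift n M ∈ resCycles M (s - n) :=
      ⟨comp_mem_homDeg (toShift_mem n M) hf.1 (by ring), fun x => by
        have := hf.2 (toShift n M x)
        rw [shift_d_toShift, map_zsmul] at this
        rcases Int.units_eq_one_or n.negOnePow with h | h <;> simpa [h] using this⟩
    obtain ⟨g, hg, b, ⟨h, hh, e⟩, e'⟩ := Submodule.mem_sup.1 (h3 hf')
    refine Submodule.mem_sup.2 ⟨_, ⟨g, hg, rfl⟩, b ∘ₗ ofShift n M,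
      ⟨(n.negOnePow : ℤ) • (h ∘ₗ ofShift n M), zsmul_mem
        (comp_mem_homDeg (ofShift_mem n M) hh (by ring)) _, fun x => ?_⟩, LinearMap.ext fun x =>
        LinearMap.congr_fun e' (ofShift n M x)⟩
    rw [LinearMap.comp_apply, e, LinearMap.smul_apply, LinearMap.comp_apply, ofShift_d, map_zsmul,
      smul_smul]
    rcases Int.units_eq_one_or n.negOnePow with h | h <;> simp [h]

theorem mem_resBoundaries_cone {M N : DGModule 𝒜} {f : M ⟶ N} {s : ℤ}
    {g : cone f →ₗ[Aᵐᵒᵖ] degZero 𝒜} {h : N →ₗ[Aᵐᵒᵖ] degZero 𝒜}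
    (hh : h ∈ homDeg N.toGrModule (residue 𝒜).toGrModule (s - 1))
    (e : ∀ y, g (coneInl f y) = h (N.d y))
    (h₂ : g ∘ₗ coneInr f - h ∘ₗ f.1 ∈ resBoundaries M (s - 1)) : g ∈ resBoundaries (cone f) s := by
  refine (isBoundary_residue_iff (ε := 1)).1 (isBoundary_cone hh (fun y => ?_) ?_)
  · exact (e y).trans ((one_smul ℤ (h (N.d y))).symm.trans (zero_add _).symm)
  · refine isBoundary_residue_iff.2 ?_
    have : g ∘ₗ coneInr f - ((1 : ℤˣ) : ℤ) • (h ∘ₗ f.1) = g ∘ₗ coneInr f - h ∘ₗ f.1 :=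
      congrArg (g ∘ₗ coneInr f - ·) (one_smul ℤ _)
    exact (congrArg (· ∈ resBoundaries M (s - 1)) this).mpr h₂

theorem resCycles_cone_correction {M N : DGModule 𝒜} {f : M ⟶ N} {s : ℤ}
    {g : cone f →ₗ[Aᵐᵒᵖ] degZero 𝒜} {h : N →ₗ[Aᵐᵒᵖ] degZero 𝒜} (hg : g ∈ resCycles (cone f) s)
    (hh : h ∈ homDeg N.toGrModule (residue 𝒜).toGrModule (s - 1))
    (e : ∀ y, g (coneInl f y) = h (N.d y)) :
    g ∘ₗ coneInr f - h ∘ₗ f.1 ∈ resCycles M (s - 1) := by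
  have h₂ := isCycle_residue_iff.1 (isCycle_cone_correction (ε := 1) (isCycle_residue_iff.2 hg) hh
    fun y => (e y).trans ((one_smul ℤ (h (N.d y))).symm.trans (zero_add _).symm))
  have : g ∘ₗ coneInr f - ((1 : ℤˣ) : ℤ) • (h ∘ₗ f.1) = g ∘ₗ coneInr f - h ∘ₗ f.1 :=
    congrArg (g ∘ₗ coneInr f - ·) (one_smul ℤ _)
  exact (congrArg (· ∈ resCycles M (s - 1)) this).mp h₂

theorem resCycles_comp {M N : DGModule 𝒜} (f : M ⟶ N) {s : ℤ} {g : N →ₗ[Aᵐᵒᵖ] degZero 𝒜}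
    (hg : g ∈ resCycles N s) : g ∘ₗ f.1 ∈ resCycles M s :=
  isCycle_residue_iff.1 ((isCycle_residue_iff (ε := 1)).2 hg |>.comp f)

theorem resBoundaries_comp {M N : DGModule 𝒜} (f : M ⟶ N) {s : ℤ} {g : N →ₗ[Aᵐᵒᵖ] degZero 𝒜}
    (hg : g ∈ resBoundaries N s) : g ∘ₗ f.1 ∈ resBoundaries M s :=
  isBoundary_residue_iff.1 ((isBoundary_residue_iff (ε := 1)).2 hg |>.comp f)

theorem resCycles_comp_inl {M N : DGModule 𝒜} {f : M ⟶ N} {s : ℤ}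
    {g : cone f →ₗ[Aᵐᵒᵖ] degZero 𝒜} (hg : g ∈ resCycles (cone f) s) :
    g ∘ₗ coneInl f ∈ resCycles N s :=
  isCycle_residue_iff.1 ((isCycle_residue_iff (ε := 1)).2 hg).comp_inl

/-- The middle term of the long exact sequence is generated by the generators coming from M and by
lifts of generators of its image in the cohomology of N. That image is finitely generated by the
Noetherian property. -/
theorem ResFinite.cone {M N : DGModule 𝒜} {f : M ⟶ N} {s : ℤ} (hN : ResFinite N s)
    (hM : ResFinite M (s - 1)) : ResFinite (cone f) s := by
  have := isNoetherianRing_end_degZero (𝒜 := 𝒜)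
  obtain ⟨G, h1, -, h3⟩ := hN
  obtain ⟨G₂, k1, k2, k3⟩ := hM
  have hle : (resCycles (DGKoszul.cone f) s).map (precompRes (coneInl f)) ≤ resCycles N s := by
    rintro _ ⟨g, hg, rfl⟩
    exact resCycles_comp_inl hg
  obtain ⟨G₁, j1, j2, j3⟩ := exists_fg_le_of_le_sup h1 (hle.trans h3)
  obtain ⟨G₁', i1, i2, i3⟩ : ∃ G', G'.FG ∧ G' ≤ resCycles (DGKoszul.cone f) s ∧
      G'.map (precompRes (coneInl f)) = G₁ := by
    obtain ⟨t, rfl⟩ := j1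
    classical
    obtain ⟨t', ht', rfl⟩ := Finset.subset_set_image_iff.1 (Submodule.span_le.1 j2)
    exact ⟨Submodule.span _ t', ⟨t', rfl⟩, Submodule.span_le.2 ht', by
      rw [Submodule.map_span, Finset.coe_image]⟩
  refine ⟨G₁' ⊔ G₂.map (precompRes (coneSnd f)), i1.sup (k1.map _), sup_le i2 ?_, fun g hg => ?_⟩
  · rintro _ ⟨g, hg, rfl⟩
    refine ⟨comp_mem_homDeg (coneSnd_mem f) (k2 hg).1 (by ring), fun x => ?_⟩
    change g (coneSnd f _) = 0
    rw [coneSnd_d, map_neg, (k2 hg).2, neg_zero]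
  · obtain ⟨_, hx, b, ⟨h, hh, e⟩, e'⟩ := Submodule.mem_sup.1 (j3 ⟨g, hg, rfl⟩)
    rw [← i3] at hx
    obtain ⟨g', hg', rfl⟩ := hx
    have e1 : ∀ y, (g - g') (coneInl f y) = h (N.d y) := fun y => by
      rw [← e, LinearMap.sub_apply, sub_eq_iff_eq_add']
      exact (LinearMap.congr_fun e' y).symm
    obtain ⟨g₂, hg₂, b₂, hb₂, e₂⟩ := Submodule.mem_sup.1
      (k3 (resCycles_cone_correction (sub_mem hg (i2 hg')) hh e1))
    have hz' : g - g' - g₂ ∘ₗ coneSnd f ∈ resBoundaries (DGKoszul.cone f) s := by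
      refine mem_resBoundaries_cone hh (fun y => ?_) ?_
      · rw [LinearMap.sub_apply, e1, LinearMap.comp_apply, coneSnd_inl, map_zero, sub_zero]
      · have : (g - g' - g₂ ∘ₗ coneSnd f) ∘ₗ coneInr f - h ∘ₗ f.1 = b₂ := by
          rw [← add_right_inj g₂, e₂]
          refine LinearMap.ext fun x => ?_
          simp only [LinearMap.add_apply, LinearMap.sub_apply, LinearMap.comp_apply, coneSnd_inr]
          abel
        rw [this]
        exact hb₂
    refine Submodule.mem_sup.2 ⟨g' + g₂ ∘ₗ coneSnd f, add_mem (Submodule.mem_sup_left hg')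
      (Submodule.mem_sup_right ⟨g₂, hg₂, rfl⟩), _, hz', ?_⟩
    abel

theorem ResFinite.retract {X Y : DGModule 𝒜} {i : X ⟶ Y} {r : Y ⟶ X}
    (h : homotopic (i ≫ r) (𝟙 X)) {s : ℤ} (hY : ResFinite Y s) : ResFinite X s := by
  obtain ⟨G, h1, h2, h3⟩ := hY
  refine ⟨G.map (precompRes i.1), h1.map _, ?_, fun f hf => ?_⟩
  · rintro _ ⟨g, hg, rfl⟩
    exact resCycles_comp i (h2 hg)
  · obtain ⟨g, hg, b, hb, e⟩ := Submodule.mem_sup.1 (h3 (resCycles_comp r hf))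
    have hb1 := (isBoundary_residue_iff (ε := 1)).2 (resBoundaries_comp i hb)
    have hb2 := isBoundary_sub_of_homotopic ((isCycle_residue_iff (ε := 1)).2 hf) h
    refine Submodule.mem_sup.2 ⟨_, ⟨g, hg, rfl⟩, _, isBoundary_residue_iff.1 (hb1.sub hb2), ?_⟩
    refine LinearMap.ext fun x => ?_
    have e1 : g (i.1 x) + b (i.1 x) = f (r.1 (i.1 x)) := LinearMap.congr_fun e (i.1 x)
    change g (i.1 x) + (b (i.1 x) - (f (r.1 (i.1 x)) - f x)) = f x
    rw [← e1]
    abel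

theorem IsPerfect.resFinite {M : DGModule 𝒜} (hM : IsPerfect 𝒜 (toHot M)) (s : ℤ) :
    ResFinite M s :=
  isPerfect_induction (p := fun M => ∀ s, ResFinite M s) resFinite_regular
    (fun _ _ h _ => (h _).shift) (fun _ _ _ h h' s => (h' s).cone (h _))
    (fun _ _ _ _ e h s => (h s).retract e) hM s

end Residue

/-! ### The dg module K(A): linear, perfect, and a resolution of A⁰. -/

section KoszulComplex

variable {A : Type u} [Ring A] {𝒜 : ℤ → AddSubgroup A}

namespace KoszulResolution

variable (P : KoszulResolution 𝒜)

/-- The `n`-th component of `K(A)`, shifted to be generated in degree zero. -/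
def term (n : ℕ) : GrModule 𝒜 := (P.X n).shift n

/-- The projections of `K(A)` to its components. -/
noncomputable def component (n : ℕ) : P.K →ₗ[Aᵐᵒᵖ] P.term n :=
  (DirectSum.component Aᵐᵒᵖ ℕ (fun n => P.X n) n)

/-- The inclusions of the components of `K(A)`. -/
noncomputable def single (n : ℕ) : P.term n →ₗ[Aᵐᵒᵖ] P.K :=
  (DirectSum.lof Aᵐᵒᵖ ℕ (fun n => (P.X n : Type u)) n)

/-- The differential of the resolution with the sign used in `K(A)`. -/
def sd (n : ℕ) : P.term (n + 1) →ₗ[Aᵐᵒᵖ] P.term n :=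
  (((-1 : ℤ) ^ (n + 1)) • P.d n : P.X (n + 1) →ₗ[Aᵐᵒᵖ] P.X n)

/-- The augmentation on the component of index zero. -/
def augZero : P.term 0 →ₗ[Aᵐᵒᵖ] degZero 𝒜 := P.ε

theorem component_mem (n : ℕ) : P.component n ∈ homDeg P.K.toGrModule (P.term n) 0 :=
  fun i x hx => by rw [add_zero]; exact hx n

theorem ext_component {x y : P.K} (h : ∀ n, P.component n x = P.component n y) : x = y :=
  DFinsupp.ext h

theorem component_single_same (n : ℕ) (x : P.term n) : P.component n (P.single n x) = x :=
  DirectSum.of_eq_same (β := fun n => (P.X n : Type u)) n x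

theorem component_single_ne {m n : ℕ} (h : m ≠ n) (x : P.term n) :
    P.component m (P.single n x) = 0 :=
  DirectSum.of_eq_of_ne (β := fun n => (P.X n : Type u)) n m x h

theorem single_mem (n : ℕ) : P.single n ∈ homDeg (P.term n) P.K.toGrModule 0 := fun i x hx => by
  rw [add_zero]
  intro m
  change P.component m (P.single n x) ∈ (P.term m).deg i
  by_cases h : m = n
  · subst h
    rwa [component_single_same]
  · rw [component_single_ne _ h]
    exact zero_mem _

theorem component_d (n : ℕ) (x : P.K) :
    P.component n (P.K.d x) = P.sd n (P.component (n + 1) x) :=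
  P.kd_apply x n

theorem sd_eq_zero_iff (n : ℕ) (x : P.term (n + 1)) : P.sd n x = 0 ↔ P.d n x = 0 := by
  change ((-1 : ℤ) ^ (n + 1)) • P.d n x = 0 ↔ P.d n x = 0
  rcases neg_one_pow_eq_or ℤ (n + 1) with h | h <;> simp [h]

theorem exists_sd_eq_iff (n : ℕ) (x : P.term n) :
    (∃ y, P.sd n y = x) ↔ ∃ y, P.d n y = x := by
  change (∃ y, ((-1 : ℤ) ^ (n + 1)) • P.d n y = x) ↔ ∃ y, P.d n y = x
  rcases neg_one_pow_eq_or ℤ (n + 1) with h | h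
  · simp [h]
  · rw [h]
    constructor
    · rintro ⟨y, hy⟩; exact ⟨-y, by simpa using hy⟩
    · rintro ⟨y, hy⟩; exact ⟨-y, by simpa using hy⟩

theorem exact_sd_sd (n : ℕ) : Function.Exact (P.sd (n + 1)) (P.sd n) := fun x => by
  rw [sd_eq_zero_iff]
  exact (P.exact_succ n x).trans (P.exists_sd_eq_iff (n + 1) x).symm

theorem exact_sd_aug : Function.Exact (P.sd 0) P.augZero := fun x =>
  (P.exact_zero x).trans (P.exists_sd_eq_iff 0 x).symm

theorem sd_mem (n : ℕ) : P.sd n ∈ homDeg (P.term (n + 1)) (P.term n) 1 := fun i x hx => by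
  have h := P.d_mem n _ _ hx
  rw [show i + ((n + 1 : ℕ) : ℤ) + 0 = i + 1 + n by push_cast; ring] at h
  exact zsmul_mem h _

theorem isLinear_term (hfg : P.FinitelyGenerated) (n : ℕ) : (P.term n).IsLinear where
  projective := (P.projective n).shift n
  generated := by
    have := P.generated n
    rw [← zero_add (n : ℤ)] at this
    exact this
  finite := hfg n

/-- For a resolution of finite length the direct sum is the product. -/
theorem exists_component_eq {N : ℕ} (hN : ∀ n ≥ N, Subsingleton (P.X n)) (f : ∀ n, P.term n) :
    ∃ x : P.K, ∀ n, P.component n x = f n := by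
  have key : ∀ g : ∀ n, P.X n, ∃ x : DirectSum ℕ fun n => P.X n, ∀ n, n < N → x n = g n := fun g =>
    ⟨(DFinsupp.mk (Finset.range N) fun n => g n.1 : Π₀ n, (P.X n : Type u)), fun n h =>
      DFinsupp.mk_of_mem (β := fun n => (P.X n : Type u)) (Finset.mem_range.2 h)⟩
  obtain ⟨x, hx⟩ := key f
  refine ⟨x, fun n => ?_⟩
  rcases Nat.lt_or_ge n N with h | h
  · exact hx n h
  · have := hN n h
    exact Subsingleton.elim (α := P.X n) _ _

theorem sum_single {N : ℕ} (hN : ∀ n ≥ N, Subsingleton (P.X n)) (x : P.K) :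
    ∑ n ∈ Finset.range N, P.single n (P.component n x) = x := by
  refine P.ext_component fun m => ?_
  rw [map_sum]
  rcases Nat.lt_or_ge m N with h | h
  · rw [Finset.sum_eq_single m (fun n _ hn => P.component_single_ne hn.symm _)
      (fun h' => absurd (Finset.mem_range.2 h) h'), component_single_same]
  · have := hN m h
    exact Subsingleton.elim (α := P.X m) _ _

theorem isLinear_K (hlen : P.FiniteLength) (hfg : P.FinitelyGenerated) :
    P.K.toGrModule.IsLinear := by
  obtain ⟨N, hN⟩ := hlen
  refine ⟨fun M M' p f hp hps hf => ?_, ?_, ?_⟩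
  · choose g hg e using fun n => (P.isLinear_term hfg n).projective M M' p (f ∘ₗ P.single n) hp hps
      (comp_mem_homDeg (P.single_mem n) hf (add_zero 0))
    refine ⟨∑ n ∈ Finset.range N, g n ∘ₗ P.component n, sum_mem fun n _ =>
      comp_mem_homDeg (P.component_mem n) (hg n) (add_zero 0), LinearMap.ext fun x => ?_⟩
    have e' : ∀ n y, p (g n y) = f (P.single n y) := fun n => LinearMap.congr_fun (e n)
    rw [LinearMap.comp_apply, LinearMap.sum_apply, map_sum]
    simp only [LinearMap.comp_apply, e']
    rw [← map_sum, P.sum_single hN]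
  · rw [eq_top_iff]
    intro x _
    rw [← P.sum_single hN x]
    refine sum_mem fun n _ => ?_
    refine generated_induction (P.isLinear_term hfg n).generated (P.component n x)
      (fun a v hv => ?_) (by rw [map_zero]; exact zero_mem _)
      (fun x y hx hy => by rw [map_add]; exact add_mem hx hy)
    rw [map_smul]
    refine Submodule.smul_mem _ _ (Submodule.subset_span ?_)
    have := P.single_mem n 0 v hv
    rwa [add_zero] at this
  · have : ∀ n, Module.Finite Aᵐᵒᵖ (P.term n) := fun n => (P.isLinear_term hfg n).finite
    refine Module.Finite.of_surjective (M := ∀ n : Fin N, P.term n)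
      (∑ n : Fin N, P.single n ∘ₗ LinearMap.proj (φ := fun n : Fin N => (P.term n : Type u)) n)
      fun x => ⟨fun n => P.component n x, ?_⟩
    rw [LinearMap.sum_apply]
    exact (Fin.sum_univ_eq_sum_range (fun n => P.single n (P.component n x)) N).trans
      (P.sum_single hN x)

variable [GradedRing 𝒜] [PosSemisimple 𝒜]

/-- Linear dg submodules of powers of `K(A)` are perfect. -/
theorem isPerfect_of_injective (hlen : P.FiniteLength) (hfg : P.FinitelyGenerated)
    {Y : DGModule 𝒜} (hY : Y.toGrModule.IsLinear) {n : ℕ} (j : Y ⟶ P.K.pow n)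
    (hj : Function.Injective j.1) : IsPerfect 𝒜 (toHot Y) := by
  obtain ⟨N, hN⟩ := hlen
  refine DGKoszul.isPerfect_of_injective (P.isLinear_term hfg) P.component_mem
    (fun x h => P.ext_component fun n => (h n).trans (map_zero _).symm) (fun k x h => ?_)
    (fun k (hk : k ≥ N) => ?_) hY j hj
  · rw [component_d, h, map_zero]
  · have := hN k hk
    exact LinearMap.ext fun x => Subsingleton.elim (α := P.X k) _ _

theorem isPerfect_pow (hlen : P.FiniteLength) (hfg : P.FinitelyGenerated) (n : ℕ) :
    IsPerfect 𝒜 (toHot (P.K.pow n)) :=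
  P.isPerfect_of_injective hlen hfg ((P.isLinear_K hlen hfg).pow n) (𝟙 _) Function.injective_id

theorem isPerfect_K (hlen : P.FiniteLength) (hfg : P.FinitelyGenerated) :
    IsPerfect 𝒜 (toHot P.K) :=
  P.isPerfect_of_injective hlen hfg (P.isLinear_K hlen hfg)
    (DGModule.powLift fun _ : Fin 1 => 𝟙 _) fun _ _ h => congrFun h 0

/-- The augmentation of `K(A)` as a linear map. -/
noncomputable def augLin : P.K →ₗ[Aᵐᵒᵖ] degZero 𝒜 := P.augZero ∘ₗ P.component 0

/-- The augmentation `K(A) → A⁰`. -/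
noncomputable def aug : P.K ⟶ residue 𝒜 :=
  ⟨P.augLin, mem_homDeg_residue.2 fun i hi x hx => by
      have h := P.ε_mem _ _ (hx 0)
      obtain ⟨a, ha, e⟩ := h
      refine e.symm.trans ((Submodule.Quotient.mk_eq_zero _).2 ?_)
      rcases lt_trichotomy i 0 with h | h | h
      · rw [Nat.cast_zero, add_zero, PosSemisimple.positive (𝒜 := 𝒜) i h] at ha
        rw [(AddSubgroup.mem_bot.1 ha)]
        exact zero_mem _
      · omega
      · exact mem_posIdeal_of_mem (by simpa using h) ha,
    LinearMap.ext fun x => by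
      have h : P.augZero (P.component 0 (P.K.d x)) = 0 := by
        rw [component_d]
        exact P.exact_sd_aug.apply_apply_eq_zero _
      exact h.symm⟩

theorem aug_apply (x : P.K) : P.aug.1 x = P.augZero (P.component 0 x) := rfl

/-- A cycle of the cone has second entry k with d k = 0 and zero augmentation. Exactness of the
resolution, one component at a time, and surjectivity onto A⁰ provide a preimage. -/
theorem acyclic_cone_aug (hlen : P.FiniteLength) : Acyclic (cone P.aug) := by
  obtain ⟨N, hN⟩ := hlen
  intro i z _ hz
  have h1 : P.K.d (coneSnd P.aug z) = 0 := by
    have := congrArg (coneSnd P.aug) hz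
    rwa [coneSnd_d, map_zero, neg_eq_zero] at this
  have h2 : P.augZero (P.component 0 (coneSnd P.aug z)) = 0 := by
    have := congrArg (coneFst P.aug) hz
    rw [coneFst_d, map_zero] at this
    exact (zero_add (M := residue 𝒜) _).symm.trans this
  set k := coneSnd P.aug z
  have h3 : ∀ n, ∃ y, P.sd n y = -(P.component n k) := by
    intro n
    cases n with
    | zero => exact (P.exact_sd_aug _).1 (by rw [map_neg, h2, neg_zero])
    | succ n =>
      refine (P.exact_sd_sd n _).1 ?_
      rw [map_neg, ← component_d, h1, map_zero, neg_zero]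
  choose y hy using h3
  obtain ⟨y₀, hy₀⟩ : ∃ y₀, P.augZero y₀ = coneFst P.aug z := P.surjective _
  -- The preimage of component n of -k is placed at index n + 1. Index 0 is invisible to the
  -- differential and is free to provide the required augmentation.
  obtain ⟨l, hl⟩ := P.exists_component_eq hN fun n => Nat.casesOn n y₀ y
  refine ⟨coneInr P.aug l, ?_⟩
  have h4 : P.aug.1 l = coneFst P.aug z := by rw [aug_apply, hl 0]; exact hy₀
  have h5 : P.K.d l = -k := P.ext_component fun n => by
    rw [component_d, hl (n + 1), map_neg]; exact hy n
  rw [cone_d_inr, h4, h5, map_neg, sub_neg_eq_add, coneInl_fst_add]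

/-- Surjectivity of Hˢ(M, K) → Hˢ(M, A⁰): included into the acyclic cone of the augmentation, f is
null-homotopic, and the second entry of the homotopy is the lift. -/
theorem exists_lift_aug (hlen : P.FiniteLength) {M : DGModule 𝒜} (hM : IsPerfect 𝒜 (toHot M))
    {s : ℤ} {f : M →ₗ[Aᵐᵒᵖ] degZero 𝒜} (hf : f ∈ resCycles M s) (ε : ℤˣ) :
    ∃ g, IsCycle M P.K s ε g ∧ f - P.augLin ∘ₗ g ∈ resBoundaries M s := by
  have hf' : IsCycle M (cone P.aug) s ε (coneInl P.aug ∘ₗ f) := by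
    refine ⟨comp_mem_homDeg hf.1 (coneInl_mem _) (add_zero _), fun x => ?_⟩
    have h1 : (coneInl P.aug ∘ₗ f) (M.d x) = 0 :=
      (congrArg (coneInl P.aug) (hf.2 x)).trans (map_zero _)
    rw [h1, smul_zero]
    exact (cone_d_inl P.aug (f x)).trans (map_zero _)
  obtain ⟨h, hh, e⟩ := hM.null_of_acyclic (P.acyclic_cone_aug hlen) s ε _ hf'
  refine ⟨coneSnd P.aug ∘ₗ h, ⟨comp_mem_homDeg hh (coneSnd_mem _) (by ring), fun x => ?_⟩,
    (ε : ℤ) • (coneFst P.aug ∘ₗ h : M →ₗ[Aᵐᵒᵖ] degZero 𝒜),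
    zsmul_mem (comp_mem_homDeg hh (coneFst_mem _) (by ring)) _,
    fun x => ?_⟩
  · have h1 := congrArg (coneSnd P.aug) (e x)
    rw [map_add, coneSnd_d, map_zsmul] at h1
    have h2 : coneSnd P.aug ((coneInl P.aug ∘ₗ f) x) = 0 := rfl
    rw [h2] at h1
    exact (neg_add_eq_zero.1 h1.symm)
  · have h1 := congrArg (coneFst P.aug) (e x)
    rw [map_add, coneFst_d, map_zsmul] at h1
    have h2 : f x = 0 + P.augLin (coneSnd P.aug (h x)) +
      ((ε : ℤ) • (coneFst P.aug ∘ₗ h : M →ₗ[Aᵐᵒᵖ] degZero 𝒜)) (M.d x) := h1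
    rw [zero_add] at h2
    exact sub_eq_of_eq_add' h2

/-- Injectivity of Hˢ(M, K) → Hˢ(M, A⁰): g and a homotopy k for its augmentation combine to a cycle
with values in the acyclic cone, and the second entry of a null-homotopy bounds g. -/
theorem isBoundary_of_aug (hlen : P.FiniteLength) {M : DGModule 𝒜} (hM : IsPerfect 𝒜 (toHot M))
    {s : ℤ} {ε : ℤˣ} {g : M →ₗ[Aᵐᵒᵖ] P.K} (hg : IsCycle M P.K s ε g)
    (h : P.augLin ∘ₗ g ∈ resBoundaries M s) : IsBoundary M P.K s ε g := by
  obtain ⟨k, hk, e⟩ := h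
  have hε : ∀ {N : DGModule 𝒜} (y : N), (ε : ℤ) • (ε : ℤ) • y = y := by
    intro N y
    rcases Int.units_eq_one_or ε with rfl | rfl <;> simp
  have hc : IsCycle M (cone P.aug) (s - 1) (-ε)
      (coneInr P.aug ∘ₗ g - (ε : ℤ) • (coneInl P.aug ∘ₗ k)) := by
    refine ⟨sub_mem (comp_mem_homDeg hg.1 (coneInr_mem _) (by ring))
      (zsmul_mem (comp_mem_homDeg hk (coneInl_mem _) (by ring)) _), fun x => ?_⟩
    have h1 : (cone P.aug).d (coneInl P.aug (k x)) = 0 :=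
      (cone_d_inl P.aug (k x)).trans (map_zero _)
    have h2 : coneInl P.aug (P.aug.1 (g x)) = coneInl P.aug (k (M.d x)) :=
      congrArg (coneInl P.aug) (e x)
    have h3 : (cone P.aug).d (coneInr P.aug (g x)) =
        coneInl P.aug (k (M.d x)) - (ε : ℤ) • coneInr P.aug (g (M.d x)) := by
      rw [cone_d_inr, h2, hg.2, map_zsmul]
    change (cone P.aug).d (coneInr P.aug (g x) - (ε : ℤ) • coneInl P.aug (k x)) =
      ((-ε : ℤˣ) : ℤ) • (coneInr P.aug (g (M.d x)) - (ε : ℤ) • coneInl P.aug (k (M.d x)))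
    rw [map_sub, map_zsmul, h1, h3, Units.val_neg, neg_smul, smul_sub, hε, smul_zero]
    abel
  obtain ⟨w, hw, e'⟩ := hM.null_of_acyclic (P.acyclic_cone_aug hlen) _ _ _ hc
  refine ⟨-(coneSnd P.aug ∘ₗ w), neg_mem (comp_mem_homDeg hw (coneSnd_mem _) (by ring)),
    fun x => ?_⟩
  have h1 := congrArg (coneSnd P.aug) (e' x)
  rw [map_add, coneSnd_d, map_zsmul] at h1
  have h2 : coneSnd P.aug ((coneInr P.aug ∘ₗ g - (ε : ℤ) • (coneInl P.aug ∘ₗ k)) x) = g x := by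
    refine (map_sub (coneSnd P.aug) _ _).trans ?_
    have : coneSnd P.aug ((ε : ℤ) • (coneInl P.aug ∘ₗ k) x) = 0 :=
      (map_zsmul _ _ _).trans (smul_zero _)
    exact (congrArg₂ (· - ·) rfl this).trans (sub_zero _)
  rw [← h2, h1]
  simp

theorem null_K (hlen : P.FiniteLength) {M : DGModule 𝒜} (hM : IsPerfect 𝒜 (toHot M)) {s : ℤ}
    (h : Null M (residue 𝒜) s) : Null M P.K s := fun ε _ hg =>
  P.isBoundary_of_aug hlen hM hg (null_residue_iff.1 h
    (isCycle_residue_iff.1 (hg.postcomp P.aug : IsCycle M (residue 𝒜) s ε _)))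

end KoszulResolution

end KoszulComplex

/-! ### Linear dg modules, reductions, and cones as seen by A⁰. -/

section LinearModules
variable {A : Type u} [Ring A] {𝒜 : ℤ → AddSubgroup A} [GradedRing 𝒜]

theorem isLinear_regular : (regular 𝒜).toGrModule.IsLinear where
  projective M N p f hp hps hf := by
    obtain ⟨y, hy⟩ := hps (f regularOne)
    have h1 : f regularOne ∈ N.deg 0 := by simpa using hf 0 regularOne regularOne_mem
    let M' : DGModule 𝒜 := ⟨M, 0, zero_mem _, by simp⟩
    refine ⟨fromRegular M' (M.proj 0 y), fromRegular_mem (N := M') (M.proj_mem 0 y),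
      regular_hom_ext ?_⟩
    refine (congrArg p (fromRegular_one (N := M') (M.proj 0 y))).trans ?_
    rw [← proj_apply_of_mem_homDeg hp 0 0 (add_zero 0), hy, N.proj_of_mem h1]
  generated := by
    rw [eq_top_iff]
    intro a _
    have : a = MulOpposite.op (show A from a) • (regularOne : regular 𝒜) :=
      (one_mul (M := A) a).symm
    rw [this]
    exact Submodule.smul_mem _ _ (Submodule.subset_span regularOne_mem)
  finite := Module.Finite.of_surjective (LinearMap.toSpanSingleton Aᵐᵒᵖ A 1) fun a =>
    ⟨MulOpposite.op a, one_mul (M := A) a⟩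

variable [PosSemisimple 𝒜]

/-- Components of nonzero degree lie in Y A⁺, which every map to A⁰ kills; the differential sends
generators into degree one. The complex Hom(Y, A⁰) is therefore concentrated in degree zero. -/
theorem GrModule.IsLinear.mem_resCycles {Y : DGModule 𝒜} (hY : Y.toGrModule.IsLinear)
    (k : Y →ₗ[Aᵐᵒᵖ] degZero 𝒜) : k ∈ resCycles Y 0 := by
  have h1 : ∀ i ≠ 0, ∀ x ∈ Y.deg i, k x = 0 := fun i hi x hx =>
    (isTrivialMod_degZero (𝒜 := 𝒜)).map_mulPos k (mem_mulPos_of_generated hY.generated hi hx)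
  have h2 : k ∘ₗ Y.d = 0 := generated_hom_ext hY.generated fun v hv =>
    h1 1 one_ne_zero _ (by simpa using Y.d_mem 0 v hv)
  exact ⟨mem_homDeg_residue.2 fun i hi => h1 i (by simpa using hi), LinearMap.congr_fun h2⟩

theorem GrModule.IsLinear.eq_zero_of_mem_resBoundaries {Y : DGModule 𝒜}
    (hY : Y.toGrModule.IsLinear) {k : Y →ₗ[Aᵐᵒᵖ] degZero 𝒜}
    (hk : k ∈ resBoundaries Y 0) : k = 0 := by
  obtain ⟨h, -, e⟩ := hk
  exact LinearMap.ext fun x => (e x).trans ((hY.mem_resCycles h).2 x)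

theorem GrModule.IsLinear.null_residue {Y : DGModule 𝒜}
    (hY : Y.toGrModule.IsLinear) {s : ℤ} (hs : s ≠ 0) : Null Y (residue 𝒜) s := by
  rw [null_residue_iff]
  intro f hf
  have : f = 0 := generated_hom_ext hY.generated fun v hv =>
    mem_homDeg_residue.1 hf.1 0 (by simpa using hs) v hv
  rw [this]
  exact zero_mem _

theorem GrModule.IsLinear.suppBar_subset {Y : DGModule 𝒜}
    (hY : Y.toGrModule.IsLinear) : suppBar Y ⊆ {0} := by
  intro i hi
  by_contra h
  refine hi ?_
  rintro x ⟨⟨y, hy, rfl⟩, -⟩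
  have : (mulPos Y.toGrModule).mkQ.toAddMonoidHom y = 0 :=
    (Submodule.Quotient.mk_eq_zero _).2 (mem_mulPos_of_generated hY.generated h hy)
  rw [this]
  exact zero_mem _

/-- A homotopy has degree -1, so it sends the generators to the zero component of degree -1 of Z. -/
theorem GrModule.IsLinear.eq_of_homotopic {Y : DGModule 𝒜}
    (hY : Y.toGrModule.IsLinear) {Z : DGModule 𝒜} (hZ : Z.toGrModule.IsLinear)
    {f g : Y ⟶ Z} (h : homotopic f g) : f = g := by
  obtain ⟨h, hh, e⟩ := h
  have : h = 0 := generated_hom_ext hY.generated fun v hv => by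
    have := hh 0 v hv
    rwa [deg_eq_bot_of_generated hZ.generated (by norm_num)] at this
  rw [this, LinearMap.comp_zero, LinearMap.zero_comp, add_zero, sub_eq_zero] at e
  exact Subtype.ext e

/-- The homogeneous components of the quotient map are again linear maps to a module killed by A⁺,
so they vanish on M A⁺. -/
theorem proj_mem_mulPos {M : GrModule 𝒜} {x : M} (hx : x ∈ mulPos M) (i : ℤ) :
    M.proj i x ∈ mulPos M :=
  (Submodule.Quotient.mk_eq_zero _).1
    ((isTrivialMod_bar M).map_mulPos ((isTrivialMod_bar M).component (mulPos M).mkQ i) hx)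

/-- Maps to A⁰ factor through the reduction, and over a semisimple ring a functional that kills all
cocycles extends along the differential. -/
theorem null_residue_of_suppBar {M : DGModule 𝒜} {s : ℤ} (h : -s ∉ suppBar M) :
    Null M (residue 𝒜) s := by
  have h' : barCocycles M (-s) ≤ barCoboundaries M (-s) := not_not.1 h
  rw [null_residue_iff]
  intro f hf
  have hproj : ∀ x, f (M.proj (-s) x) = f x := fun x => by
    induction x using M.homogeneous_induction with
    | mem i x hx =>
      by_cases hi : -s = i
      · rw [hi, M.proj_of_mem hx]
      · rw [M.proj_of_mem_ne hi hx, map_zero,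
          mem_homDeg_residue.1 hf.1 i (by omega) x hx]
    | zero => rw [map_zero]
    | add x y hx hy => rw [map_add, map_add, map_add, hx, hy]
  have hd : ∀ x, M.d (M.proj (-s) x) = M.proj (1 - s) (M.d x) := fun x =>
    (proj_apply_of_mem_homDeg M.d_mem (-s) (1 - s) (by ring) x).symm
  let f' : Bar M →ₗ[Aᵐᵒᵖ] degZero 𝒜 :=
    (mulPos M.toGrModule).liftQ f ((isTrivialMod_degZero (𝒜 := 𝒜)).map_mulPos f)
  have hf'd : ∀ b, f' (barD M b) = 0 := fun b => by
    obtain ⟨m, rfl⟩ := (mulPos M.toGrModule).mkQ_surjective b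
    exact hf.2 m
  -- Only the component of degree -s matters to f. It is again a cocycle, hence a coboundary, and f
  -- kills coboundaries.
  have hker : ∀ b, barD M b = 0 → f' b = 0 := fun b hb => by
    obtain ⟨m, rfl⟩ := (mulPos M.toGrModule).mkQ_surjective b
    have hm : M.d m ∈ mulPos M.toGrModule := (Submodule.Quotient.mk_eq_zero _).1 hb
    have h2 : (mulPos M.toGrModule).mkQ (M.proj (-s) m) ∈ barCoboundaries M (-s) :=
      h' ⟨⟨_, M.proj_mem _ _, rfl⟩, (Submodule.Quotient.mk_eq_zero _).2
        (hd m ▸ proj_mem_mulPos hm _)⟩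
    obtain ⟨c, -, hc⟩ := h2
    exact (hproj m).symm.trans ((congrArg f' hc).symm.trans (hf'd c))
  have := (isTrivialMod_bar M.toGrModule).isSemisimpleModule
  obtain ⟨r, hr⟩ := exists_regular_of_isSemisimpleModule (barD M)
  have hr' : ∀ b, f' (r (barD M b)) = f' b := fun b => by
    have h1 := hker (r (barD M b) - b) (by
      rw [map_sub, sub_eq_zero]; exact LinearMap.congr_fun hr b)
    rwa [map_sub, sub_eq_zero] at h1
  -- The quasi-inverse r need not respect degrees, so only the component of degree 1 - s of the
  -- resulting homotopy is kept.
  refine ⟨(isTrivialMod_degZero (𝒜 := 𝒜)).component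
    (f' ∘ₗ r ∘ₗ (mulPos M.toGrModule).mkQ) (1 - s), mem_homDeg_residue.2 fun i hi x hx => ?_,
    fun x => ?_⟩
  · change f' (r ((mulPos M.toGrModule).mkQ (M.proj (1 - s) x))) = 0
    rw [M.proj_of_mem_ne (by omega) hx, map_zero, map_zero, map_zero]
  · change f x = f' (r ((mulPos M.toGrModule).mkQ (M.proj (1 - s) (M.d x))))
    rw [← hd]
    exact ((hr' ((mulPos M.toGrModule).mkQ (M.proj (-s) x))).trans (hproj x)).symm

/-- The morphism induces a surjection on cocycles with values in the residue module. -/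
def ResSurjective {M N : DGModule 𝒜} (f : M ⟶ N) : Prop :=
  ∀ ψ ∈ resCycles M 0, ∃ k ∈ resCycles N 0, ψ - k ∘ₗ f.1 ∈ resBoundaries M 0

/-- In the long exact sequence only s = 1 involves H⁰(M, A⁰); there the surjectivity of f on degree
zero cohomology is used. -/
theorem null_residue_cone {M N : DGModule 𝒜} {f : M ⟶ N}
    (hM : ∀ s ≠ 0, Null M (residue 𝒜) s) (hN : ∀ s ≠ 0, Null N (residue 𝒜) s)
    (hf : ResSurjective f) {s : ℤ} (hs : s ≠ 0) : Null (cone f) (residue 𝒜) s := by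
  by_cases h1 : s = 1
  · subst h1
    rw [null_residue_iff]
    intro g hg
    obtain ⟨h, hh, e⟩ := null_residue_iff.1 (hN 1 one_ne_zero) (resCycles_comp_inl hg)
    have hc := resCycles_cone_correction hg hh e
    rw [sub_self] at hc hh
    obtain ⟨k, hk, hk'⟩ := hf _ hc
    refine mem_resBoundaries_cone (h := h + k) ?_ (fun y => ?_) ?_
    · rw [sub_self]
      exact add_mem hh hk.1
    · rw [LinearMap.add_apply, hk.2, add_zero]
      exact e y
    · rw [LinearMap.add_comp, ← sub_sub, sub_self]
      exact hk'
  · exact (hN s hs).cone (hM _ (by omega))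

/-- H⁰ of the cone sits between H⁻¹(M, A⁰), which vanishes, and the kernel of H⁰(N, A⁰) → H⁰(M, A⁰).
-/
theorem null_residue_cone_zero {M N : DGModule 𝒜} {f : M ⟶ N}
    (hM : Null M (residue 𝒜) (-1))
    (hf : ∀ k ∈ resCycles N 0, k ∘ₗ f.1 ∈ resBoundaries M 0 → k ∈ resBoundaries N 0) :
    Null (cone f) (residue 𝒜) 0 := by
  rw [null_residue_iff]
  intro g hg
  have h1 : (g ∘ₗ coneInl f) ∘ₗ f.1 ∈ resBoundaries M 0 := by
    refine ⟨g ∘ₗ coneInr f, comp_mem_homDeg (N := (residue 𝒜).toGrModule) (coneInr_mem f) hg.1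
      (by ring), fun x => ?_⟩
    have := hg.2 (coneInr f x)
    rw [cone_d_inr, map_sub, sub_eq_zero] at this
    exact this
  obtain ⟨h, hh, e⟩ := hf _ (resCycles_comp_inl hg) h1
  rw [← zero_sub (1 : ℤ)] at hM
  exact mem_resBoundaries_cone hh e (null_residue_iff.1 hM (resCycles_cone_correction hg hh e))

end LinearModules

/-! ### Dévissage in the target, and contractible cones. -/

section SecondVariable

variable {A : Type u} [Ring A] {𝒜 : ℤ → AddSubgroup A}

theorem Null.to_shift {X Y : DGModule 𝒜} {s n : ℤ} (h : Null X Y (s + n)) :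
    Null X (DGKoszul.shift n Y) s := by
  rintro ε f ⟨hf, hfd⟩
  have hn : ∀ {Z : DGModule 𝒜} (z : Z), (n.negOnePow : ℤ) • (n.negOnePow : ℤ) • z = z := by
    intro Z z
    rw [smul_smul, ← Units.val_mul, Int.units_mul_self, Units.val_one, one_smul]
  obtain ⟨k, hk, e⟩ := h (ε * n.negOnePow) (ofShift n Y ∘ₗ f)
    ⟨comp_mem_homDeg hf (ofShift_mem n Y) rfl, fun x => by
      have h1 := congrArg (ofShift n Y) (hfd x)
      rw [ofShift_d, map_zsmul] at h1
      have h2 := congrArg (fun z => (n.negOnePow : ℤ) • z) h1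
      simp only [hn] at h2
      rw [LinearMap.comp_apply, h2, smul_smul, ← Units.val_mul, mul_comm]
      rfl⟩
  refine ⟨(n.negOnePow : ℤ) • (toShift n Y ∘ₗ k),
    zsmul_mem (comp_mem_homDeg hk (toShift_mem n Y) (by ring)) _, fun x => ?_⟩
  have h1 : f x = toShift n Y (Y.d (k x) + ((ε * n.negOnePow : ℤˣ) : ℤ) • k (X.d x)) :=
    congrArg (toShift n Y) (e x)
  rw [h1, LinearMap.smul_apply, LinearMap.smul_apply, map_zsmul, LinearMap.comp_apply,
    shift_d_toShift, hn, map_add, map_zsmul, Units.val_mul, mul_smul]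
  rfl

theorem IsBoundary.isCycle {M N : DGModule 𝒜} {s : ℤ} {ε : ℤˣ} {f : M →ₗ[Aᵐᵒᵖ] N}
    (hf : IsBoundary M N s ε f) : IsCycle M N s ε f := by
  obtain ⟨h, hh, e⟩ := hf
  obtain rfl : f = N.d ∘ₗ h + (ε : ℤ) • (h ∘ₗ M.d) := LinearMap.ext e
  refine ⟨add_mem (comp_mem_homDeg hh N.d_mem (by ring))
    (zsmul_mem (comp_mem_homDeg M.d_mem hh (by ring)) _), fun x => ?_⟩
  change N.d (N.d (h x) + (ε : ℤ) • h (M.d x)) =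
    (ε : ℤ) • (N.d (h (M.d x)) + (ε : ℤ) • h (M.d (M.d x)))
  rw [map_add, N.d_d, zero_add, M.d_d, map_zero, smul_zero, add_zero, map_zsmul]

/-- A null-homotopy of the second entry is used to change g by a boundary until it takes values in
N, where it is again a boundary. -/
theorem Null.to_cone {X M N : DGModule 𝒜} {f : M ⟶ N} {s : ℤ} (hN : Null X N s)
    (hM : Null X M (s + 1)) : Null X (DGKoszul.cone f) s := by
  rintro ε g hg
  obtain ⟨h, hh, e⟩ := hM (-ε) (coneSnd f ∘ₗ g)
    ⟨comp_mem_homDeg hg.1 (coneSnd_mem f) rfl, fun x => by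
      have h1 := congrArg (coneSnd f) (hg.2 x)
      rw [coneSnd_d, map_zsmul] at h1
      rw [LinearMap.comp_apply, LinearMap.comp_apply, Units.val_neg, neg_smul, ← h1, neg_neg]⟩
  have hb : IsBoundary X (DGKoszul.cone f) s ε
      ((DGKoszul.cone f).d ∘ₗ coneInr f ∘ₗ h + (ε : ℤ) • (coneInr f ∘ₗ h ∘ₗ X.d)) :=
    ⟨coneInr f ∘ₗ h, comp_mem_homDeg hh (coneInr_mem f) (by ring), fun x => rfl⟩
  have hc := hb.isCycle
  have hg' := hg.add hc
  set g' := g + ((DGKoszul.cone f).d ∘ₗ coneInr f ∘ₗ h + (ε : ℤ) • (coneInr f ∘ₗ h ∘ₗ X.d))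
    with hg'_def
  have hsnd : ∀ x, coneSnd f (g' x) = 0 := fun x => by
    have h2 : coneSnd f (g' x) = coneSnd f (g x) +
        (coneSnd f ((DGKoszul.cone f).d (coneInr f (h x))) +
          (ε : ℤ) • coneSnd f (coneInr f (h (X.d x)))) := by
      rw [← map_zsmul, ← map_add, ← map_add]; rfl
    have h3 : coneSnd f (g x) = M.d (h x) + ((-ε : ℤˣ) : ℤ) • h (X.d x) := e x
    rw [h2, h3, coneSnd_d, coneSnd_inr, coneSnd_inr, Units.val_neg, neg_smul]
    abel
  have hinl : ∀ x, coneInl f (coneFst f (g' x)) = g' x := fun x => by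
    have := coneInl_fst_add f (g' x)
    rwa [hsnd, map_zero, add_zero] at this
  obtain ⟨k, hk, e'⟩ := hN ε (coneFst f ∘ₗ g')
    ⟨comp_mem_homDeg hg'.1 (coneFst_mem f) (add_zero _), fun x => by
      have h1 := congrArg (coneFst f) (hg'.2 x)
      rw [coneFst_d, hsnd, map_zero, add_zero, map_zsmul] at h1
      exact h1⟩
  have hb' : IsBoundary X (DGKoszul.cone f) s ε g' := by
    refine ⟨coneInl f ∘ₗ k, comp_mem_homDeg hk (coneInl_mem f) (add_zero _), fun x => ?_⟩
    have h1 : g' x = coneInl f (N.d (k x) + (ε : ℤ) • k (X.d x)) :=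
      (hinl x).symm.trans (congrArg (coneInl f) (e' x))
    rw [h1, map_add, map_zsmul, ← cone_d_inl]
    rfl
  have := hb'.sub hb
  rwa [hg'_def, add_sub_cancel_right] at this

theorem Null.to_retract {X Y Z : DGModule 𝒜} {i : Y ⟶ Z} {r : Z ⟶ Y}
    (h : homotopic (i ≫ r) (𝟙 Y)) {s : ℤ} (hZ : Null X Z s) : Null X Y s := by
  intro ε f hf
  have h1 := (hZ ε _ (hf.postcomp i)).postcomp r
  obtain ⟨k, hk, e⟩ := h
  have h2 : IsBoundary X Y s ε (r.1 ∘ₗ i.1 ∘ₗ f - f) := by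
    refine ⟨k ∘ₗ f, comp_mem_homDeg hf.1 hk (by ring), fun x => ?_⟩
    have h3 : r.1 (i.1 (f x)) - f x = Y.d (k (f x)) + k (Y.d (f x)) := LinearMap.congr_fun e (f x)
    rw [hf.2, map_zsmul] at h3
    exact h3
  have := h1.sub h2
  rwa [sub_sub_cancel] at this

theorem IsPerfect.null_of_null_regular [GradedRing 𝒜] {X Y : DGModule 𝒜}
    (hY : IsPerfect 𝒜 (toHot Y)) (hX : ∀ s, Null X (DGKoszul.regular 𝒜) s) (s : ℤ) : Null X Y s :=
  isPerfect_induction (p := fun Y => ∀ s, Null X Y s) hX (fun _ _ h _ => (h _).to_shift)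
    (fun _ _ _ h h' s => (h' s).to_cone (h _)) (fun _ _ _ _ e h s => (h s).to_retract e) hY s

/-- A morphism whose mapping cone is contractible is a homotopy equivalence. -/
theorem exists_homotopy_inverse {M N : DGModule 𝒜} {f : M ⟶ N}
    (h : Null (cone f) (cone f) 0) :
    ∃ g : N ⟶ M, homotopic (f ≫ g) (𝟙 M) ∧ homotopic (g ≫ f) (𝟙 N) := by
  -- A contraction of the cone is a matrix of four maps: the entry N → M is the homotopy inverse,
  -- and the two diagonal entries supply the homotopies.
  obtain ⟨H, hH, e⟩ := h 1 _ (isCycle_hom (𝟙 (cone f)))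
  have e' : ∀ z, z = (cone f).d (H z) + H ((cone f).d z) := fun z => by
    have := e z
    rw [Units.val_one, one_smul] at this
    exact this
  have h1 : ∀ y, coneSnd f (H (coneInl f (N.d y))) = M.d (coneSnd f (H (coneInl f y))) :=
      fun y => by
    have := congrArg (coneSnd f) (e' (coneInl f y))
    rw [map_add, coneSnd_d, cone_d_inl, coneSnd_inl] at this
    exact (neg_add_eq_zero.1 this.symm).symm
  have h2 : ∀ x, coneSnd f (H (coneInl f (f.1 x))) - x = M.d (coneSnd f (H (coneInr f x))) +
      coneSnd f (H (coneInr f (M.d x))) := fun x => by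
    have := congrArg (coneSnd f) (e' (coneInr f x))
    rw [map_add, coneSnd_d, cone_d_inr, coneSnd_inr, map_sub, map_sub] at this
    nth_rw 2 [this]
    abel
  have h3 : ∀ y, f.1 (coneSnd f (H (coneInl f y))) - y =
      N.d (-(coneFst f (H (coneInl f y)))) + -(coneFst f (H (coneInl f (N.d y)))) := fun y => by
    have := congrArg (coneFst f) (e' (coneInl f y))
    rw [map_add, coneFst_d, cone_d_inl, coneFst_inl] at this
    nth_rw 2 [this]
    rw [map_neg]
    abel
  refine ⟨⟨coneSnd f ∘ₗ H ∘ₗ coneInl f, comp_mem_homDeg (comp_mem_homDeg (coneInl_mem f) hH rfl)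
    (coneSnd_mem f) (by ring), LinearMap.ext fun y => (h1 y).symm⟩,
    ⟨coneSnd f ∘ₗ H ∘ₗ coneInr f, comp_mem_homDeg (comp_mem_homDeg (coneInr_mem f) hH rfl)
      (coneSnd_mem f) (by ring), LinearMap.ext h2⟩,
    ⟨-(coneFst f ∘ₗ H ∘ₗ coneInl f),
      neg_mem (comp_mem_homDeg (comp_mem_homDeg (coneInl_mem f) hH rfl)
      (coneFst_mem f) (by ring)), LinearMap.ext h3⟩⟩

end SecondVariable

/-! ### Embeddings into powers of K(A) and linear models of objects of the heart. -/

section LinearModels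
variable {A : Type u} [Ring A] {𝒜 : ℤ → AddSubgroup A} [GradedRing 𝒜] [PosSemisimple 𝒜]

/-- A morphism of linear dg modules factors through its image, with kernel and image linear. -/
theorem exists_kernel_image {Y Z : DGModule 𝒜} (hY : Y.toGrModule.IsLinear)
    (hZ : Z.toGrModule.IsLinear) (g : Y ⟶ Z) :
    ∃ (N I : DGModule 𝒜) (S : SplitSES N Y I) (ι : I ⟶ Z) (r : Z →ₗ[Aᵐᵒᵖ] I),
      N.toGrModule.IsLinear ∧ I.toGrModule.IsLinear ∧ r ∈ homDeg Z.toGrModule I.toGrModule 0 ∧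
      (∀ x, r (ι.1 x) = x) ∧ ∀ y, ι.1 (S.q.1 y) = g.1 y := by
  obtain ⟨r, hr, hgr⟩ := hY.exists_regular hZ g.2.1
  have he : r ∘ₗ g.1 ∈ homDeg Y.toGrModule Y.toGrModule 0 := comp_mem_homDeg g.2.1 hr (add_zero 0)
  have hee : ∀ y, (r ∘ₗ g.1) ((r ∘ₗ g.1) y) = (r ∘ₗ g.1) y := fun y => congrArg r (hgr y)
  have hed : ∀ y, (r ∘ₗ g.1) (Y.d ((r ∘ₗ g.1) y)) = (r ∘ₗ g.1) (Y.d y) := fun y => by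
    change r (g.1 (Y.d (r (g.1 y)))) = r (g.1 (Y.d y))
    rw [← DGModule.hom_d, hgr, DGModule.hom_d]
  -- Since g r g = g, the idempotent r g has the same kernel as g, which is stable under the
  -- differential; its image is a model of the image of g.
  let S := SplitSES.ofIdempotent Y (r ∘ₗ g.1) he hee hed
  refine ⟨_, _, S, ⟨g.1 ∘ₗ S.j, comp_mem_homDeg S.j_mem g.2.1 (add_zero 0),
    LinearMap.ext fun x => ?_⟩, S.q.1 ∘ₗ r,
    hY.corner (he := id_sub_mem_homDeg he) fun y => ?_, hY.corner (he := he) hee,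
    comp_mem_homDeg hr S.q.2.1 (add_zero 0), fun x => ?_, hgr⟩
  · have h1 : S.j (S.q.1 (Y.d (S.j x))) = r (g.1 (Y.d (S.j x))) := rfl
    have h2 := DGModule.hom_d S.q (S.j x)
    rw [S.q_j] at h2
    change Z.d (g.1 (S.j x)) = g.1 (S.j (_ : _))
    rw [h2, h1, hgr, DGModule.hom_d]
  · change y - (r ∘ₗ g.1) y - (r ∘ₗ g.1) (y - (r ∘ₗ g.1) y) = y - (r ∘ₗ g.1) y
    rw [map_sub, hee, sub_self, sub_zero]
  · refine Eq.trans ?_ (S.q_j x)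
    have h1 : S.q.1 (r (g.1 (S.j x))) = S.q.1 (S.j (S.q.1 (S.j x))) := rfl
    exact h1.trans (by rw [S.q_j])

namespace KoszulResolution

variable (P : KoszulResolution 𝒜) (hlen : P.FiniteLength) (hfg : P.FinitelyGenerated)

/-- The augmentation on a component of a finite power of `K(A)`. -/
noncomputable def augPow {n : ℕ} (i : Fin n) : P.K.pow n →ₗ[Aᵐᵒᵖ] degZero 𝒜 :=
  P.augLin ∘ₗ P.K.toGrModule.powProj i

/-- Finitely many classes generate H⁰(M, A⁰) over End(A⁰); each lifts to a map M → K, and together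
they form α. -/
theorem exists_resSurjective (hlen : P.FiniteLength) (hfg : P.FinitelyGenerated)
    {M : DGModule 𝒜} (hM : IsPerfect 𝒜 (toHot M)) :
    ∃ (n : ℕ) (α : M ⟶ P.K.pow n), ResSurjective α := by
  obtain ⟨G, hG, hGZ, hZ⟩ := hM.resFinite 0
  obtain ⟨n, g, rfl⟩ := Submodule.fg_iff_exists_fin_generating_family.1 hG
  choose a ha hab using fun i => P.exists_lift_aug hlen hM (hGZ (Submodule.subset_span ⟨i, rfl⟩)) 1
  have hlin := (P.isLinear_K hlen hfg).pow n
  refine ⟨n, DGModule.powLift fun i => (ha i).hom, fun ψ hψ => ?_⟩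
  obtain ⟨x, hx, y, hy, rfl⟩ := Submodule.mem_sup.1 (hZ hψ)
  obtain ⟨c, rfl⟩ := (Submodule.mem_span_range_iff_exists_fun _).1 hx
  refine ⟨∑ i, c i • P.augPow i, GrModule.IsLinear.mem_resCycles (Y := P.K.pow n) hlin _, ?_⟩
  have h1 : (∑ i, c i • P.augPow i) ∘ₗ (DGModule.powLift fun i => (ha i).hom).1 =
      ∑ i, c i • (P.augLin ∘ₗ a i) := LinearMap.ext fun x => by
    rw [LinearMap.comp_apply, LinearMap.sum_apply, LinearMap.sum_apply]
    rfl
  rw [h1, add_sub_right_comm, ← Finset.sum_sub_distrib]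
  refine add_mem (sum_mem fun i _ => ?_) hy
  rw [← smul_sub]
  exact Submodule.smul_mem _ _ (hab i)

/-- If every functional to A⁰ factors through α, then α is split injective as a graded map, since A⁰
detects nonzero elements of Y / Y A⁺. The cokernel is then a graded retract of Kⁿ. -/
theorem exists_embedding (hlen : P.FiniteLength) (hfg : P.FinitelyGenerated)
    {Y : DGModule 𝒜} (hY : Y.toGrModule.IsLinear) (hYp : IsPerfect 𝒜 (toHot Y)) :
    ∃ (n : ℕ) (C : DGModule 𝒜) (S : SplitSES Y (P.K.pow n) C), C.toGrModule.IsLinear ∧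
      IsPerfect 𝒜 (toHot C) ∧ ResSurjective S.φ := by
  obtain ⟨n, α, hα⟩ := P.exists_resSurjective hlen hfg hYp
  have hKn : (P.K.pow n).toGrModule.IsLinear := (P.isLinear_K hlen hfg).pow n
  obtain ⟨r, hr, hαr⟩ := hY.exists_regular hKn α.2.1
  have h1 : r ∘ₗ α.1 = LinearMap.id := generated_hom_ext hY.generated fun v hv => by
    by_contra hne
    -- This defect has degree zero and is killed by α, because α r α = α. A functional that is
    -- nonzero on it could not factor through α.
    have hz : v - r (α.1 v) ≠ 0 := sub_ne_zero.2 (Ne.symm hne)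
    have hz0 : v - r (α.1 v) ∈ Y.deg 0 := by
      have := hr _ _ (α.2.1 0 v hv)
      simp only [add_zero] at this
      exact sub_mem hv this
    have hz1 : (mulPos Y.toGrModule).mkQ (v - r (α.1 v)) ≠ 0 := fun h =>
      hz (eq_zero_of_mem_mulPos hY.generated ((Submodule.Quotient.mk_eq_zero _).1 h) hz0)
    obtain ⟨k, hk⟩ := (isTrivialMod_bar Y.toGrModule).exists_ne_zero hz1
    obtain ⟨k', -, hk'⟩ := hα _ (hY.mem_resCycles (k ∘ₗ (mulPos Y.toGrModule).mkQ))
    have h2 := LinearMap.congr_fun (hY.eq_zero_of_mem_resBoundaries hk') (v - r (α.1 v))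
    have h3 : α.1 (v - r (α.1 v)) = 0 := by rw [map_sub, hαr, sub_self]
    rw [LinearMap.sub_apply, LinearMap.comp_apply (f := k'), h3, map_zero, sub_zero] at h2
    exact hk h2
  have h2 : ∀ y, r (α.1 y) = y := LinearMap.congr_fun h1
  refine ⟨n, _, SplitSES.ofSplitMono α r hr h2, ?_,
    (SplitSES.ofSplitMono α r hr h2).isPerfect_quotient hYp (P.isPerfect_pow hlen hfg n), hα⟩
  exact hKn.corner (he := id_sub_comp_mem_homDeg α hr) fun y => by simp [h2]

/-- Dimension shifting along Y → Kⁿ → C moves the question from (s, Y) to (s - 1, C) with C again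
linear, because Hˢ(M, K) vanishes with Hˢ(M, A⁰). Below the bound j for M there is nothing left to
prove. -/
theorem null_of_null_residue (hlen : P.FiniteLength) (hfg : P.FinitelyGenerated)
    {M : DGModule 𝒜} (hM : IsPerfect 𝒜 (toHot M)) {t : ℤ}
    (h : ∀ s < t, Null M (residue 𝒜) s) {s : ℤ} (hs : s < t) {Y : DGModule 𝒜}
    (hY : Y.toGrModule.IsLinear) (hYp : IsPerfect 𝒜 (toHot Y)) : Null M Y s := by
  obtain ⟨j, hj⟩ := hM.exists_null_of_lt
  have key : ∀ n : ℕ, ∀ s < t, s < j + n → ∀ Y : DGModule 𝒜, Y.toGrModule.IsLinear →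
      IsPerfect 𝒜 (toHot Y) → Null M Y s := by
    intro n
    induction n with
    | zero => exact fun s _ hs Y hY _ => hj s (by simpa using hs) Y fun i hi =>
        deg_eq_bot_of_generated hY.generated hi
    | succ n ih =>
      intro s hs hsn Y hY hYp ε f hf
      obtain ⟨m, C, S, hC, hCp, -⟩ := P.exists_embedding hlen hfg hY hYp
      refine S.isBoundary_of_φ (ih (s - 1) (by omega) (by push_cast at hsn; omega) C hC hCp) ?_
      exact (P.null_K hlen hM (h s hs)).pow m ε _ (hf.postcomp S.φ)
  exact key (s - j + 1).toNat s hs (by omega) Y hY hYp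

/-- Perfect dg modules whose reduction has cohomology in degree zero only are homotopy equivalent
to linear ones. -/
theorem exists_linear_model (hlen : P.FiniteLength) (hfg : P.FinitelyGenerated)
    {M : DGModule 𝒜} (hM : IsPerfect 𝒜 (toHot M)) (h : ∀ s ≠ 0, Null M (residue 𝒜) s) :
    ∃ (N : DGModule 𝒜) (f : M ⟶ N) (g : N ⟶ M), N.toGrModule.IsLinear ∧
      IsPerfect 𝒜 (toHot N) ∧ homotopic (f ≫ g) (𝟙 M) ∧ homotopic (g ≫ f) (𝟙 N) := by
  obtain ⟨n, α, hα⟩ := P.exists_resSurjective hlen hfg hM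
  have hK := P.isLinear_K hlen hfg
  have hKn : (P.K.pow n).toGrModule.IsLinear := hK.pow n
  -- The map β on the cone of α provides the next term of a copresentation. Its restriction g
  -- satisfies g α ≃ 0, with homotopy the restriction of β to M.
  obtain ⟨m, β, hβ⟩ := P.exists_resSurjective hlen hfg
    (IsPerfect.cone α hM (P.isPerfect_pow hlen hfg n))
  have hKm : (P.K.pow m).toGrModule.IsLinear := hK.pow m
  let g : P.K.pow n ⟶ P.K.pow m := ⟨β.1 ∘ₗ coneInl α,
    comp_mem_homDeg (coneInl_mem α) β.2.1 (add_zero 0), LinearMap.ext fun x => by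
      change (P.K.pow m).d (β.1 (coneInl α x)) = β.1 (coneInl α ((P.K.pow n).d x))
      rw [DGModule.hom_d, cone_d_inl]⟩
  obtain ⟨N, I, S, ι, r, hN, hI, hr, hrι, hιq⟩ := exists_kernel_image hKn hKm g
  have hNp : IsPerfect 𝒜 (toHot N) :=
    P.isPerfect_of_injective hlen hfg hN S.φ (Function.LeftInverse.injective S.r_φ)
  have hIp : IsPerfect 𝒜 (toHot I) :=
    P.isPerfect_of_injective hlen hfg hI ι (Function.LeftInverse.injective hrι)
  let T := SplitSES.ofSplitMono ι r hr hrι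
  have hQ := hKm.corner (he := id_sub_comp_mem_homDeg ι hr) fun y => by simp [hrι]
  have hQp := T.isPerfect_quotient hIp (P.isPerfect_pow hlen hfg m)
  -- The null-homotopy of g α takes values in Kᵐ. It can be moved into the image I because H⁻¹(M, -)
  -- vanishes on the linear cokernel of I → Kᵐ.
  have hqα : IsBoundary M I 0 1 (S.q.1 ∘ₗ α.1) := by
    refine T.isBoundary_of_φ (P.null_of_null_residue hlen hfg hM (t := 0)
      (fun s hs => h s hs.ne) (by norm_num) hQ hQp) ?_
    refine ⟨β.1 ∘ₗ coneInr α, comp_mem_homDeg (coneInr_mem α) β.2.1 (by ring), fun x => ?_⟩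
    have h1 : ι.1 (S.q.1 (α.1 x)) = β.1 (coneInl α (α.1 x)) := hιq (α.1 x)
    have h2 : coneInl α (α.1 x) = (cone α).d (coneInr α x) + coneInr α (M.d x) := by
      rw [cone_d_inr, sub_add_cancel]
    have h3 : β.1 (coneInl α (α.1 x)) =
        (P.K.pow m).d (β.1 (coneInr α x)) + β.1 (coneInr α (M.d x)) := by
      rw [h2, map_add, DGModule.hom_d]
    rw [Units.val_one, one_smul]
    exact h1.trans h3
  obtain ⟨γ', hγ', hαγ⟩ := S.exists_lift (isCycle_hom α) hqα
  let γ : M ⟶ N := hγ'.hom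
  have hres : ∀ k : P.K.pow n →ₗ[Aᵐᵒᵖ] degZero 𝒜,
      k ∘ₗ α.1 - (k ∘ₗ S.φ.1) ∘ₗ γ.1 ∈ resBoundaries M 0 := fun k => by
    obtain ⟨w, hw, e⟩ := hαγ
    have hk := GrModule.IsLinear.mem_resCycles (Y := P.K.pow n) hKn k
    refine ⟨k ∘ₗ w, comp_mem_homDeg (N := (residue 𝒜).toGrModule) hw hk.1 (by ring), fun x => ?_⟩
    have h1 := congrArg k (e x)
    rw [map_add, hk.2, zero_add, Units.val_one, one_smul, LinearMap.sub_apply, map_sub] at h1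
    exact h1
  have hγ : ResSurjective γ := fun ψ hψ => by
    obtain ⟨k, -, hk⟩ := hα ψ hψ
    refine ⟨k ∘ₗ S.φ.1, hN.mem_resCycles _, ?_⟩
    have := add_mem hk (hres k)
    rwa [sub_add_sub_cancel] at this
  -- Extend k to Kⁿ by the retraction r. The homotopy for its restriction to M extends it further to
  -- the cone of α, hence it factors through β up to a boundary. On Kⁿ this says k r = l g, which
  -- vanishes on the kernel N of g.
  have hinj : ∀ k ∈ resCycles N 0, k ∘ₗ γ.1 ∈ resBoundaries M 0 → k ∈ resBoundaries N 0 := by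
    intro k _ hk
    have h1 : (k ∘ₗ S.r) ∘ₗ α.1 ∈ resBoundaries M 0 := by
      have h2 := add_mem (hres (k ∘ₗ S.r)) hk
      have h3 : (k ∘ₗ S.r) ∘ₗ S.φ.1 = k := LinearMap.ext fun y => congrArg k (S.r_φ y)
      rwa [h3, sub_add_cancel] at h2
    obtain ⟨w, hw, e⟩ := h1
    have hkr := GrModule.IsLinear.mem_resCycles (Y := P.K.pow n) hKn (k ∘ₗ S.r)
    have hc : (k ∘ₗ S.r) ∘ₗ coneFst α + w ∘ₗ coneSnd α ∈ resCycles (cone α) 0 := by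
      refine ⟨add_mem (comp_mem_homDeg (N := (residue 𝒜).toGrModule) (coneFst_mem α) hkr.1
        (by ring)) (comp_mem_homDeg (N := (residue 𝒜).toGrModule) (coneSnd_mem α) hw (by ring)),
        fun z => ?_⟩
      change (k ∘ₗ S.r) (coneFst α ((cone α).d z)) + w (coneSnd α ((cone α).d z)) = 0
      have e' : (k ∘ₗ S.r) (α.1 (coneSnd α z)) = w (M.d (coneSnd α z)) := e (coneSnd α z)
      rw [coneFst_d, coneSnd_d, map_add, hkr.2, e', map_neg, zero_add, add_neg_cancel]
    obtain ⟨l, -, hl⟩ := hβ _ hc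
    have h4 : (k ∘ₗ S.r - l ∘ₗ g.1) ∈ resBoundaries (P.K.pow n) 0 := by
      obtain ⟨b, hb, e'⟩ := hl
      refine ⟨b ∘ₗ coneInl α, comp_mem_homDeg (N := (residue 𝒜).toGrModule) (coneInl_mem α) hb
        (by ring), fun x => ?_⟩
      have h5 := e' (coneInl α x)
      rw [cone_d_inl] at h5
      refine Eq.trans ?_ h5
      change k (S.r x) - l (β.1 (coneInl α x)) =
        k (S.r (coneFst α (coneInl α x))) + w (coneSnd α (coneInl α x)) - l (β.1 (coneInl α x))
      rw [coneFst_inl, coneSnd_inl, map_zero, add_zero]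
    have h6 := GrModule.IsLinear.eq_zero_of_mem_resBoundaries (Y := P.K.pow n) hKn h4
    have h7 : k = 0 := LinearMap.ext fun y => by
      have h8 : k (S.r (S.φ.1 y)) - l (g.1 (S.φ.1 y)) = 0 := LinearMap.congr_fun h6 (S.φ.1 y)
      rw [S.r_φ, ← hιq, S.q_φ, map_zero, map_zero, sub_zero] at h8
      exact h8
    rw [h7]
    exact zero_mem _
  have hcone : ∀ s, Null (cone γ) (residue 𝒜) s := fun s => by
    by_cases hs : s = 0
    · subst hs
      exact null_residue_cone_zero (h _ (by norm_num)) hinj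
    · exact null_residue_cone h (fun s hs => hN.null_residue hs) hγ hs
  have hconep := IsPerfect.cone γ hM hNp
  -- The cone of γ has no cohomology with values in A⁰, hence none in the linear module A, hence
  -- none in any perfect module, including itself.
  obtain ⟨δ, h1, h2⟩ := exists_homotopy_inverse (hconep.null_of_null_regular (fun s =>
    P.null_of_null_residue hlen hfg hconep (t := s + 1) (fun s _ => hcone s) (by omega)
      isLinear_regular IsPerfect.regular) 0)
  exact ⟨N, γ, δ, hN, hNp, h1, h2⟩

end KoszulResolution
end LinearModels

/-! ### A formal duality criterion of Morita type. -/

section Copresentation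

variable {H : Type v} [Category.{u} H] [Preadditive H] {K : H} {T : ℕ → H}
  {π : ∀ n, Fin n → (T n ⟶ K)} {ι : ∀ n, Fin n → (K ⟶ T n)}

theorem comp_eq_sum (hπι : ∀ n, ∑ k, π n k ≫ ι n k = 𝟙 (T n)) {X : H} {n : ℕ} (φ : X ⟶ T n)
    {Z : H} (b : T n ⟶ Z) : φ ≫ b = ∑ k, (φ ≫ π n k) ≫ ι n k ≫ b := by
  have h : φ ≫ (∑ k, π n k ≫ ι n k) ≫ b = φ ≫ b := by rw [hπι, Category.id_comp]
  rw [← h, Preadditive.sum_comp, Preadditive.comp_sum]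
  simp only [Category.assoc]

/-- By End(K)-linearity, g is determined on maps that factor through φ by its values on the
coordinates of φ. -/
theorem map_comp_eq (hπι : ∀ n, ∑ k, π n k ≫ ι n k = 𝟙 (T n)) {X Y : H} {n : ℕ} (φ : Y ⟶ T n)
    (g : (preadditiveYonedaObj K).obj (Opposite.op Y) ⟶
      (preadditiveYonedaObj K).obj (Opposite.op X)) (b : T n ⟶ K) :
    (show X ⟶ K from g.hom (show Y ⟶ K from φ ≫ b)) =
      (∑ k, (show X ⟶ K from g.hom (show Y ⟶ K from φ ≫ π n k)) ≫ ι n k) ≫ b := by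
  have h1 : ((show Y ⟶ K from φ ≫ b) : (preadditiveYonedaObj K).obj (Opposite.op Y)) =
      ∑ k, (show End K from ι n k ≫ b) •
        (show (preadditiveYonedaObj K).obj (Opposite.op Y) from φ ≫ π n k) :=
    comp_eq_sum hπι φ b
  change g.hom _ = _
  rw [h1, map_sum, Preadditive.sum_comp]
  refine Finset.sum_congr rfl fun k _ => ?_
  rw [map_smul, Category.assoc]
  rfl

/-- An object `K` such that every object has a copresentation by powers of `K` on which `Hom(-, K)`
is exact, and such that submodules of `Hom(Kⁿ, K)` are kernels of restriction maps, gives an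
equivalence with finitely generated modules over the endomorphism ring. -/
theorem isEquivalence_of_copresentation
    (hπι : ∀ n, ∑ k, π n k ≫ ι n k = 𝟙 (T n))
    (hιπ : ∀ n k l, ι n k ≫ π n l = if k = l then 𝟙 K else 0)
    (hE : ∀ X : H, ∃ (n : ℕ) (φ : X ⟶ T n), (∀ (Z : H) (f : Z ⟶ X), f ≫ φ = 0 → f = 0) ∧
      (∀ c : X ⟶ K, ∃ b, c = φ ≫ b) ∧ ∃ (m : ℕ) (w : T n ⟶ T m), φ ≫ w = 0 ∧
        ∀ (Z : H) (u : Z ⟶ T n), u ≫ w = 0 → ∃ f, u = f ≫ φ)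
    (hS : ∀ (n : ℕ) (S : Submodule (End K) ((preadditiveYonedaObj K).obj (Opposite.op (T n)))),
      ∃ (N : H) (φ : N ⟶ T n), (∀ c : N ⟶ K, ∃ b, c = φ ≫ b) ∧
        ∀ c : T n ⟶ K, φ ≫ c = 0 ↔ c ∈ S) :
    ∃ hF : ∀ M : Hᵒᵖ, ModuleCat.isFG (End K) ((preadditiveYonedaObj K).obj M),
      ((ModuleCat.isFG (End K)).lift (preadditiveYonedaObj K) hF).rightOp.IsEquivalence := by
  have hF : ∀ M : Hᵒᵖ, ModuleCat.isFG (End K) ((preadditiveYonedaObj K).obj M) := fun M => by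
    obtain ⟨n, φ, -, h, -⟩ := hE M.unop
    refine ⟨?_⟩
    have : Submodule.span (End K) (Set.range fun k =>
        (show (preadditiveYonedaObj K).obj M from φ ≫ π n k)) = ⊤ := by
      rw [eq_top_iff]
      rintro c -
      obtain ⟨b, hb⟩ := h c
      have h1 : c = ∑ k, (show End K from ι n k ≫ b) •
          (show (preadditiveYonedaObj K).obj M from φ ≫ π n k) :=
        hb.trans (comp_eq_sum hπι φ b)
      rw [h1]
      exact sum_mem fun k _ => Submodule.smul_mem _ _ (Submodule.subset_span ⟨k, rfl⟩)
    rw [← this]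
    exact Submodule.fg_span (Set.finite_range _)
  have hfaith : (preadditiveYonedaObj K).Faithful := ⟨fun {Y X} f g h => by
    obtain ⟨n, φ, hφ, -, -⟩ := hE Y.unop
    have h1 : ∀ c : Y.unop ⟶ K, f.unop ≫ c = g.unop ≫ c := fun c =>
      LinearMap.congr_fun (congrArg ModuleCat.Hom.hom h) c
    have h2 : (f.unop - g.unop) ≫ φ = 0 := by
      have h3 := comp_eq_sum hπι ((f.unop - g.unop) ≫ φ) (𝟙 (T n))
      rw [Category.comp_id] at h3
      rw [h3]
      refine Finset.sum_eq_zero fun k _ => ?_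
      rw [Category.assoc (f.unop - g.unop), Preadditive.sub_comp, h1, sub_self, Limits.zero_comp]
    exact Quiver.Hom.unop_inj (sub_eq_zero.1 (hφ _ _ h2))⟩
  have hfull : (preadditiveYonedaObj K).Full := ⟨fun {Y X} g => by
    obtain ⟨n, φ, -, hgen, m, w, hφw, hw⟩ := hE Y.unop
    have key := map_comp_eq hπι φ g
    -- The tuple of images under g of the coordinates of φ. It is killed by w because φ is, so it
    -- factors through φ, and the factor induces g.
    set u : X.unop ⟶ T n :=
      ∑ k, (show X.unop ⟶ K from g.hom (show Y.unop ⟶ K from φ ≫ π n k)) ≫ ι n k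
    have huw : u ≫ w = 0 := by
      have h3 := comp_eq_sum hπι (u ≫ w) (𝟙 (T m))
      rw [Category.comp_id] at h3
      rw [h3]
      refine Finset.sum_eq_zero fun k _ => ?_
      have h4 := key (w ≫ π m k)
      have h5 : φ ≫ w ≫ π m k = 0 := by rw [← Category.assoc, hφw, Limits.zero_comp]
      rw [h5] at h4
      rw [Category.assoc u, ← h4]
      exact (congrArg (· ≫ _) (map_zero g.hom)).trans Limits.zero_comp
    obtain ⟨f, hf⟩ := hw _ u huw
    refine ⟨f.op, ModuleCat.hom_ext (LinearMap.ext fun c => ?_)⟩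
    obtain ⟨b, rfl⟩ := hgen c
    refine Eq.trans ?_ (key b).symm
    rw [hf, Category.assoc]
    rfl⟩
  refine ⟨hF, ?_⟩
  have hess : ((ModuleCat.isFG (End K)).lift (preadditiveYonedaObj K) hF).EssSurj := ⟨fun V => by
    have : Module.Finite (End K) V.obj := V.property
    obtain ⟨n, f, hf⟩ := Module.Finite.exists_fin' (End K) V.obj
    let ev : (preadditiveYonedaObj K).obj (Opposite.op (T n)) →ₗ[End K] (Fin n → End K) :=
      { toFun := fun c k => ι n k ≫ (show T n ⟶ K from c)
        map_add' := fun c c' => funext fun k => Preadditive.comp_add _ _ _ _ _ _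
        map_smul' := fun a c => funext fun k => (Category.assoc _ _ _).symm }
    have hev : Function.Surjective ev := fun e => by
      refine ⟨show T n ⟶ K from ∑ k, π n k ≫ (show K ⟶ K from e k), funext fun l => ?_⟩
      change ι n l ≫ (∑ k, π n k ≫ (show K ⟶ K from e k)) = e l
      rw [Preadditive.comp_sum, Finset.sum_eq_single l]
      · rw [← Category.assoc, hιπ, if_pos rfl]
        exact Category.id_comp _
      · intro k _ hk
        rw [← Category.assoc, hιπ, if_neg hk.symm, Limits.zero_comp]
      · intro h
        exact absurd (Finset.mem_univ l) h
    -- A finitely generated module is a quotient of Hom(Kⁿ, K). The object N on which exactly the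
    -- relations vanish has Hom(N, K) equal to this quotient.
    obtain ⟨N, φ, hgen, hker⟩ := hS n (LinearMap.ker (f ∘ₗ ev))
    let ρ := ((preadditiveYonedaObj K).map φ.op).hom
    have hρ : Function.Surjective ρ := fun c => by
      obtain ⟨b, hb⟩ := hgen c
      exact ⟨b, hb.symm⟩
    have hk : LinearMap.ker (f ∘ₗ ev) = LinearMap.ker ρ := by
      ext c
      exact (hker c).symm
    let e := ((Submodule.quotEquivOfEq _ _ hk).symm.trans
      (LinearMap.quotKerEquivOfSurjective (f ∘ₗ ev) (hf.comp hev)))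
    let e' := (LinearMap.quotKerEquivOfSurjective ρ hρ).symm.trans e
    exact ⟨Opposite.op N, ⟨ObjectProperty.isoMk _ e'.toModuleIso⟩⟩⟩
  have : ((ModuleCat.isFG (End K)).lift (preadditiveYonedaObj K) hF).IsEquivalence := {}
  infer_instance

end Copresentation

/-! ### K(A) as an injective cogenerator of the heart. -/

section HeartEquivalence
variable {A : Type u} [Ring A] {𝒜 : ℤ → AddSubgroup A} [GradedRing 𝒜]

/-- The inclusions of a finite power. -/
def DGModule.powIncl (Y : DGModule 𝒜) {n : ℕ} (k : Fin n) : Y ⟶ Y.pow n :=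
  ⟨Y.toGrModule.powSingle k, Y.toGrModule.powSingle_mem k, LinearMap.ext fun x =>
    Y.toGrModule.pow_ext fun l => by
      have h : Y.d (Y.toGrModule.powProj l (Y.toGrModule.powSingle k x)) =
          Y.toGrModule.powProj l (Y.toGrModule.powSingle k (Y.d x)) := by
        rw [Y.toGrModule.powProj_single, Y.toGrModule.powProj_single]
        split_ifs
        · rfl
        · exact map_zero _
      exact h⟩

theorem DGModule.sum_coe {X Y : DGModule 𝒜} {ι : Type*} (s : Finset ι) (f : ι → (X ⟶ Y)) :
    (∑ i ∈ s, f i).1 = ∑ i ∈ s, (f i).1 :=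
  map_sum (dgHom X Y).subtype f s

theorem DGModule.sum_powProj_incl (Y : DGModule 𝒜) (n : ℕ) :
    ∑ k : Fin n, Y.powProj k ≫ Y.powIncl k = 𝟙 (Y.pow n) := by
  refine Subtype.ext ?_
  rw [DGModule.sum_coe]
  refine LinearMap.ext fun x => ?_
  rw [LinearMap.sum_apply]
  exact Y.toGrModule.sum_powSingle x

theorem DGModule.powIncl_proj (Y : DGModule 𝒜) {n : ℕ} (k l : Fin n) :
    Y.powIncl k ≫ Y.powProj l = if k = l then 𝟙 Y else 0 := by
  refine Subtype.ext (LinearMap.ext fun x => ?_)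
  refine (Y.toGrModule.powProj_single k l x).trans ?_
  by_cases h : l = k
  · rw [if_pos h, if_pos h.symm]; rfl
  · rw [if_neg h, if_neg (Ne.symm h)]; rfl

theorem heart_iff {X : DGHot 𝒜} : heart 𝒜 X ↔ IsPerfect 𝒜 X ∧ suppBar X.as ⊆ {0} := by
  have : ({0} : Set ℤ) = Set.Iic 0 ∩ Set.Ici 0 := by
    ext; simp [le_antisymm_iff]
  rw [this, Set.subset_inter_iff]
  exact ⟨fun h => ⟨h.1.1, h.1.2, h.2.2⟩, fun h => ⟨⟨h.1, h.2.1⟩, h.1, h.2.2⟩⟩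

variable [PosSemisimple 𝒜]

/-- Linear perfect dg modules as objects of the heart. -/
def Heart.ofLinear (Y : DGModule 𝒜) (hY : Y.toGrModule.IsLinear)
    (hYp : IsPerfect 𝒜 (toHot Y)) : Heart 𝒜 :=
  ⟨toHot Y, heart_iff.2 ⟨hYp, hY.suppBar_subset⟩⟩

/-- The morphism of the heart given by a morphism of dg modules. -/
def Heart.homOf {X Y : Heart 𝒜} (f : X.obj.as ⟶ Y.obj.as) : X ⟶ Y :=
  ObjectProperty.homMk ((Quotient.functor homotopic).map f)

theorem Heart.homOf_surjective {X Y : Heart 𝒜} (f : X ⟶ Y) :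
    ∃ f' : X.obj.as ⟶ Y.obj.as, f = Heart.homOf f' := by
  obtain ⟨f', hf'⟩ := (Quotient.functor (homotopic (𝒜 := 𝒜))).map_surjective
    (X := X.obj.as) (Y := Y.obj.as) f.hom
  exact ⟨f', ObjectProperty.hom_ext _ hf'.symm⟩

theorem Heart.homOf_eq_iff {X Y : Heart 𝒜} {f g : X.obj.as ⟶ Y.obj.as} :
    (Heart.homOf f : X ⟶ Y) = Heart.homOf g ↔ homotopic f g := by
  refine Iff.trans ⟨fun h => congrArg (fun k => k.hom) h, fun h => ObjectProperty.hom_ext _ h⟩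
    (Quotient.functor_map_eq_iff homotopic f g)

/-- Passage to the heart as an additive map. -/
def Heart.homAddHom (X Y : Heart 𝒜) : (X.obj.as ⟶ Y.obj.as) →+ (X ⟶ Y) where
  toFun := Heart.homOf
  map_zero' := rfl
  map_add' _ _ := rfl

theorem Heart.null_residue (X : Heart 𝒜) {s : ℤ} (hs : s ≠ 0) : Null X.obj.as (residue 𝒜) s :=
  null_residue_of_suppBar fun h => hs (by simpa using (heart_iff.1 X.property).2 h)

theorem Heart.isPerfect (X : Heart 𝒜) : IsPerfect 𝒜 (toHot X.obj.as) := (heart_iff.1 X.property).1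

namespace KoszulResolution

variable (P : KoszulResolution 𝒜)

/-- Extension of maps to K reduces to extension of their augmentations, as Hom(-, K) and H⁰(-, A⁰)
agree on perfect modules. -/
theorem exists_comp_of_resSurjective (hlen : P.FiniteLength) {M N : DGModule 𝒜}
    (hM : IsPerfect 𝒜 (toHot M)) (hN : IsPerfect 𝒜 (toHot N)) {f : M ⟶ N} (hf : ResSurjective f)
    (c : M ⟶ P.K) : ∃ b : N ⟶ P.K, homotopic c (f ≫ b) := by
  have h1 : P.augLin ∘ₗ c.1 ∈ resCycles M 0 :=
    isCycle_residue_iff.1 ((isCycle_hom c).postcomp P.aug : IsCycle M (residue 𝒜) 0 1 _)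
  obtain ⟨k, hk, hk'⟩ := hf _ h1
  obtain ⟨b, hb, hb'⟩ := P.exists_lift_aug hlen hN hk 1
  refine ⟨hb.hom, homotopic_iff_isBoundary.2 (P.isBoundary_of_aug hlen hM
    ((isCycle_hom c).sub (isCycle_hom (f ≫ hb.hom))) ?_)⟩
  have h2 := add_mem hk' (resBoundaries_comp f hb')
  have h3 : P.augLin ∘ₗ (c.1 - (f ≫ hb.hom).1) =
      (P.augLin ∘ₗ c.1 - k ∘ₗ f.1) + (k - P.augLin ∘ₗ b) ∘ₗ f.1 := by
    rw [LinearMap.comp_sub, LinearMap.sub_comp, sub_add_sub_cancel]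
    rfl
  rw [h3]
  exact h2

theorem homotopic_of_augLin_eq (hlen : P.FiniteLength) {M : DGModule 𝒜}
    (hM : IsPerfect 𝒜 (toHot M)) {f g : M ⟶ P.K} (h : P.augLin ∘ₗ f.1 = P.augLin ∘ₗ g.1) :
    homotopic f g := by
  refine homotopic_iff_isBoundary.2 (P.isBoundary_of_aug hlen hM
    ((isCycle_hom f).sub (isCycle_hom g)) ?_)
  rw [LinearMap.comp_sub, h, sub_self]
  exact zero_mem _

/-- φ is a monomorphism in the heart, since H⁻¹(X, C) = 0 for X in the heart and C linear. -/
theorem homotopic_of_comp_φ (hlen : P.FiniteLength) (hfg : P.FinitelyGenerated)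
    (X : Heart 𝒜) {Y Z C : DGModule 𝒜} (S : SplitSES Y Z C) (hC : C.toGrModule.IsLinear)
    (hCp : IsPerfect 𝒜 (toHot C)) {f : X.obj.as ⟶ Y} (h : homotopic (f ≫ S.φ) 0) :
    homotopic f 0 := by
  refine homotopic_iff_isBoundary.2 (S.isBoundary_of_φ (P.null_of_null_residue hlen hfg X.isPerfect
    (t := 0) (fun s hs => X.null_residue hs.ne) (by norm_num) hC hCp) ?_)
  have h1 : S.φ.1 ∘ₗ (f.1 - (0 : X.obj.as ⟶ Y).1) = (f ≫ S.φ).1 - (0 : X.obj.as ⟶ Z).1 :=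
    LinearMap.ext fun x => by
      change S.φ.1 (f.1 x - 0) = S.φ.1 (f.1 x) - 0
      rw [sub_zero, sub_zero]
  rw [h1]
  exact homotopic_iff_isBoundary.1 h

/-- The dg module `K(A)ⁿ` as an object of the heart. -/
noncomputable def heartPow (hlen : P.FiniteLength) (hfg : P.FinitelyGenerated) (n : ℕ) : Heart 𝒜 :=
  Heart.ofLinear (P.K.pow n) ((P.isLinear_K hlen hfg).pow n) (P.isPerfect_pow hlen hfg n)

/-- The dg module `K(A)` as an object of the heart. -/
noncomputable def heartK (hlen : P.FiniteLength) (hfg : P.FinitelyGenerated) : Heart 𝒜 :=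
  Heart.ofLinear P.K (P.isLinear_K hlen hfg) (P.isPerfect_K hlen hfg)

/-- Embed a linear model of X in Kⁿ, then embed the linear cokernel in Kᵐ. -/
theorem exists_copresentation (hlen : P.FiniteLength) (hfg : P.FinitelyGenerated) (X : Heart 𝒜) :
    ∃ (n : ℕ) (φ : X ⟶ P.heartPow hlen hfg n),
      (∀ (Z : Heart 𝒜) (f : Z ⟶ X), f ≫ φ = 0 → f = 0) ∧
      (∀ c : X ⟶ P.heartK hlen hfg, ∃ b, c = φ ≫ b) ∧
      ∃ (m : ℕ) (w : P.heartPow hlen hfg n ⟶ P.heartPow hlen hfg m), φ ≫ w = 0 ∧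
        ∀ (Z : Heart 𝒜) (u : Z ⟶ P.heartPow hlen hfg n), u ≫ w = 0 → ∃ f, u = f ≫ φ := by
  obtain ⟨N, γ, δ, hN, hNp, hγδ, hδγ⟩ :=
    P.exists_linear_model hlen hfg X.isPerfect fun s hs => X.null_residue hs
  obtain ⟨n, C, S, hC, hCp, hS⟩ := P.exists_embedding hlen hfg hN hNp
  obtain ⟨m, C', S', hC', hCp', hS'⟩ := P.exists_embedding hlen hfg hC hCp
  let N' := Heart.ofLinear N hN hNp
  let C₀ := Heart.ofLinear C hC hCp
  let γ' : X ⟶ N' := Heart.homOf (Y := N') γ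
  let δ' : N' ⟶ X := Heart.homOf (X := N') δ
  have h1 : γ' ≫ δ' = 𝟙 X := Heart.homOf_eq_iff.2 hγδ
  have h2 : δ' ≫ γ' = 𝟙 N' := Heart.homOf_eq_iff (X := N') (Y := N') |>.2 hδγ
  let φ' : N' ⟶ P.heartPow hlen hfg n := Heart.homOf (X := N') (Y := P.heartPow hlen hfg n) S.φ
  let q' : P.heartPow hlen hfg n ⟶ C₀ := Heart.homOf (X := P.heartPow hlen hfg n) (Y := C₀) S.q
  let ψ' : C₀ ⟶ P.heartPow hlen hfg m := Heart.homOf (X := C₀) (Y := P.heartPow hlen hfg m) S'.φ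
  have hφ' : ∀ (Z : Heart 𝒜) (f : Z ⟶ N'), f ≫ φ' = 0 → f = 0 := fun Z f hf => by
    obtain ⟨f, rfl⟩ := Heart.homOf_surjective f
    refine Heart.homOf_eq_iff (Y := N') (g := 0) |>.2
      (P.homotopic_of_comp_φ hlen hfg Z S hC hCp ?_)
    exact Heart.homOf_eq_iff (Y := P.heartPow hlen hfg n) (g := 0) |>.1 hf
  have hψ' : ∀ (Z : Heart 𝒜) (f : Z ⟶ C₀), f ≫ ψ' = 0 → f = 0 := fun Z f hf => by
    obtain ⟨f, rfl⟩ := Heart.homOf_surjective f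
    refine Heart.homOf_eq_iff (Y := C₀) (g := 0) |>.2
      (P.homotopic_of_comp_φ hlen hfg Z S' hC' hCp' ?_)
    exact Heart.homOf_eq_iff (Y := P.heartPow hlen hfg m) (g := 0) |>.1 hf
  refine ⟨n, γ' ≫ φ', fun Z f hf => ?_, fun c => ?_, m, q' ≫ ψ', ?_, fun Z u hu => ?_⟩
  · rw [← Category.assoc] at hf
    have := hφ' _ _ hf
    rw [← Category.comp_id f, ← h1, ← Category.assoc, this, Limits.zero_comp]
  · obtain ⟨c', hc'⟩ := Heart.homOf_surjective (δ' ≫ c)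
    obtain ⟨b, hb⟩ := P.exists_comp_of_resSurjective hlen hNp (P.isPerfect_pow hlen hfg n) hS c'
    refine ⟨Heart.homOf (X := P.heartPow hlen hfg n) (Y := P.heartK hlen hfg) b, ?_⟩
    have h3 : δ' ≫ c = φ' ≫ Heart.homOf (X := P.heartPow hlen hfg n) (Y := P.heartK hlen hfg) b :=
      hc'.trans (Heart.homOf_eq_iff (X := N') (Y := P.heartK hlen hfg) |>.2 hb)
    rw [Category.assoc, ← h3, ← Category.assoc, h1, Category.id_comp]
  · have h3 : φ' ≫ q' = 0 := by
      refine congrArg (Heart.homOf (X := N') (Y := C₀)) (?_ : S.φ ≫ S.q = 0)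
      exact Subtype.ext (LinearMap.ext S.q_φ)
    rw [Category.assoc, ← Category.assoc φ', h3, Limits.zero_comp, Limits.comp_zero]
  · rw [← Category.assoc] at hu
    have h3 := hψ' _ _ hu
    obtain ⟨u, rfl⟩ := Heart.homOf_surjective u
    have h4 : homotopic (u ≫ S.q) 0 := Heart.homOf_eq_iff (Y := C₀) (g := 0) |>.1 h3
    have h5 := homotopic_iff_isBoundary.1 h4
    obtain ⟨f, hf, hf'⟩ := S.exists_lift (isCycle_hom u) (by
      have h6 : (u ≫ S.q).1 - (0 : Z.obj.as ⟶ C).1 = S.q.1 ∘ₗ u.1 := sub_zero _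
      rwa [h6] at h5)
    refine ⟨Heart.homOf (Y := N') hf.hom ≫ δ', ?_⟩
    rw [Category.assoc, ← Category.assoc δ', h2, Category.id_comp]
    exact Heart.homOf_eq_iff (Y := P.heartPow hlen hfg n) |>.2 (homotopic_iff_isBoundary.2 hf')

/-- For linear Y the module Hom(Y, A⁰) is its own cohomology, which is finitely generated over
End(A⁰). -/
theorem isNoetherian_resCycles {Y : DGModule 𝒜} (hY : Y.toGrModule.IsLinear)
    (hYp : IsPerfect 𝒜 (toHot Y)) :
    IsNoetherian (Module.End Aᵐᵒᵖ (degZero 𝒜)) (Y →ₗ[Aᵐᵒᵖ] degZero 𝒜) := by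
  have := isNoetherianRing_end_degZero (𝒜 := 𝒜)
  obtain ⟨G, hG, -, h⟩ := hYp.resFinite 0
  have : Module.Finite (Module.End Aᵐᵒᵖ (degZero 𝒜)) (Y →ₗ[Aᵐᵒᵖ] degZero 𝒜) := by
    refine ⟨?_⟩
    have : G = ⊤ := eq_top_iff.2 fun f _ => by
      obtain ⟨x, hx, y, hy, rfl⟩ := Submodule.mem_sup.1 (h (hY.mem_resCycles f))
      rw [hY.eq_zero_of_mem_resBoundaries hy, add_zero]
      exact hx
    rwa [← this]
  infer_instance

theorem heart_sum_proj_incl (hlen : P.FiniteLength) (hfg : P.FinitelyGenerated) (n : ℕ) :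
    ∑ k : Fin n, (Heart.homOf (P.K.powProj k) : P.heartPow hlen hfg n ⟶ P.heartK hlen hfg) ≫
      (Heart.homOf (P.K.powIncl k) : P.heartK hlen hfg ⟶ P.heartPow hlen hfg n) =
    𝟙 (P.heartPow hlen hfg n) := by
  have h := congrArg (Heart.homAddHom (P.heartPow hlen hfg n) (P.heartPow hlen hfg n))
    (P.K.sum_powProj_incl n)
  exact (map_sum (Heart.homAddHom (P.heartPow hlen hfg n) (P.heartPow hlen hfg n))
    (fun k => P.K.powProj k ≫ P.K.powIncl k) Finset.univ).symm.trans h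

theorem heart_incl_proj (hlen : P.FiniteLength) (hfg : P.FinitelyGenerated) (n : ℕ)
    (k l : Fin n) :
    (Heart.homOf (P.K.powIncl k) : P.heartK hlen hfg ⟶ P.heartPow hlen hfg n) ≫
      (Heart.homOf (P.K.powProj l) : P.heartPow hlen hfg n ⟶ P.heartK hlen hfg) =
    if k = l then 𝟙 (P.heartK hlen hfg) else 0 := by
  have h := congrArg (Heart.homAddHom (P.heartK hlen hfg) (P.heartK hlen hfg))
    (P.K.powIncl_proj k l)
  by_cases hkl : k = l
  · rw [if_pos hkl] at h ⊢
    exact h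
  · rw [if_neg hkl] at h ⊢
    exact h

/-- Finitely many elements of S have augmentations spanning those of all of S over End(A⁰). The
required N is the common kernel of these elements. -/
theorem exists_kernel_realization (hlen : P.FiniteLength) (hfg : P.FinitelyGenerated) (n : ℕ)
    (S : Submodule (End (P.heartK hlen hfg))
      ((preadditiveYonedaObj (P.heartK hlen hfg)).obj (Opposite.op (P.heartPow hlen hfg n)))) :
    ∃ (N : Heart 𝒜) (φ : N ⟶ P.heartPow hlen hfg n),
      (∀ c : N ⟶ P.heartK hlen hfg, ∃ b, c = φ ≫ b) ∧
        ∀ c : P.heartPow hlen hfg n ⟶ P.heartK hlen hfg, φ ≫ c = 0 ↔ c ∈ S := by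
  have hK := P.isLinear_K hlen hfg
  have hKn : (P.K.pow n).toGrModule.IsLinear := hK.pow n
  have hKnp := P.isPerfect_pow hlen hfg n
  have := isNoetherian_resCycles hKn hKnp
  let toH : (P.K.pow n ⟶ P.K) → (P.heartPow hlen hfg n ⟶ P.heartK hlen hfg) := fun s =>
    Heart.homOf (X := P.heartPow hlen hfg n) (Y := P.heartK hlen hfg) s
  let W : Set (P.K.pow n →ₗ[Aᵐᵒᵖ] degZero 𝒜) :=
    (fun s : P.K.pow n ⟶ P.K => P.augLin ∘ₗ s.1) '' {s | toH s ∈ S}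
  -- The finite generating set is chosen inside W itself, so that its members are augmentations of
  -- elements of S.
  obtain ⟨W', hW', hspan⟩ := (Submodule.fg_span_iff_fg_span_finset_subset W).1
    (IsNoetherian.noetherian (Submodule.span (Module.End Aᵐᵒᵖ (degZero 𝒜)) W))
  have hex : ∀ j : Fin W'.card, ∃ s : P.K.pow n ⟶ P.K, toH s ∈ S ∧
      P.augLin ∘ₗ s.1 = (W'.equivFin.symm j).1 := fun j => hW' (W'.equivFin.symm j).2
  choose s hsS hs using hex
  let v : P.K.pow n ⟶ P.K.pow W'.card := DGModule.powLift s
  obtain ⟨N, I, T, ι, r, hN, hI, hr, hrι, hιq⟩ := exists_kernel_image hKn (hK.pow W'.card) v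
  have hNp : IsPerfect 𝒜 (toHot N) :=
    P.isPerfect_of_injective hlen hfg hN T.φ (Function.LeftInverse.injective T.r_φ)
  have hT : ResSurjective T.φ := fun ψ _ =>
    ⟨ψ ∘ₗ T.r, GrModule.IsLinear.mem_resCycles (Y := P.K.pow n) hKn _, by
      have : (ψ ∘ₗ T.r) ∘ₗ T.φ.1 = ψ := LinearMap.ext fun y => congrArg ψ (T.r_φ y)
      rw [this, sub_self]
      exact zero_mem _⟩
  let N' := Heart.ofLinear N hN hNp
  refine ⟨N', Heart.homOf (X := N') (Y := P.heartPow hlen hfg n) T.φ, fun c => ?_, fun c => ?_⟩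
  · obtain ⟨c, rfl⟩ := Heart.homOf_surjective c
    obtain ⟨b, hb⟩ := P.exists_comp_of_resSurjective hlen hNp hKnp hT c
    exact ⟨Heart.homOf (X := P.heartPow hlen hfg n) (Y := P.heartK hlen hfg) b,
      Heart.homOf_eq_iff (X := N') (Y := P.heartK hlen hfg) |>.2 hb⟩
  obtain ⟨c, rfl⟩ : ∃ c' : P.K.pow n ⟶ P.K, c = toH c' := Heart.homOf_surjective c
  refine (Heart.homOf_eq_iff (X := N') (Y := P.heartK hlen hfg) (f := T.φ ≫ c) (g := 0)).trans
    ⟨fun h => ?_, fun h => ?_⟩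
  · have h1 : T.φ ≫ c = 0 := hN.eq_of_homotopic hK h
    have h1' : ∀ y, c.1 (T.φ.1 y) = 0 := fun y => LinearMap.congr_fun (congrArg Subtype.val h1) y
    -- As c vanishes on the kernel of v, its augmentation factors through the image of v; the graded
    -- retraction r extends the factor to the whole power of K. Lifting it to b presents c as v
    -- followed by b, an End(K)-combination of elements of S.
    let l : P.K.pow W'.card →ₗ[Aᵐᵒᵖ] degZero 𝒜 := P.augLin ∘ₗ c.1 ∘ₗ T.j ∘ₗ r
    have hl : l ∘ₗ v.1 = P.augLin ∘ₗ c.1 := LinearMap.ext fun y => by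
      change P.augLin (c.1 (T.j (r (v.1 y)))) = P.augLin (c.1 y)
      conv_rhs => rw [← T.add y, map_add, h1', zero_add]
      rw [← hιq, hrι]
    have hKm : (P.K.pow W'.card).toGrModule.IsLinear := hK.pow W'.card
    obtain ⟨b, hb, hb'⟩ := P.exists_lift_aug hlen (P.isPerfect_pow hlen hfg W'.card)
      (GrModule.IsLinear.mem_resCycles (Y := P.K.pow W'.card) hKm l) 1
    have hlb : l = P.augLin ∘ₗ b := sub_eq_zero.1
      (GrModule.IsLinear.eq_zero_of_mem_resBoundaries (Y := P.K.pow W'.card) hKm hb')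
    have h2 : homotopic c (v ≫ hb.hom) := P.homotopic_of_augLin_eq hlen hKnp (by
      rw [← hl, hlb]; rfl)
    have h3 := Heart.homOf_eq_iff (X := P.heartPow hlen hfg n) (Y := P.heartK hlen hfg) |>.2 h2
    let v' : P.heartPow hlen hfg n ⟶ P.heartPow hlen hfg W'.card :=
      Heart.homOf (X := P.heartPow hlen hfg n) (Y := P.heartPow hlen hfg W'.card) v
    let b' : P.heartPow hlen hfg W'.card ⟶ P.heartK hlen hfg :=
      Heart.homOf (X := P.heartPow hlen hfg W'.card) (Y := P.heartK hlen hfg) hb.hom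
    have h4 := comp_eq_sum (P.heart_sum_proj_incl hlen hfg) v' b'
    have h5 : toH c = _ := h3.trans h4
    refine (congrArg (fun c => c ∈ S) h5).mpr ?_
    exact sum_mem fun j _ => S.smul_mem
      (show End (P.heartK hlen hfg) from Heart.homOf (X := P.heartK hlen hfg)
        (Y := P.heartPow hlen hfg W'.card) (P.K.powIncl j) ≫ b') (hsS j)
  · refine P.homotopic_of_augLin_eq hlen hNp (LinearMap.ext fun y => ?_)
    have h1 : P.augLin ∘ₗ c.1 ∈ Submodule.span (Module.End Aᵐᵒᵖ (degZero 𝒜)) W :=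
      Submodule.subset_span ⟨c, h, rfl⟩
    -- Vanishing on N passes from the chosen generators to their span over End(A⁰), hence to the
    -- augmentation of every element of S.
    have h2 : ∀ k ∈ Submodule.span (Module.End Aᵐᵒᵖ (degZero 𝒜)) W, k (T.φ.1 y) = 0 := by
      rw [hspan]
      intro k hk
      induction hk using Submodule.span_induction with
      | mem w hw =>
        have h3 := hs (W'.equivFin ⟨w, hw⟩)
        rw [Equiv.symm_apply_apply] at h3
        have h4 : v.1 (T.φ.1 y) = 0 := by rw [← hιq, T.q_φ, map_zero]
        have h5 : (s (W'.equivFin ⟨w, hw⟩)).1 (T.φ.1 y) = 0 :=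
          congrArg (P.K.toGrModule.powProj (W'.equivFin ⟨w, hw⟩)) h4
        refine (LinearMap.congr_fun h3 (T.φ.1 y)).symm.trans ?_
        rw [LinearMap.comp_apply, h5, map_zero]
      | zero => rfl
      | add k k' _ _ h h' => rw [LinearMap.add_apply, h, h', add_zero]
      | smul a k _ h => exact (congrArg a h).trans (map_zero a)
    exact (h2 _ h1).trans (map_zero P.augLin).symm

theorem isEquivalence (hlen : P.FiniteLength) (hfg : P.FinitelyGenerated) :
    ∃ hF : ∀ M : (Heart 𝒜)ᵒᵖ, ModuleCat.isFG (End (P.heartK hlen hfg))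
        ((preadditiveYonedaObj (P.heartK hlen hfg)).obj M),
      ((ModuleCat.isFG (End (P.heartK hlen hfg))).lift
        (preadditiveYonedaObj (P.heartK hlen hfg)) hF).rightOp.IsEquivalence :=
  isEquivalence_of_copresentation (P.heart_sum_proj_incl hlen hfg) (P.heart_incl_proj hlen hfg)
    (P.exists_copresentation hlen hfg) (P.exists_kernel_realization hlen hfg)

end KoszulResolution

end HeartEquivalence

/-! ### Ext from a minimal projective resolution. -/

section MinimalResolutions

open Abelian

/-- Projective resolutions of `Ω 0` with syzygies `Ω n`, such that the syzygies are killed by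
morphisms to `Ω 0`. -/
structure MinimalResolution (C : Type v') [Category.{v} C] [Abelian C] where
  Q : ℕ → C
  Ω : ℕ → C
  p : ∀ n, Q n ⟶ Ω n
  i : ∀ n, Ω (n + 1) ⟶ Q n
  zero : ∀ n, i n ≫ p n = 0
  exact : ∀ n, (ShortComplex.mk (i n) (p n) (zero n)).ShortExact
  projective : ∀ n, Projective (Q n)
  minimal : ∀ (n : ℕ) (φ : Q n ⟶ Ω 0), i n ≫ φ = 0

namespace MinimalResolution

variable {C : Type v'} [Category.{v} C] [Abelian C] (X : MinimalResolution C)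

instance (n : ℕ) : Epi (X.p n) := (X.exact n).epi_g
instance (n : ℕ) : Projective (X.Q n) := X.projective n

theorem exists_factor {n : ℕ} {Y : C} (φ : X.Q n ⟶ Y) (h : X.i n ≫ φ = 0) :
    ∃ ψ : X.Ω n ⟶ Y, X.p n ≫ ψ = φ :=
  have : Epi (ShortComplex.mk (X.i n) (X.p n) (X.zero n)).g := (X.exact n).epi_g
  ⟨(X.exact n).exact.desc φ h, (X.exact n).exact.g_desc φ h⟩

/-- The morphism induced on a syzygy by a morphism to `Ω 0`. -/
noncomputable def bar {n : ℕ} (φ : X.Q n ⟶ X.Ω 0) : X.Ω n ⟶ X.Ω 0 :=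
  (X.exists_factor φ (X.minimal n φ)).choose

theorem p_bar {n : ℕ} (φ : X.Q n ⟶ X.Ω 0) : X.p n ≫ X.bar φ = φ :=
  (X.exists_factor φ (X.minimal n φ)).choose_spec

theorem bar_p_comp {n : ℕ} (ψ : X.Ω n ⟶ X.Ω 0) : X.bar (X.p n ≫ ψ) = ψ := by
  rw [← cancel_epi (X.p n), p_bar]

theorem bar_add {n : ℕ} (φ ψ : X.Q n ⟶ X.Ω 0) : X.bar (φ + ψ) = X.bar φ + X.bar ψ := by
  rw [← cancel_epi (X.p n), p_bar, Preadditive.comp_add, p_bar, p_bar]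

variable [HasExt.{u} C]

/-- The iterated extension of `Ω 0` by `Ω n`. -/
noncomputable def iter : ∀ n, Ext.{u} (X.Ω 0) (X.Ω n) n
  | 0 => Ext.mk₀ (𝟙 _)
  | n + 1 => (iter n).comp (X.exact n).extClass rfl

theorem iter_succ (n : ℕ) : X.iter (n + 1) = (X.iter n).comp (X.exact n).extClass rfl := rfl

/-- The kernel is the image of Extᵏ(Qₙ, Ω₀). For k = 0 this image is zero by minimality, for k > 0
by projectivity. -/
theorem extClass_comp_injective {n k : ℕ} {x : Ext.{u} (X.Ω (n + 1)) (X.Ω 0) k} {m : ℕ}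
    (h : 1 + k = m) (hx : (X.exact n).extClass.comp x h = 0) : x = 0 := by
  obtain ⟨y, hy⟩ := Ext.contravariant_sequence_exact₁ (X.exact n) _ x h hx
  cases k with
  | zero =>
    obtain ⟨φ, rfl⟩ := Ext.mk₀_bijective _ _ |>.2 y
    rw [← hy, Ext.mk₀_comp_mk₀, X.minimal, Ext.mk₀_zero]
  | succ k =>
    rw [← hy, (Ext.eq_zero_of_projective y : y = 0), Ext.comp_zero]

theorem extClass_comp_surjective {n k m : ℕ} (h : 1 + k = m) (y : Ext.{u} (X.Ω n) (X.Ω 0) m) :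
    ∃ x : Ext.{u} (X.Ω (n + 1)) (X.Ω 0) k, (X.exact n).extClass.comp x h = y := by
  refine Ext.contravariant_sequence_exact₃ (X.exact n) _ y ?_ h
  obtain rfl : m = k + 1 := by omega
  exact Ext.eq_zero_of_projective (P := X.Q n) _

theorem iter_comp_injective (n : ℕ) : ∀ {k m : ℕ} {x : Ext.{u} (X.Ω n) (X.Ω 0) k}
    (h : n + k = m), (X.iter n).comp x h = 0 → x = 0 := by
  induction n with
  | zero =>
    intro k m x h hx
    obtain rfl : k = m := by omega
    rwa [iter, Ext.mk₀_id_comp] at hx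
  | succ n ih =>
    intro k m x h hx
    rw [iter_succ, Ext.comp_assoc _ _ _ rfl (add_comm 1 k) (by omega)] at hx
    exact X.extClass_comp_injective _ (ih _ hx)

theorem iter_comp_surjective (n : ℕ) : ∀ {k m : ℕ} (h : n + k = m)
    (y : Ext.{u} (X.Ω 0) (X.Ω 0) m),
    ∃ x : Ext.{u} (X.Ω n) (X.Ω 0) k, (X.iter n).comp x h = y := by
  induction n with
  | zero =>
    intro k m h y
    obtain rfl : k = m := by omega
    exact ⟨y, by rw [iter, Ext.mk₀_id_comp]⟩
  | succ n ih =>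
    intro k m h y
    obtain ⟨z, hz⟩ := ih (k := k + 1) (by omega) y
    obtain ⟨x, hx⟩ := X.extClass_comp_surjective (add_comm 1 k) z
    refine ⟨x, ?_⟩
    rw [iter_succ, Ext.comp_assoc _ _ _ rfl (add_comm 1 k) (by omega), hx, hz]

/-- The extension class of a morphism from a term of the resolution. -/
noncomputable def cls (n : ℕ) : (X.Q n ⟶ X.Ω 0) →+ Ext.{u} (X.Ω 0) (X.Ω 0) n where
  toFun φ := (X.iter n).comp (Ext.mk₀ (X.bar φ)) (add_zero n)
  map_zero' := by
    have : X.bar (0 : X.Q n ⟶ X.Ω 0) = 0 := by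
      rw [← cancel_epi (X.p n), p_bar, Limits.comp_zero]
    rw [this, Ext.mk₀_zero, Ext.comp_zero]
  map_add' φ ψ := by rw [bar_add, Ext.mk₀_add, Ext.comp_add]

theorem cls_apply (n : ℕ) (φ : X.Q n ⟶ X.Ω 0) :
    X.cls n φ = (X.iter n).comp (Ext.mk₀ (X.bar φ)) (add_zero n) := rfl

/-- Minimality gives Hom(Qₙ, Ω₀) = Hom(Ωₙ, Ω₀), and iterated dimension shifting identifies the
latter with Extⁿ(Ω₀, Ω₀). -/
theorem cls_bijective (n : ℕ) : Function.Bijective (X.cls n) := by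
  constructor
  · refine (injective_iff_map_eq_zero _).2 fun φ h => ?_
    have h1 := X.iter_comp_injective n (add_zero n) h
    rw [Ext.mk₀_eq_zero_iff] at h1
    rw [← X.p_bar φ, h1, Limits.comp_zero]
  · intro y
    obtain ⟨x, hx⟩ := X.iter_comp_surjective n (add_zero n) y
    obtain ⟨ψ, rfl⟩ := Ext.mk₀_bijective _ _ |>.2 x
    exact ⟨X.p n ≫ ψ, by rw [cls_apply, bar_p_comp, hx]⟩

/-- Composition with a morphism of resolutions computes the product with its class. -/
theorem cls_comp {j : ℕ} (g : ∀ i, X.Q (j + i) ⟶ X.Q i)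
    (hg : ∀ i, (X.p (j + i + 1) ≫ X.i (j + i)) ≫ g i = g (i + 1) ≫ X.p (i + 1) ≫ X.i i)
    (i : ℕ) (φ : X.Q i ⟶ X.Ω 0) :
    X.cls (j + i) (g i ≫ φ) = (X.cls j (g 0 ≫ X.p 0)).comp (X.cls i φ) rfl := by
  have h1 : ∀ i, ∃ ω : X.Ω (j + i) ⟶ X.Ω i, X.p (j + i) ≫ ω = g i ≫ X.p i := fun i => by
    refine X.exists_factor _ ?_
    rw [← cancel_epi (X.p (j + i + 1)), ← Category.assoc, ← Category.assoc, hg,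
      Category.assoc, Category.assoc, X.zero, Limits.comp_zero, Limits.comp_zero,
      Limits.comp_zero]
  choose ω hω using h1
  have h2 : ∀ i, X.i (j + i) ≫ g i = ω (i + 1) ≫ X.i i := fun i => by
    rw [← cancel_epi (X.p (j + i + 1)), ← Category.assoc, hg]
    have : X.p (j + i + 1) ≫ ω (i + 1) = g (i + 1) ≫ X.p (i + 1) := hω (i + 1)
    rw [← Category.assoc, ← Category.assoc, this]
  -- The maps g and ω form morphisms between the syzygy sequences, so the extension classes are
  -- natural for them. Iterating this moves ω past the iterated extension.
  have h3 : ∀ i, (X.exact (j + i)).extClass.comp (Ext.mk₀ (ω (i + 1))) (add_zero 1) =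
      (Ext.mk₀ (ω i)).comp (X.exact i).extClass (zero_add 1) := fun i =>
    ShortComplex.ShortExact.extClass_naturality (X.exact (j + i)) (X.exact i)
      { τ₁ := ω (i + 1), τ₂ := g i, τ₃ := ω i, comm₁₂ := (h2 i).symm, comm₂₃ := (hω i).symm }
  have h4 : ∀ i, (X.iter (j + i)).comp (Ext.mk₀ (ω i)) (add_zero _) =
      ((X.iter j).comp (Ext.mk₀ (ω 0)) (add_zero j)).comp (X.iter i) rfl := fun i => by
    induction i with
    | zero =>
      refine Eq.symm ?_
      exact Ext.comp_mk₀_id _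
    | succ i ih =>
      have e1 : X.iter (j + (i + 1)) = (X.iter (j + i)).comp (X.exact (j + i)).extClass rfl := rfl
      rw [e1, Ext.comp_assoc_of_third_deg_zero, h3, ← Ext.comp_assoc_of_second_deg_zero, ih,
        iter_succ, Ext.comp_assoc _ _ _ rfl rfl (by omega)]
  have h5 : X.bar (g i ≫ φ) = ω i ≫ X.bar φ := by
    rw [← cancel_epi (X.p (j + i)), p_bar, ← Category.assoc, hω, Category.assoc, p_bar]
  have h6 : X.bar (g 0 ≫ X.p 0) = ω 0 := by
    rw [← cancel_epi (X.p j), p_bar]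
    exact (hω 0).symm
  rw [cls_apply, cls_apply, cls_apply, h5, h6, ← Ext.mk₀_comp_mk₀,
    ← Ext.comp_assoc_of_third_deg_zero, h4, Ext.comp_assoc_of_third_deg_zero]

end MinimalResolution

end MinimalResolutions

/-! ### The endomorphism ring of K(A) as the ring of self-extensions. -/

section ExtAlgebra

open Abelian

variable {A : Type u} [Ring A] {𝒜 : ℤ → AddSubgroup A} [GradedRing 𝒜]

theorem GrModule.IsLinear.module_projective {T : GrModule 𝒜} (hT : T.IsLinear) :
    Module.Projective Aᵐᵒᵖ T := by
  obtain ⟨n, i, p, -, -, h⟩ := hT.exists_retract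
  have e : Aᵐᵒᵖ ≃ₗ[Aᵐᵒᵖ] A := LinearEquiv.ofBijective (LinearMap.toSpanSingleton Aᵐᵒᵖ A 1)
    ⟨fun x y hxy => MulOpposite.unop_injective
      ((one_mul x.unop).symm.trans (hxy.trans (one_mul y.unop))),
      fun a => ⟨MulOpposite.op a, one_mul a⟩⟩
  have : Module.Projective Aᵐᵒᵖ ((regular 𝒜).toGrModule.pow n) :=
    Module.Projective.of_equiv (LinearEquiv.piCongrRight fun _ : Fin n => e)
  exact Module.Projective.of_split i p (LinearMap.ext h)

variable [PosSemisimple 𝒜]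

namespace KoszulResolution

variable (P : KoszulResolution 𝒜)

/-- The resolution is minimal: generators of the next term are sent to degree one, hence into the
part killed by every map to A⁰. -/
theorem comp_sd_eq_zero (hfg : P.FinitelyGenerated) {n : ℕ} (φ : P.term n →ₗ[Aᵐᵒᵖ] degZero 𝒜)
    (x : P.term (n + 1)) : φ (P.sd n x) = 0 := by
  have : φ ∘ₗ P.sd n = 0 := generated_hom_ext (P.isLinear_term hfg (n + 1)).generated
    fun v hv => (isTrivialMod_degZero (𝒜 := 𝒜)).map_mulPos φ
      (mem_mulPos_of_generated (P.isLinear_term hfg n).generated one_ne_zero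
        (by simpa using P.sd_mem n 0 v hv))
  exact LinearMap.congr_fun this x

/-- The syzygies of the Koszul resolution. -/
noncomputable def syzygy : ℕ → ModuleCat.{u} Aᵐᵒᵖ
  | 0 => ModuleCat.of Aᵐᵒᵖ (degZero 𝒜)
  | n + 1 => ModuleCat.of Aᵐᵒᵖ (LinearMap.range (P.sd n))

/-- The projections of the terms of the Koszul resolution to the syzygies. -/
noncomputable def syzygyProj : ∀ n, ModuleCat.of Aᵐᵒᵖ (P.term n) ⟶ P.syzygy n
  | 0 => ModuleCat.ofHom P.augZero
  | n + 1 => ModuleCat.ofHom (P.sd n).rangeRestrict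

/-- The inclusions of the syzygies into the terms of the Koszul resolution. -/
noncomputable def syzygyIncl (n : ℕ) : P.syzygy (n + 1) ⟶ ModuleCat.of Aᵐᵒᵖ (P.term n) :=
  ModuleCat.ofHom (LinearMap.range (P.sd n)).subtype

theorem exact_incl_proj (n : ℕ) :
    Function.Exact (P.syzygyIncl n).hom (P.syzygyProj n).hom := by
  have h1 : ∀ x, (∃ y, (P.syzygyIncl n).hom y = x) ↔ ∃ y, P.sd n y = x := fun x =>
    ⟨fun ⟨⟨_, y, hy⟩, h⟩ => ⟨y, hy.trans h⟩, fun ⟨y, hy⟩ => ⟨⟨x, y, hy⟩, rfl⟩⟩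
  cases n with
  | zero => exact fun x => (P.exact_sd_aug x).trans (h1 x).symm
  | succ n =>
    intro x
    refine Iff.trans ?_ ((P.exact_sd_sd n x).trans (h1 x).symm)
    exact ⟨fun h => congrArg Subtype.val h, fun h => Subtype.ext h⟩

/-- The Koszul resolution as a minimal resolution in the category of right modules. -/
noncomputable def minimalResolution (hfg : P.FinitelyGenerated) :
    MinimalResolution (ModuleCat.{u} Aᵐᵒᵖ) where
  Q n := ModuleCat.of Aᵐᵒᵖ (P.term n)
  Ω := P.syzygy
  p := P.syzygyProj
  i := P.syzygyIncl
  zero n := ModuleCat.hom_ext (LinearMap.ext fun x =>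
    (P.exact_incl_proj n _).2 ⟨x, rfl⟩)
  exact n :=
    { exact := (ShortComplex.ShortExact.moduleCat_exact_iff_function_exact _).2
        (P.exact_incl_proj n)
      mono_f := (ModuleCat.mono_iff_injective _).2 Subtype.val_injective
      epi_g := (ModuleCat.epi_iff_surjective _).2 (by
        cases n with
        | zero => exact P.surjective
        | succ n => exact (P.sd n).surjective_rangeRestrict) }
  projective n := (IsProjective.iff_projective _).1 (P.isLinear_term hfg n).module_projective
  minimal n φ := ModuleCat.hom_ext (LinearMap.ext fun x => by
    obtain ⟨_, y, rfl⟩ := x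
    exact P.comp_sd_eq_zero hfg φ.hom y)

/-- The extension class of a linear map from a term of the Koszul resolution. -/
noncomputable def cls (hfg : P.FinitelyGenerated) (n : ℕ) :
    (P.term n →ₗ[Aᵐᵒᵖ] degZero 𝒜) →+
      Ext.{u} (ModuleCat.of Aᵐᵒᵖ (degZero 𝒜)) (ModuleCat.of Aᵐᵒᵖ (degZero 𝒜)) n :=
  ((P.minimalResolution hfg).cls n).comp (ModuleCat.homAddEquiv (R := Aᵐᵒᵖ)
    (M := ModuleCat.of Aᵐᵒᵖ (P.term n)) (N := ModuleCat.of Aᵐᵒᵖ (degZero 𝒜))).symm.toAddMonoidHom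

theorem cls_bijective (hfg : P.FinitelyGenerated) (n : ℕ) :
    Function.Bijective (P.cls hfg n) :=
  ((P.minimalResolution hfg).cls_bijective n).comp (ModuleCat.homAddEquiv (R := Aᵐᵒᵖ)
    (M := ModuleCat.of Aᵐᵒᵖ (P.term n)) (N := ModuleCat.of Aᵐᵒᵖ (degZero 𝒜))).symm.bijective

theorem cls_augZero (hfg : P.FinitelyGenerated) : P.cls hfg 0 P.augZero = Ext.mk₀ (𝟙 _) := by
  have h : (P.minimalResolution hfg).bar ((P.minimalResolution hfg).p 0) = 𝟙 _ := by
    rw [← cancel_epi ((P.minimalResolution hfg).p 0), MinimalResolution.p_bar, Category.comp_id]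
  refine ((P.minimalResolution hfg).cls_apply 0 ((P.minimalResolution hfg).p 0)).trans ?_
  rw [h]
  exact Ext.comp_mk₀_id _

theorem cls_comp (hfg : P.FinitelyGenerated) {j : ℕ}
    (g : ∀ i, P.term (j + i) →ₗ[Aᵐᵒᵖ] P.term i)
    (hg : ∀ i x, g i (P.sd (j + i) x) = P.sd i (g (i + 1) x)) (i : ℕ)
    (φ : P.term i →ₗ[Aᵐᵒᵖ] degZero 𝒜) :
    P.cls hfg (j + i) (φ ∘ₗ g i) = (P.cls hfg j (P.augZero ∘ₗ g 0)).comp (P.cls hfg i φ) rfl :=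
  (P.minimalResolution hfg).cls_comp (fun i => ModuleCat.ofHom (g i))
    (fun i => ModuleCat.hom_ext (LinearMap.ext (hg i))) i (ModuleCat.ofHom φ)

theorem d_single_succ (n : ℕ) (x : P.term (n + 1)) :
    P.K.d (P.single (n + 1) x) = P.single n (P.sd n x) := P.ext_component fun m => by
  rw [component_d]
  by_cases h : m = n
  · subst h
    rw [component_single_same, component_single_same]
  · rw [component_single_ne _ (by omega), component_single_ne _ h, map_zero]

theorem d_single_zero (x : P.term 0) : P.K.d (P.single 0 x) = 0 := P.ext_component fun m => by
  rw [component_d, component_single_ne _ (Nat.succ_ne_zero m), map_zero, map_zero]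

/-- The matrix entries of an endomorphism of `K(A)`. -/
noncomputable def entry (g : P.K ⟶ P.K) (i n : ℕ) : P.term n →ₗ[Aᵐᵒᵖ] P.term i :=
  P.component i ∘ₗ g.1 ∘ₗ P.single n

theorem entry_apply (g : P.K ⟶ P.K) (i n : ℕ) (x : P.term n) :
    P.entry g i n x = P.component i (g.1 (P.single n x)) := rfl

/-- With the signs kept in `sd`, the entries of fixed index difference commute strictly with the
differentials, so they form a chain map without further signs. -/
theorem entry_sd (g : P.K ⟶ P.K) (i n : ℕ) (x : P.term (n + 1)) :
    P.entry g i n (P.sd n x) = P.sd i (P.entry g (i + 1) (n + 1) x) := by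
  rw [entry_apply, entry_apply, ← d_single_succ, ← DGModule.hom_d, component_d]

theorem sd_entry_zero (g : P.K ⟶ P.K) (i : ℕ) (x : P.term 0) :
    P.sd i (P.entry g (i + 1) 0 x) = 0 := by
  rw [entry_apply, ← component_d, DGModule.hom_d, d_single_zero, map_zero, map_zero]

theorem entry_mem (g : P.K ⟶ P.K) (i n : ℕ) : P.entry g i n ∈ homDeg (P.term n) (P.term i) 0 :=
  comp_mem_homDeg (comp_mem_homDeg (P.single_mem n) g.2.1 (add_zero 0)) (P.component_mem i)
    (add_zero 0)

/-- By exactness x is a boundary, and its preimage could be taken in degree -1 of the next term,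
which is zero. -/
theorem eq_zero_of_sd_eq_zero (hfg : P.FinitelyGenerated) {n : ℕ} {x : P.term (n + 1)}
    (hx : x ∈ (P.term (n + 1)).deg 0) (h : P.sd n x = 0) : x = 0 := by
  obtain ⟨z, rfl⟩ := (P.exact_sd_sd n x).1 h
  rw [← (P.term (n + 1)).proj_of_mem hx, proj_apply_of_mem_homDeg (P.sd_mem (n + 1)) (-1) 0 rfl,
    proj_eq_zero_of_generated (P.isLinear_term hfg (n + 2)).generated (by norm_num), map_zero]

/-- Endomorphisms are triangular: inductively, `sd` kills the images of the generators, and it is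
injective on them by `eq_zero_of_sd_eq_zero`. -/
theorem entry_eq_zero (hfg : P.FinitelyGenerated) (g : P.K ⟶ P.K) {i n : ℕ} (h : n < i) :
    P.entry g i n = 0 := by
  induction n generalizing i with
  | zero =>
    obtain ⟨i, rfl⟩ := Nat.exists_eq_succ_of_ne_zero h.ne'
    refine generated_hom_ext (P.isLinear_term hfg 0).generated fun v hv => ?_
    refine P.eq_zero_of_sd_eq_zero hfg ?_ (P.sd_entry_zero g i v)
    simpa using P.entry_mem g (i + 1) 0 0 v hv
  | succ n ih =>
    obtain ⟨i, rfl⟩ := Nat.exists_eq_succ_of_ne_zero (Nat.ne_zero_of_lt h)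
    refine generated_hom_ext (P.isLinear_term hfg (n + 1)).generated fun v hv => ?_
    refine P.eq_zero_of_sd_eq_zero hfg ?_ ?_
    · simpa using P.entry_mem g (i + 1) (n + 1) 0 v hv
    · change P.sd i (P.entry g (i + 1) (n + 1) v) = 0
      rw [← entry_sd, ih (by omega)]
      rfl

/-- The sum of the extension classes of the components of a linear map on `K(A)`. -/
noncomputable def toExt (hfg : P.FinitelyGenerated) (N : ℕ) :
    (P.K →ₗ[Aᵐᵒᵖ] degZero 𝒜) →+ KoszulDual 𝒜 where
  toFun k := ∑ n ∈ Finset.range N, DirectSum.of (fun n =>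
    Ext.{u} (ModuleCat.of Aᵐᵒᵖ (degZero 𝒜)) (ModuleCat.of Aᵐᵒᵖ (degZero 𝒜)) n) n
      (P.cls hfg n (k ∘ₗ P.single n))
  map_zero' := by simp
  map_add' k l := by simp [LinearMap.add_comp, Finset.sum_add_distrib]

theorem toExt_apply (hfg : P.FinitelyGenerated) (N : ℕ) (k : P.K →ₗ[Aᵐᵒᵖ] degZero 𝒜) :
    P.toExt hfg N k = ∑ n ∈ Finset.range N, DirectSum.of (fun n =>
      Ext.{u} (ModuleCat.of Aᵐᵒᵖ (degZero 𝒜)) (ModuleCat.of Aᵐᵒᵖ (degZero 𝒜)) n) n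
        (P.cls hfg n (k ∘ₗ P.single n)) := rfl

theorem toExt_apply_apply (hfg : P.FinitelyGenerated) {N n : ℕ} (hn : n < N)
    (k : P.K →ₗ[Aᵐᵒᵖ] degZero 𝒜) : P.toExt hfg N k n = P.cls hfg n (k ∘ₗ P.single n) := by
  rw [toExt_apply, DFinsupp.finsetSum_apply, Finset.sum_eq_single n]
  · exact DirectSum.of_eq_same n _
  · exact fun m _ hm => DirectSum.of_eq_of_ne m n _ hm.symm
  · exact fun h => absurd (Finset.mem_range.2 hn) h

theorem term_hom_eq_zero {N : ℕ} (hN : ∀ n ≥ N, Subsingleton (P.X n)) {n : ℕ} (hn : N ≤ n)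
    (φ : P.term n →ₗ[Aᵐᵒᵖ] degZero 𝒜) : φ = 0 := LinearMap.ext fun x => by
  have := hN n hn
  exact (congrArg φ (Subsingleton.elim (α := P.X n) x 0)).trans (map_zero φ)

theorem toExt_bijective (hfg : P.FinitelyGenerated) {N : ℕ}
    (hN : ∀ n ≥ N, Subsingleton (P.X n)) : Function.Bijective (P.toExt hfg N) := by
  constructor
  · refine (injective_iff_map_eq_zero _).2 fun k hk => LinearMap.ext fun x => ?_
    rw [← P.sum_single hN x, map_sum]
    refine Finset.sum_eq_zero fun n hn => ?_
    have h1 := P.toExt_apply_apply hfg (Finset.mem_range.1 hn) k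
    rw [hk] at h1
    have h2 : k ∘ₗ P.single n = 0 :=
      (P.cls_bijective hfg n).1 (h1.symm.trans (map_zero (P.cls hfg n)).symm)
    exact LinearMap.congr_fun h2 _
  · intro y
    choose φ hφ using fun n => (P.cls_bijective hfg n).2 (y n)
    refine ⟨∑ n ∈ Finset.range N, φ n ∘ₗ P.component n, DFinsupp.ext fun m => ?_⟩
    rcases Nat.lt_or_ge m N with h | h
    · rw [toExt_apply_apply _ _ h, ← hφ m]
      congr 1
      refine LinearMap.ext fun x => ?_
      rw [LinearMap.comp_apply, LinearMap.sum_apply, Finset.sum_eq_single m]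
      · rw [LinearMap.comp_apply, component_single_same]
      · intro n _ hn
        rw [LinearMap.comp_apply, component_single_ne _ hn, map_zero]
      · exact fun h' => absurd (Finset.mem_range.2 h) h'
    · rw [← hφ m, P.term_hom_eq_zero hN h (φ m), map_zero, toExt_apply,
        DFinsupp.finsetSum_apply]
      refine Finset.sum_eq_zero fun n hn => ?_
      exact DirectSum.of_eq_of_ne n m _ (by have := Finset.mem_range.1 hn; omega)

theorem toExt_augLin (hfg : P.FinitelyGenerated) {N : ℕ} (hN : 0 < N) :
    P.toExt hfg N P.augLin = 1 := by
  rw [toExt_apply, Finset.sum_eq_single 0]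
  · have h : P.augLin ∘ₗ P.single 0 = P.augZero := LinearMap.ext fun x =>
      congrArg P.augZero (P.component_single_same 0 x)
    rw [h, cls_augZero]
    rfl
  · intro n _ hn
    have h : P.augLin ∘ₗ P.single n = 0 := LinearMap.ext fun x =>
      (congrArg P.augZero (P.component_single_ne hn.symm x)).trans (map_zero _)
    rw [h, map_zero, map_zero]
  · exact fun h => absurd (Finset.mem_range.2 hN) h

/-- The entries of g that lower the index by j lift the class of degree j determined by g, so
composing with them is multiplying by that class. -/
theorem cls_comp_entry (hfg : P.FinitelyGenerated) (g : P.K ⟶ P.K) {i j n : ℕ} (h : j + i = n)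
    (φ : P.term i →ₗ[Aᵐᵒᵖ] degZero 𝒜) :
    P.cls hfg n (φ ∘ₗ P.entry g i n) =
      (P.cls hfg j ((P.augLin ∘ₗ g.1) ∘ₗ P.single j)).comp (P.cls hfg i φ) h := by
  subst h
  exact P.cls_comp hfg (fun i => P.entry g i (j + i)) (fun i x => P.entry_sd g i (j + i) x) i φ

/-- Expand the composite through the components i of K. The term with source index n is the product
of classes of degrees i and n - i. -/
theorem toExt_comp (hfg : P.FinitelyGenerated) {N : ℕ} (hN : ∀ n ≥ N, Subsingleton (P.X n))
    (f g : P.K ⟶ P.K) : P.toExt hfg N (P.augLin ∘ₗ f.1 ∘ₗ g.1) =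
      P.toExt hfg N (P.augLin ∘ₗ f.1) * P.toExt hfg N (P.augLin ∘ₗ g.1) := by
  let o := DirectSum.of (fun n =>
    Ext.{u} (ModuleCat.of Aᵐᵒᵖ (degZero 𝒜)) (ModuleCat.of Aᵐᵒᵖ (degZero 𝒜)) n)
  let t : ℕ → ℕ → KoszulDual 𝒜 := fun n i =>
    o n (P.cls hfg n (((P.augLin ∘ₗ f.1) ∘ₗ P.single i) ∘ₗ P.entry g i n))
  have h1 : P.toExt hfg N (P.augLin ∘ₗ f.1 ∘ₗ g.1) =
      ∑ n ∈ Finset.range N, ∑ i ∈ Finset.range N, t n i := by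
    rw [toExt_apply]
    refine Finset.sum_congr rfl fun n _ => ?_
    have : (P.augLin ∘ₗ f.1 ∘ₗ g.1) ∘ₗ P.single n = ∑ i ∈ Finset.range N,
        ((P.augLin ∘ₗ f.1) ∘ₗ P.single i) ∘ₗ P.entry g i n := LinearMap.ext fun x => by
      have h := congrArg (P.augLin ∘ₗ f.1) (P.sum_single hN (g.1 (P.single n x)))
      rw [map_sum] at h
      rw [LinearMap.sum_apply]
      exact h.symm
    rw [this, map_sum, map_sum]
  have h2 : P.toExt hfg N (P.augLin ∘ₗ f.1) * P.toExt hfg N (P.augLin ∘ₗ g.1) =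
      ∑ i ∈ Finset.range N, ∑ j ∈ Finset.range N, t (i + j) i := by
    rw [toExt_apply, toExt_apply, Finset.sum_mul_sum]
    refine Finset.sum_congr rfl fun i _ => Finset.sum_congr rfl fun j _ => ?_
    rw [DirectSum.of_mul_of]
    exact congrArg (o (i + j)) (P.cls_comp_entry hfg g (add_comm j i) _).symm
  rw [h1, h2, Finset.sum_comm]
  refine Finset.sum_congr rfl fun i _ => ?_
  -- To match the ranges of summation: the terms with n ≥ N vanish since the resolution has ended,
  -- and those with n < i vanish by triangularity.
  have h3 : ∑ n ∈ Finset.range (i + N), t n i = ∑ n ∈ Finset.range N, t n i := by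
    rw [add_comm i N, Finset.sum_range_add, add_eq_left]
    refine Finset.sum_eq_zero fun k _ => ?_
    change o _ (P.cls hfg (N + k) _) = 0
    rw [P.term_hom_eq_zero hN (Nat.le_add_right N k) (_ ∘ₗ _), map_zero, map_zero]
  rw [← h3, Finset.sum_range_add, add_eq_right]
  refine Finset.sum_eq_zero fun n hn => ?_
  change o _ (P.cls hfg n _) = 0
  rw [P.entry_eq_zero hfg g (Finset.mem_range.1 hn), LinearMap.comp_zero, map_zero, map_zero]

/-- Composition with the augmentation identifies endomorphisms of `K(A)` with linear maps. -/
theorem augLin_comp_bijective (hlen : P.FiniteLength) (hfg : P.FinitelyGenerated) :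
    Function.Bijective fun f : P.K ⟶ P.K => P.augLin ∘ₗ f.1 := by
  have hK := P.isLinear_K hlen hfg
  have hKp := P.isPerfect_K hlen hfg
  constructor
  · intro f g h
    exact hK.eq_of_homotopic hK (P.homotopic_of_augLin_eq hlen hKp h)
  · intro k
    obtain ⟨b, hb, hb'⟩ := P.exists_lift_aug hlen hKp (hK.mem_resCycles k) 1
    exact ⟨hb.hom, (sub_eq_zero.1 (hK.eq_zero_of_mem_resBoundaries hb')).symm⟩

/-- As K is linear, its endomorphisms in the heart are honest endomorphisms of the dg module, and
these are read off from their augmentations. -/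
theorem nonempty_ringEquiv (hlen : P.FiniteLength) (hfg : P.FinitelyGenerated) :
    Nonempty (End (P.heartK hlen hfg) ≃+* KoszulDual 𝒜) := by
  have hK := P.isLinear_K hlen hfg
  obtain ⟨N, hN⟩ := id hlen
  -- The bound is raised to N + 1 so that index 0, which carries the unit, is in range even if N =
  -- 0.
  have hN' : ∀ n ≥ N + 1, Subsingleton (P.X n) := fun n hn => hN n (by omega)
  let Ψ : End P.K →+* End (P.heartK hlen hfg) :=
    { toFun := fun f => (Heart.homOf f : P.heartK hlen hfg ⟶ P.heartK hlen hfg)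
      map_one' := rfl
      map_mul' := fun _ _ => rfl
      map_zero' := rfl
      map_add' := fun _ _ => rfl }
  have hΨ : Function.Bijective Ψ :=
    ⟨fun f g h => hK.eq_of_homotopic hK
      (Heart.homOf_eq_iff (X := P.heartK hlen hfg) (Y := P.heartK hlen hfg) |>.1 h), fun f => by
      obtain ⟨f', hf'⟩ := Heart.homOf_surjective f
      exact ⟨f', hf'.symm⟩⟩
  let Θ : End P.K →+* KoszulDual 𝒜 :=
    { toFun := fun f => P.toExt hfg (N + 1) (P.augLin ∘ₗ f.1)
      map_one' := P.toExt_augLin hfg (Nat.succ_pos N)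
      map_mul' := fun f g => P.toExt_comp hfg hN' f g
      map_zero' := (congrArg (P.toExt hfg (N + 1)) (LinearMap.comp_zero P.augLin)).trans
        (map_zero _)
      map_add' := fun f g => (congrArg (P.toExt hfg (N + 1))
        (LinearMap.comp_add f.1 g.1 P.augLin)).trans (map_add _ _ _) }
  have hΘ : Function.Bijective Θ :=
    (P.toExt_bijective hfg hN').comp (P.augLin_comp_bijective hlen hfg)
  exact ⟨(RingEquiv.ofBijective Ψ hΨ).symm.trans (RingEquiv.ofBijective Θ hΘ)⟩

end KoszulResolution

end ExtAlgebra

end DGKoszul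

theorem theorem9p3 {A : Type u} [Ring A] (𝒜 : ℤ → AddSubgroup A) [GradedRing 𝒜]
    (hA : DGKoszul.IsKoszulRing 𝒜) (P : DGKoszul.KoszulResolution 𝒜)
    (hlen : P.FiniteLength) (hfg : P.FinitelyGenerated) :
    ∃ K : DGKoszul.Heart 𝒜, K.obj = DGKoszul.toHot P.K ∧
      (∃ hF : ∀ M : (DGKoszul.Heart 𝒜)ᵒᵖ,
          ModuleCat.isFG (End K) ((preadditiveYonedaObj K).obj M),
        ((ModuleCat.isFG (End K)).lift (preadditiveYonedaObj K) hF).rightOp.IsEquivalence) ∧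
      Nonempty (End K ≃+* DGKoszul.KoszulDual 𝒜) := by
  have : DGKoszul.PosSemisimple 𝒜 := ⟨hA.positive, hA.semisimple⟩
  exact ⟨P.heartK hlen hfg, rfl, P.isEquivalence hlen hfg, P.nonempty_ringEquiv hlen hfg⟩
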